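/- Let $d\in\mathbb N$, $\gamma>0$, and let $V:\mathbb R^d\to\mathbb R$ be a smooth potential whose derivatives of order $\ge 2$ are all bounded and with $e^{-V}\in L^1(\mathbb R^d)$. Put $$\mu_\infty(v)=\frac{e^{-|v|^2/2}}{(2\pi)^{d/2}},\qquad \rho_\infty(x)=\frac{e^{-V(x)}}{\int e^{-V}\,dx},\qquad \mathcal M(x,v)=\rho_\infty(x)\mu_\infty(v),$$ and let $B^2=\{f: f/\mathcal M^{1/2}\in L^2(dx\,dv)\}$ with norm $\|f\|_{B^2}^2=\iint |f|^2\mathcal M^{-1}\,dx\,dv$. Let $\Lambda^2-1$ be the closure in (complex) $B^2$, from $C_c^\infty(\mathbb R^{2d})$, of the operator $$-\gamma\,\partial_v\cdot(\partial_v+v)-\gamma\,\partial_x\cdot(\partial_x+\partial_xV).$$ It is self-adjoint and nonnegative with lowest eigenvalue $0$. Assume that it has a spectral gap $\alpha>0$, i.e. that $\alpha>0$ is the infimum of its spectrum without $0$. Consider the Cauchy problem $$\partial_t f+v\cdot\partial_x f-\partial_xV(x)\cdot\partial_v f=\gamma\Big(\mu_\infty\int f(t,x,w)\,dw-f\Big),\qquad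 f|_{t=0}=f_0. \tag{1}$$ A solution of (1) in $B^2$ is a curve $f\in C([0,\infty);B^2)$ with $f(0)=f_0$ such that for all $t\ge0$ the integral $\int_0^t f(s)\,ds$ lies in the domain of $T$ and $f(t)=f_0+T\int_0^t f(s)\,ds$, where $T$ is the closure in $B^2$, from $C_c^\infty(\mathbb R^{2d})$, of $-v\cdot\partial_x+\partial_xV\cdot\partial_v+Q$ with $Qf=\gamma(\mu_\infty\int f\,dw-f)$. Then there is a constant $A>0$, depending only on $d$, $\gamma$ and on bounds for the second and third order derivatives of $V$, such that for every $f_0\in B^2$ with $f_0\ge 0$ and $\|f_0\|_{L^1}=1$, problem (1) has a unique solution $f$ in $B^2$, and for all $t\ge 0$: $f(t)\ge0$ almost everywhere, $f(t)\ln(f(t)/\mathcal M)$ is integrable (with $0\ln 0=0$), and $$0\le H(f(t)|\mathcal M):=\iint f(t)\ln\Big(\frac{f(t)}{\mathcal M}\Big)dx\,dv\le 3\,\|f_0\|_{B^2}\,\|f_0-\mathcal M\|_{B^2}\,e^{-\alpha^2t/A}.$$ -/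

import Mathlib

open MeasureTheory
open scoped ContDiff NNReal

noncomputable section

namespace RelaxationBoltzmann

/-- Position space, and also velocity space. -/
abbrev E (d : ℕ) := EuclideanSpace ℝ (Fin d)

/-- `V` is a confining potential: it is smooth, all its derivatives of order two or more are
bounded, and `exp (-V)` is integrable. -/
structure IsConfining {d : ℕ} (V : E d → ℝ) : Prop where
  smooth : ContDiff ℝ ∞ V
  bounded : ∀ n : ℕ, 2 ≤ n → ∃ C : ℝ, ∀ x, ‖iteratedFDeriv ℝ n V x‖ ≤ C
  integrable : Integrable (fun x => Real.exp (-V x))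

/-- The Maxwellian in velocity. -/
def muInf {d : ℕ} (v : E d) : ℝ := Real.exp (-‖v‖ ^ 2 / 2) / (2 * Real.pi) ^ ((d : ℝ) / 2)

/-- The spatial Maxwellian. -/
def rhoInf {d : ℕ} (V : E d → ℝ) (x : E d) : ℝ := Real.exp (-V x) / ∫ y, Real.exp (-V y)

/-- The global Maxwellian, a function of `z = (x, v)`. -/
def maxwellian {d : ℕ} (V : E d → ℝ) (z : E d × E d) : ℝ := rhoInf V z.1 * muInf z.2

/-- The measure with density `1 / maxwellian` with respect to `dx dv`. -/
def weight {d : ℕ} (V : E d → ℝ) : Measure (E d × E d) :=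
  volume.withDensity (fun z => ENNReal.ofReal (maxwellian V z)⁻¹)

/-- The weighted space `B²`, with real (`𝕜 = ℝ`) or complex (`𝕜 = ℂ`) valued functions. -/
abbrev B2 (𝕜 : Type) [RCLike 𝕜] {d : ℕ} (V : E d → ℝ) := Lp 𝕜 2 (weight V)

/-- The norm of `B²`, for a function. -/
def b2Norm {d : ℕ} (V : E d → ℝ) (g : E d × E d → ℝ) : ℝ :=
  Real.sqrt (∫ z, |g z| ^ 2 * (maxwellian V z)⁻¹)

section Operators

variable {𝕜 : Type} [RCLike 𝕜] {d : ℕ}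

/-- The partial derivative of `φ` in the position coordinate `j`. -/
def dX (j : Fin d) (φ : E d × E d → 𝕜) (z : E d × E d) : 𝕜 :=
  fderiv ℝ φ z (EuclideanSpace.single j 1, 0)

/-- The partial derivative of `φ` in the velocity coordinate `j`. -/
def dV (j : Fin d) (φ : E d × E d → 𝕜) (z : E d × E d) : 𝕜 :=
  fderiv ℝ φ z (0, EuclideanSpace.single j 1)

/-- The partial derivative of the potential in the coordinate `j`. -/
def gradV (V : E d → ℝ) (j : Fin d) (x : E d) : ℝ :=
  fderiv ℝ V x (EuclideanSpace.single j 1)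

/-- The collision operator `Q φ = γ (ρ μ_∞ - φ)`, `ρ (x) = ∫ φ (x, w) dw`. -/
def collision (γ : ℝ) (φ : E d × E d → 𝕜) (z : E d × E d) : 𝕜 :=
  γ • (muInf z.2 • (∫ w, φ (z.1, w)) - φ z)

/-- The operator `φ ↦ - v · ∂_x φ + ∂_x V · ∂_v φ + Q φ`, so that the kinetic equation reads
`∂_t f = kinetic V γ f`. -/
def kinetic (V : E d → ℝ) (γ : ℝ) (φ : E d × E d → 𝕜) (z : E d × E d) : 𝕜 :=
  -(∑ j, z.2 j • dX j φ z) + (∑ j, gradV V j z.1 • dV j φ z) + collision γ φ z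

/-- The operator `Λ² - 1`, that is `φ ↦ - γ ∂_v · (∂_v + v) φ - γ ∂_x · (∂_x + ∂_x V) φ`. -/
def lambdaSqSubOne (V : E d → ℝ) (γ : ℝ) (φ : E d × E d → 𝕜) (z : E d × E d) : 𝕜 :=
  -(γ • ∑ j, dV j (fun y => dV j φ y + y.2 j • φ y) z)
    - γ • ∑ j, dX j (fun y => dX j φ y + gradV V j y.1 • φ y) z

/-- The graph of the closure in `B²` of an operator `P` with domain the smooth compactly
supported functions. -/
def closureGraph (V : E d → ℝ) (P : (E d × E d → 𝕜) → E d × E d → 𝕜) :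
    Set (B2 𝕜 V × B2 𝕜 V) :=
  closure {p | ∃ φ : E d × E d → 𝕜, ContDiff ℝ ∞ φ ∧ HasCompactSupport φ ∧
    p.1 =ᵐ[weight V] φ ∧ p.2 =ᵐ[weight V] P φ}

end Operators

/-- The spectrum of the (closed, unbounded) operator `T` with graph `G`: the complement of the
set of the `z` for which `T - z` maps the domain of `T` one-to-one onto `H`, with a bounded
inverse. -/
def graphSpectrum {H : Type*} [NormedAddCommGroup H] [NormedSpace ℂ H] (G : Set (H × H)) :
    Set ℂ :=
  {z | (∃ C : ℝ, ∀ p ∈ G, ‖p.1‖ ≤ C * ‖p.2 - z • p.1‖) ∧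
    ∀ g : H, ∃ p ∈ G, p.2 - z • p.1 = g}ᶜ

/-- The operator `Λ² - 1` (closed in `B²`; it is self-adjoint and nonnegative, with lowest
eigenvalue `0`) has the spectral gap `α > 0`: the infimum of its spectrum without the eigenvalue
`0` is `α`. -/
def HasSpectralGap {d : ℕ} (V : E d → ℝ) (γ α : ℝ) : Prop :=
  0 < α ∧ IsGLB (Complex.re ''
    (graphSpectrum (closureGraph (𝕜 := ℂ) V (lambdaSqSubOne V γ)) \ {0})) α

/-- `f` is the (mild) solution in `B²` of `∂_t f + v · ∂_x f - ∂_x V · ∂_v f = Q f`,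
`f (0) = f₀`: it is a continuous curve in `B²`, for every `t ≥ 0` the integral `∫_0^t f (s) ds`
is in the domain of the closure `T` of the kinetic operator from the smooth compactly supported
functions, and `f (t) - f₀ = T (∫_0^t f (s) ds)`. -/
def IsSolution {d : ℕ} (V : E d → ℝ) (γ : ℝ) (f₀ : B2 ℝ V) (f : C(ℝ≥0, B2 ℝ V)) : Prop :=
  f 0 = f₀ ∧ ∀ t : ℝ≥0,
    (∫ s in (0 : ℝ)..t, f s.toNNReal, f t - f₀) ∈ closureGraph V (kinetic V γ)

/-- The integrand `g ln (g / M)` of the relative entropy with respect to the Maxwellian `M`. -/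
def entropyDensity {d : ℕ} (V : E d → ℝ) (g : E d × E d → ℝ) (z : E d × E d) : ℝ :=
  g z * Real.log (g z / maxwellian V z)

/-- The relative entropy `∬ g ln (g / M) dx dv`. -/
def relEntropy {d : ℕ} (V : E d → ℝ) (g : E d × E d → ℝ) : ℝ := ∫ z, entropyDensity V g z

end RelaxationBoltzmann

end

/-!
Write `f = h M` and let `L` be the weighted Laplacian of phase space, so that `Λ² - 1` acts on `h`
as `γ L`. On `h` the equation is `h' = X h + γ (Π - 1) h`, where the transport `X` is
antisymmetric in `L²(M dx dv)` and `Π` averages over the velocities.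

*Decay.* The norm itself only dissipates the microscopic part: its square has the derivative
`-2 γ ‖h - Π h‖ ^ 2`. The macroscopic part is recovered by adding to the squared distance to the
equilibria a small multiple of the cross term `⟪K h, h⟫`, with the corrector `K = X Π (Λ²)⁻¹`. The
velocity average of `-X X Π` is the weighted Laplacian of the density, so that the derivative of
the cross term contains the form of `1 - (Λ²)⁻¹` on `Π h`, which the spectral gap bounds below by
a multiple of `α / (1 + α)` (`inner_correctorLin_transportLin`, `IsResolvent.gap_of_kernel`). The
remaining terms pair something macroscopic with `h - Π h` and are absorbed, because `K` and the
part of `X X Π (Λ²)⁻¹` that is quadratic in the velocity are bounded. The second bound is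
Bochner's formula, and costs only a bound for the Hessian of `V` (`correctorLin_transport`). A
velocity coordinate is an eigenvector of `Λ² - 1` for the eigenvalue `γ`, hence `α ≤ γ`, and this
gives the rate `α ^ 2 / A` with `A` independent of `α` (`IsHypocoercive.decay`, `distSq_le`).

*Existence and uniqueness.* The generator `T` is dissipative, which gives uniqueness
(`IsMild.eq_of_dissipative`). For existence, by the Hille–Yosida theorem (`exists_isMild`), the
range of `l - T` must be dense for large `l`. The transport is bounded relatively to `L`, and its
commutator with `L` is bounded by `L` in the sense of forms; since `Λ²` has dense range on the
test functions, a vector `g` orthogonal to the range of `l - T` may be tested against `(Λ²)⁻¹ g`,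
which shows `g = 0` (`denseRange_sub_generator`).

*Spectral gap.* The gap is assumed for the closure of `Λ² - 1` on complex functions. The
functional calculus of the bounded operator `(Λ²)⁻¹` turns it into
`α ⟪u, (Λ² - 1) u⟫ ≤ ‖(Λ² - 1) u‖ ^ 2` (`gap_of_graphSpectrum`), which is then read on real functions (`HasSpectralGap.core`).
That the kernel is spanned by `M` holds because a function with vanishing weak gradient is
constant (`eq_smul_equil`).

*Entropy.* The squared norm of the negative part of `f` does not increase (`IsMild.nonneg`), and
the mass is conserved. For a probability density `f`, from `log s ≤ s - 1` at `s = f / M`, the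
relative entropy is at most `‖f‖ ^ 2 - 1`, the squared distance of `f` to the line of `M`
(`relEntropy_bounds`), which decays and is at most `‖f₀‖ ‖f₀ - M‖` at the start.
-/

noncomputable section

namespace RelaxationBoltzmann

open Filter Topology

set_option linter.unusedSectionVars false

/-! ### Spectral gaps of symmetric operators -/

section Gap

open scoped ComplexInnerProductSpace

variable {H : Type*} [NormedAddCommGroup H] [InnerProductSpace ℂ H] [CompleteSpace H]

/-- A spectral gap `α` of a symmetric nonnegative operator `T`, as the inequality
`α ⟪T u, u⟫ ≤ ‖T u‖ ^ 2`. Only the bounded operator `R = (1 + T)⁻¹` is used: its spectrum lies in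
`[0, 1 / (1 + α)] ∪ {1}`, where `(1 - r) (1 - (1 + α) r)` is nonnegative, and the functional calculus makes this an
inequality between operators. -/
theorem gap_of_graphSpectrum {G : Submodule ℂ (H × H)}
    (hsymm : ∀ p ∈ G, ∀ q ∈ G, ⟪p.2, q.1⟫ = ⟪p.1, q.2⟫) (hpos : ∀ p ∈ G, 0 ≤ (⟪p.2, p.1⟫).re)
    {α : ℝ} (hα : 0 < α) (hgap : IsGLB (Complex.re '' (graphSpectrum (G : Set (H × H)) \ {0})) α) :
    (∀ g, ∃ p ∈ G, p.2 + p.1 = g) ∧ ∀ p ∈ G, α * (⟪p.2, p.1⟫).re ≤ ‖p.2‖ ^ 2 := by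
  have hres : ∀ z : ℝ, z ≠ 0 → z < α →
      (∃ C : ℝ, ∀ p ∈ G, ‖p.1‖ ≤ C * ‖p.2 - (z : ℂ) • p.1‖) ∧
      ∀ g : H, ∃ p ∈ G, p.2 - (z : ℂ) • p.1 = g := by
    intro z hz hzα
    have h1 : (z : ℂ) ∉ graphSpectrum (G : Set (H × H)) := by
      intro hmem
      have := hgap.1 ⟨(z : ℂ), ⟨hmem, by simpa using hz⟩, rfl⟩
      simp only [Complex.ofReal_re] at this
      linarith
    simpa only [graphSpectrum, Set.mem_compl_iff, not_not, Set.mem_ofPred_eq, SetLike.mem_coe]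
      using h1
  obtain ⟨⟨C, hC⟩, hsurj⟩ := hres (-1) (by norm_num) (by linarith)
  have hC' : ∀ p ∈ G, ‖p.1‖ ≤ C * ‖p.2 + p.1‖ := fun p hp => by simpa using hC p hp
  have hsurj' : ∀ g, ∃ p ∈ G, p.2 + p.1 = g := fun g => by simpa using hsurj g
  refine ⟨hsurj', ?_⟩
  let S : G →ₗ[ℂ] H := (LinearMap.snd ℂ H H + LinearMap.fst ℂ H H).comp G.subtype
  have hS : ∀ p : G, S p = p.1.2 + p.1.1 := fun p => by simp [S]
  have hbij : Function.Bijective S := by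
    constructor
    · rw [← LinearMap.ker_eq_bot, LinearMap.ker_eq_bot']
      intro p hp
      rw [hS] at hp
      have h1 := hC' p.1 p.2
      rw [hp, norm_zero, mul_zero] at h1
      have h3 : p.1.1 = 0 := by simpa using h1
      have h4 : p.1.2 = 0 := by simpa [h3] using hp
      exact Subtype.ext (Prod.ext h3 h4)
    · intro g
      obtain ⟨p, hp, rfl⟩ := hsurj' g
      exact ⟨⟨p, hp⟩, hS _⟩
  let e := LinearEquiv.ofBijective S hbij
  have he : ∀ g, (e.symm g).1.2 + (e.symm g).1.1 = g := fun g => by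
    rw [← hS]; exact e.apply_symm_apply g
  let R₀ : H →ₗ[ℂ] H := (LinearMap.fst ℂ H H).comp (G.subtype.comp e.symm.toLinearMap)
  have hR₀ : ∀ g, R₀ g = (e.symm g).1.1 := fun g => by simp [R₀]
  have hRn : ∀ g, ‖R₀ g‖ ≤ C * ‖g‖ := fun g => by
    have := hC' _ (e.symm g).2
    rwa [he, ← hR₀] at this
  set R : H →L[ℂ] H := R₀.mkContinuous C hRn with hRdef
  have hR : ∀ g, R g = (e.symm g).1.1 := hR₀
  have hRG : ∀ g, (R g, g - R g) ∈ G := fun g => by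
    have : (R g, g - R g) = (e.symm g).1 := by
      ext
      · exact hR g
      · simp only [hR]; rw [sub_eq_iff_eq_add]; exact (he g).symm
    rw [this]; exact (e.symm g).2
  have hRp : ∀ p ∈ G, R (p.2 + p.1) = p.1 := fun p hp => by
    have : e.symm (p.2 + p.1) = ⟨p, hp⟩ := by
      rw [LinearEquiv.symm_apply_eq]; exact (hS ⟨p, hp⟩).symm
    rw [hR, this]
  have hRs : ∀ g h, ⟪R g, h⟫ = ⟪g, R h⟫ := fun g h => by
    have := hsymm _ (hRG g) _ (hRG h)
    simp only [inner_sub_left, inner_sub_right] at this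
    linear_combination -this
  have hRsa : IsSelfAdjoint R := by
    rw [ContinuousLinearMap.isSelfAdjoint_iff_isSymmetric]
    exact hRs
  have hR0 : 0 ≤ R := by
    rw [ContinuousLinearMap.nonneg_iff_isPositive, ContinuousLinearMap.isPositive_def']
    refine ⟨hRsa, fun g => ?_⟩
    have h1 := hpos _ (hRG g)
    have h2 : ⟪R g, g⟫ = ⟪R g, g - R g⟫ + ⟪R g, R g⟫ := by rw [← inner_add_right]; simp
    rw [ContinuousLinearMap.reApplyInnerSelf_apply, h2, map_add]
    have h3 : 0 ≤ RCLike.re ⟪R g, R g⟫ := inner_self_nonneg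
    have h4 : RCLike.re ⟪R g, g - R g⟫ = RCLike.re ⟪g - R g, R g⟫ := inner_re_symm _ _
    rw [h4]
    exact add_nonneg h1 h3
  have hR1 : 0 ≤ 1 - R := by
    rw [ContinuousLinearMap.nonneg_iff_isPositive, ContinuousLinearMap.isPositive_def']
    refine ⟨(IsSelfAdjoint.one _).sub hRsa, fun g => ?_⟩
    have h1 := hpos _ (hRG g)
    have h2 : ⟪g - R g, g⟫ = ⟪g - R g, R g⟫ + ⟪g - R g, g - R g⟫ := by
      rw [← inner_add_right, add_sub_cancel]
    rw [ContinuousLinearMap.reApplyInnerSelf_apply]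
    simp only [sub_apply, one_apply_eq_self]
    rw [h2, map_add]
    have h3 : 0 ≤ RCLike.re ⟪g - R g, g - R g⟫ := inner_self_nonneg
    exact add_nonneg h1 h3
  have hspec : ∀ r ∈ spectrum ℝ R, 0 ≤ (1 - r) * (1 - (1 + α) * r) := by
    intro r hr
    have hr0 : 0 ≤ r := spectrum_nonneg_of_nonneg hR0 hr
    have hr1 : r ≤ 1 := by
      have : 1 - r ∈ spectrum ℝ (1 - R) := by
        have := (spectrum.sub_singleton_eq R (1 : ℝ))
        have h2 : 1 - r ∈ spectrum ℝ (algebraMap ℝ (H →L[ℂ] H) 1 - R) := by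
          rw [← spectrum.singleton_sub_eq]
          exact ⟨1, rfl, r, hr, rfl⟩
        simpa using h2
      have := spectrum_nonneg_of_nonneg hR1 this
      linarith
    by_contra hneg
    push Not at hneg
    have hr1' : r < 1 := by
      rcases hr1.lt_or_eq with h | h
      · exact h
      · rw [h] at hneg; simp at hneg
    have hrα : 1 < (1 + α) * r := by
      by_contra h
      push Not at h
      exact absurd hneg (not_lt.2 (mul_nonneg (by linarith) (by linarith)))
    have hrpos : 0 < r := by
      rcases hr0.lt_or_eq with h | h
      · exact h
      · rw [← h] at hrα; simp at hrα; linarith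
    -- a spectral value `r` of the resolvent belongs to the spectral value `r⁻¹ - 1` of the operator
    obtain ⟨⟨D, hD⟩, hDs⟩ := hres (r⁻¹ - 1)
      (by
        have := one_lt_inv_iff₀.2 ⟨hrpos, hr1'⟩
        linarith)
      (by
        rw [sub_lt_iff_lt_add, inv_lt_iff_one_lt_mul₀ hrpos]; linarith)
    apply hr
    have hrc : (r : ℂ) ≠ 0 := by exact_mod_cast hrpos.ne'
    rw [spectrum.mem_resolventSet_iff, ContinuousLinearMap.isUnit_iff_bijective]
    have happ : ∀ g, (algebraMap ℝ (H →L[ℂ] H) r - R) g = (r : ℂ) • g - R g := fun g => by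
      simp [Algebra.algebraMap_eq_smul_one]
    constructor
    · rw [injective_iff_map_eq_zero]
      intro g hg
      rw [happ, sub_eq_zero] at hg
      have h1 := hD _ (hRG g)
      simp only [← hg] at h1
      have h2 : g - (r : ℂ) • g - ((r⁻¹ - 1 : ℝ) : ℂ) • (r : ℂ) • g = 0 := by
        rw [smul_smul]
        have : g - (r : ℂ) • g - (((r⁻¹ - 1 : ℝ) : ℂ) * (r : ℂ)) • g
          = ((1 : ℂ) - r - (((r⁻¹ - 1 : ℝ) : ℂ) * (r : ℂ))) • g := by
          rw [sub_smul, sub_smul, one_smul]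
        rw [this]
        have h0 : (1 : ℂ) - r - (((r⁻¹ - 1 : ℝ) : ℂ) * (r : ℂ)) = 0 := by
          push_cast; field_simp; ring
        rw [h0, zero_smul]
      rw [h2, norm_zero, mul_zero] at h1
      have h3 : (r : ℂ) • g = 0 := by simpa using h1
      simpa [hrc, hrpos.ne'] using h3
    · intro h
      obtain ⟨p, hp, hph⟩ := hDs ((r : ℂ)⁻¹ • h)
      refine ⟨p.2 + p.1, ?_⟩
      rw [happ, hRp p hp]
      have h1 : (r : ℂ) • (p.2 - ((r⁻¹ - 1 : ℝ) : ℂ) • p.1) = h := by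
        rw [hph, smul_smul, mul_inv_cancel₀ hrc, one_smul]
      rw [← h1, smul_sub, smul_add, smul_smul]
      have h2 : (r : ℂ) * ((r⁻¹ - 1 : ℝ) : ℂ) = 1 - r := by push_cast; field_simp
      rw [h2, sub_smul, one_smul]
      abel
  have hB : 0 ≤ (1 - R) * (1 - (1 + α) • R) := by
    have h1 : cfc (fun r : ℝ => (1 - r) * (1 - (1 + α) * r)) R = (1 - R) * (1 - (1 + α) • R) := by
      rw [cfc_mul (fun r : ℝ => 1 - r) (fun r : ℝ => 1 - (1 + α) * r) R,
        cfc_sub (fun _ : ℝ => (1 : ℝ)) (fun r => r) R,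
        cfc_sub (fun _ : ℝ => (1 : ℝ)) (fun r => (1 + α) * r) R,
        cfc_const_mul (1 + α) (fun r : ℝ => r) R, cfc_const_one ℝ R, cfc_id' ℝ R]
    rw [← h1]
    exact cfc_nonneg hspec
  rw [ContinuousLinearMap.nonneg_iff_isPositive, ContinuousLinearMap.isPositive_def'] at hB
  intro p hp
  -- with `p = (u, T u)`, the vector `p.2 + p.1` is `(1 + T) u`, which `R` maps to `u`
  have h1 := hB.2 (p.2 + p.1)
  rw [ContinuousLinearMap.reApplyInnerSelf_apply] at h1
  have h2 : ((1 - R) * (1 - (1 + α) • R)) (p.2 + p.1)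
      = (p.2 - (α : ℂ) • p.1) - R (p.2 - (α : ℂ) • p.1) := by
    have h3 : (1 - (1 + α) • R) (p.2 + p.1) = p.2 - (α : ℂ) • p.1 := by
      simp only [sub_apply, one_apply_eq_self, smul_apply, hRp p hp]
      rw [add_smul, one_smul, Complex.coe_smul]
      abel
    rw [mul_apply_eq_comp, h3]
    simp
  rw [h2, inner_sub_left, hRs, hRp p hp, ← inner_sub_right, add_sub_cancel_right,
    inner_sub_left, inner_smul_left] at h1
  have h5 : RCLike.re ⟪p.2, p.2⟫ = ‖p.2‖ ^ 2 := inner_self_eq_norm_sq p.2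
  have h6 : RCLike.re ⟪p.1, p.2⟫ = (⟪p.2, p.1⟫).re := inner_re_symm _ _
  rw [map_sub, h5] at h1
  have h7 : RCLike.re ((starRingEnd ℂ) (α : ℂ) * ⟪p.1, p.2⟫) = α * (⟪p.2, p.1⟫).re := by
    rw [← h6]; simp
  rw [h7] at h1
  linarith

end Gap

open scoped RealInnerProductSpace

/-! ### Mild solutions of evolution equations -/

section Mild

variable {H : Type*} [NormedAddCommGroup H] [InnerProductSpace ℝ H] [CompleteSpace H]

/-- `f` is a mild solution, started at `x`, of the evolution equation whose generator has the
graph `G`. -/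
def IsMild (G : Submodule ℝ (H × H)) (x : H) (f : C(ℝ≥0, H)) : Prop :=
  f 0 = x ∧ ∀ t : ℝ≥0, (∫ s in (0 : ℝ)..t, f s.toNNReal, f t - x) ∈ G

/-- A differential inequality for `Φ` on the graph of the generator passes to mild solutions. A mild
solution need not take values in the domain of the generator, but its averages over `[t, t + δ]` do
and solve the equation in the classical sense; the inequality holds for them, and then `δ → 0`. -/
theorem IsMild.lyapunov {G : Submodule ℝ (H × H)} {x : H} {f : C(ℝ≥0, H)} (hf : IsMild G x f)
    {Φ : H → ℝ} {Φ' : H → H →L[ℝ] ℝ} (hΦ : ∀ y, HasFDerivAt Φ (Φ' y) y) {κ : ℝ}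
    (hG : ∀ p ∈ G, Φ' p.1 p.2 ≤ -κ * Φ p.1) (t : ℝ≥0) :
    Φ (f t) ≤ Real.exp (-κ * t) * Φ x := by
  set F : ℝ → H := fun s => f s.toNNReal with hF
  have hFc : Continuous F := f.continuous.comp continuous_real_toNNReal
  set J : ℝ → H := fun t => ∫ s in (0 : ℝ)..t, F s with hJ
  have hJd : ∀ t, HasDerivAt J (F t) t := fun t =>
    intervalIntegral.integral_hasDerivAt_right (hFc.intervalIntegrable _ _)
      (hFc.stronglyMeasurableAtFilter _ _) hFc.continuousAt
  have hJG : ∀ t : ℝ, 0 ≤ t → (J t, F t - x) ∈ G := by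
    intro t ht
    lift t to ℝ≥0 using ht
    simpa [hJ, hF] using hf.2 t
  have hlim : ∀ t : ℝ, Tendsto (fun δ : ℝ => δ⁻¹ • (J (t + δ) - J t)) (𝓝[>] 0) (𝓝 (F t)) := by
    intro t
    have := (hasDerivAt_iff_tendsto_slope_zero.1 (hJd t))
    exact this.mono_left (nhdsWithin_mono _ (fun y hy => ne_of_gt hy))
  have hΦc : Continuous Φ := continuous_iff_continuousAt.2 fun y => (hΦ y).continuousAt
  have key : ∀ δ : ℝ, 0 < δ → ∀ t : ℝ, 0 ≤ t →
      Real.exp (κ * t) * Φ (δ⁻¹ • (J (t + δ) - J t)) ≤ Φ (δ⁻¹ • (J (0 + δ) - J 0)) := by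
    intro δ hδ
    set g : ℝ → H := fun t => δ⁻¹ • (J (t + δ) - J t) with hg
    have hgd : ∀ t, HasDerivAt g (δ⁻¹ • (F (t + δ) - F t)) t := fun t =>
      (((hJd (t + δ)).comp_add_const t δ).sub (hJd t)).const_smul δ⁻¹
    have hd : ∀ t, HasDerivAt (fun t => Real.exp (κ * t) * Φ (g t))
        (Real.exp (κ * t) * κ * Φ (g t)
          + Real.exp (κ * t) * Φ' (g t) (δ⁻¹ • (F (t + δ) - F t))) t := by
      intro t
      have h1 : HasDerivAt (fun t => Real.exp (κ * t)) (Real.exp (κ * t) * κ) t := by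
        simpa using ((hasDerivAt_id t).const_mul κ).exp
      exact h1.mul ((hΦ (g t)).comp_hasDerivAt t (hgd t))
    have hanti : AntitoneOn (fun t => Real.exp (κ * t) * Φ (g t)) (Set.Ici 0) := by
      apply antitoneOn_of_deriv_nonpos (convex_Ici 0)
      · exact fun t _ => (hd t).continuousAt.continuousWithinAt
      · exact fun t _ => (hd t).differentiableAt.differentiableWithinAt
      · intro t ht
        rw [interior_Ici] at ht
        rw [(hd t).deriv]
        have hmem : (g t, δ⁻¹ • (F (t + δ) - F t)) ∈ G := by
          have h1 := G.sub_mem (hJG (t + δ) (by linarith [ht.out])) (hJG t ht.out.le)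
          have h2 := G.smul_mem δ⁻¹ h1
          simpa [hg] using h2
        have := hG _ hmem
        have he := Real.exp_pos (κ * t)
        simp only at this
        nlinarith
    intro t ht
    have := hanti (Set.self_mem_Ici) (show t ∈ Set.Ici (0:ℝ) from ht) ht
    simpa [hg] using this
  have h1 : Real.exp (κ * t) * Φ (F t) ≤ Φ (F 0) := by
    refine le_of_tendsto_of_tendsto
      (((hΦc.tendsto _).comp (hlim t)).const_mul (Real.exp (κ * t)))
      ((hΦc.tendsto _).comp (hlim 0)) ?_
    filter_upwards [self_mem_nhdsWithin] with δ hδ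
    exact key δ hδ t t.2
  have h2 : F t = f t := by simp [hF]
  have h3 : F 0 = x := by simp [hF, hf.1]
  rw [h2, h3] at h1
  rw [neg_mul, Real.exp_neg, inv_mul_eq_div, le_div_iff₀ (Real.exp_pos _)]
  linarith

theorem hasFDerivAt_inner_apply (B : H →L[ℝ] H) (y : H) :
    HasFDerivAt (fun y => ⟪B y, y⟫) ((innerSL ℝ (B y)) + (innerSL ℝ y).comp B) y := by
  have := (B.hasFDerivAt (x := y)).inner ℝ (hasFDerivAt_id y)
  refine this.congr_fderiv ?_
  ext v
  simp [real_inner_comm]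

theorem IsMild.eq_of_dissipative {G : Submodule ℝ (H × H)} (hG : ∀ p ∈ G, ⟪p.2, p.1⟫ ≤ 0) {x : H}
    {f g : C(ℝ≥0, H)} (hf : IsMild G x f) (hg : IsMild G x g) : f = g := by
  have h : IsMild G 0 (f - g) := by
    refine ⟨by simp [hf.1, hg.1], fun t => ?_⟩
    have := G.sub_mem (hf.2 t) (hg.2 t)
    have hi : ∀ k : C(ℝ≥0, H), IntervalIntegrable (fun s : ℝ => k s.toNNReal) volume 0 t :=
      fun k => (k.continuous.comp continuous_real_toNNReal).intervalIntegrable _ _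
    simpa [intervalIntegral.integral_sub (hi f) (hi g)] using this
  ext t
  have := h.lyapunov (κ := 0) (hasFDerivAt_inner_apply (ContinuousLinearMap.id ℝ H)) (by
    intro p hp
    have := hG p hp
    have h2 := real_inner_comm p.1 p.2
    simp only [add_apply, innerSL_apply_apply, ContinuousLinearMap.comp_apply,
      ContinuousLinearMap.id_apply]
    simp only [neg_zero, zero_mul]
    linarith) t
  simp only [ContinuousLinearMap.id_apply, real_inner_self_eq_norm_sq] at this
  have h0 : ‖(f - g) t‖ ^ 2 ≤ 0 := by simpa using this
  have : (f - g) t = 0 := by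
    rw [← norm_eq_zero]; nlinarith [norm_nonneg ((f - g) t)]
  simpa [sub_eq_zero] using this

end Mild

/-! ### The Hille–Yosida theorem -/

section Existence

variable {H : Type*} [NormedAddCommGroup H] [InnerProductSpace ℝ H] [CompleteSpace H]

theorem norm_sq_le_of_hasDerivAt {u u' : ℝ → H} {c : ℝ} (hu : ∀ t, HasDerivAt u (u' t) t)
    (hc : ∀ t, 0 ≤ t → ⟪u' t, u t⟫ ≤ c) {t : ℝ} (ht : 0 ≤ t) :
    ‖u t‖ ^ 2 ≤ ‖u 0‖ ^ 2 + 2 * c * t := by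
  have hd : ∀ t, HasDerivAt (fun t => ‖u t‖ ^ 2 - 2 * c * t) (2 * ⟪u t, u' t⟫ - 2 * c) t := by
    intro t
    simpa using (hu t).norm_sq.fun_sub ((hasDerivAt_id t).const_mul (2 * c))
  have hanti : AntitoneOn (fun t => ‖u t‖ ^ 2 - 2 * c * t) (Set.Ici 0) := by
    apply antitoneOn_of_deriv_nonpos (convex_Ici 0)
    · exact fun t _ => (hd t).continuousAt.continuousWithinAt
    · exact fun t _ => (hd t).differentiableAt.differentiableWithinAt
    · intro t ht
      rw [interior_Ici] at ht
      rw [(hd t).deriv]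
      have := hc t ht.out.le
      rw [real_inner_comm] at this
      linarith
  have := hanti Set.self_mem_Ici (show t ∈ Set.Ici (0 : ℝ) from ht) ht
  simp only [mul_zero, sub_zero] at this
  linarith

/-- The orbit of a bounded generator. -/
def orbit (A : H →L[ℝ] H) (x : H) (t : ℝ) : H := NormedSpace.exp (t • A) x

theorem hasDerivAt_orbit (A : H →L[ℝ] H) (x : H) (t : ℝ) :
    HasDerivAt (orbit A x) (A (orbit A x t)) t := by
  have := (hasDerivAt_exp_smul_const' (𝕂 := ℝ) A t).clm_apply (hasDerivAt_const t x)
  change HasDerivAt (fun t : ℝ => NormedSpace.exp (t • A) x) _ t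
  simpa [orbit] using this

theorem orbit_zero (A : H →L[ℝ] H) (x : H) : orbit A x 0 = x := by simp [orbit]

theorem apply_orbit (A : H →L[ℝ] H) (x : H) (t : ℝ) : A (orbit A x t) = orbit A (A x) t := by
  have : Commute A (NormedSpace.exp (t • A)) := ((Commute.refl A).smul_right t).exp_right
  have := congrArg (fun B : H →L[ℝ] H => B x) this.eq
  simpa [orbit] using this

theorem orbit_sub (A : H →L[ℝ] H) (x y : H) (t : ℝ) :
    orbit A (x - y) t = orbit A x t - orbit A y t := by simp [orbit]

theorem norm_orbit_le {A : H →L[ℝ] H} (hA : ∀ y, ⟪A y, y⟫ ≤ 0) (x : H) {t : ℝ} (ht : 0 ≤ t) :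
    ‖orbit A x t‖ ≤ ‖x‖ := by
  have := norm_sq_le_of_hasDerivAt (c := 0) (hasDerivAt_orbit A x) (fun t _ => hA _) ht
  simp only [orbit_zero, mul_zero, zero_mul, add_zero] at this
  exact (pow_le_pow_iff_left₀ (norm_nonneg _) (norm_nonneg _) two_ne_zero).1 this

/-- The contraction `J = l (l - T)⁻¹` of a dissipative operator `T` with graph `G`. The Yosida
approximation of `T` is `l (J - 1)`, and `J` commutes with `T`. -/
theorem exists_resolvent {G : Submodule ℝ (H × H)} (hG : ∀ p ∈ G, ⟪p.2, p.1⟫ ≤ 0) {l : ℝ}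
    (hl : 0 < l) (hs : ∀ g, ∃ p ∈ G, l • p.1 - p.2 = g) :
    ∃ J : H →L[ℝ] H, (∀ g, ‖J g‖ ≤ ‖g‖) ∧ (∀ g, (J g, l • (J g - g)) ∈ G) ∧
      ∀ p ∈ G, l • (J p.1 - p.1) = J p.2 := by
  have hbd : ∀ p ∈ G, l * ‖p.1‖ ≤ ‖l • p.1 - p.2‖ := by
    intro p hp
    have h1 : ⟪l • p.1 - p.2, p.1⟫ ≤ ‖l • p.1 - p.2‖ * ‖p.1‖ := real_inner_le_norm _ _
    rw [inner_sub_left, real_inner_smul_left, real_inner_self_eq_norm_sq] at h1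
    have h2 := hG p hp
    rcases (norm_nonneg p.1).eq_or_lt with h | h
    · rw [← h]; simp
    · refine le_of_mul_le_mul_right ?_ h
      nlinarith
  let S : G →ₗ[ℝ] H := (l • LinearMap.fst ℝ H H - LinearMap.snd ℝ H H).comp G.subtype
  have hS : ∀ p : G, S p = l • p.1.1 - p.1.2 := fun p => by simp [S]
  have hbij : Function.Bijective S := by
    constructor
    · rw [← LinearMap.ker_eq_bot, LinearMap.ker_eq_bot']
      intro p hp
      rw [hS] at hp
      have h1 := hbd p.1 p.2
      rw [hp, norm_zero] at h1
      have h3 : ‖p.1.1‖ = 0 := by nlinarith [norm_nonneg p.1.1]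
      rw [norm_eq_zero] at h3
      have h4 : p.1.2 = 0 := by simpa [h3] using hp
      exact Subtype.ext (Prod.ext h3 h4)
    · intro g
      obtain ⟨p, hp, rfl⟩ := hs g
      exact ⟨⟨p, hp⟩, hS _⟩
  let e := LinearEquiv.ofBijective S hbij
  have he : ∀ g, l • (e.symm g).1.1 - (e.symm g).1.2 = g := fun g => by
    rw [← hS]; exact e.apply_symm_apply g
  let J₀ : H →ₗ[ℝ] H := (l • LinearMap.fst ℝ H H).comp (G.subtype.comp e.symm.toLinearMap)
  have hJ₀ : ∀ g, J₀ g = l • (e.symm g).1.1 := fun g => by simp [J₀]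
  have hJn : ∀ g, ‖J₀ g‖ ≤ 1 * ‖g‖ := fun g => by
    have := hbd _ (e.symm g).2
    rw [he] at this
    rw [hJ₀, norm_smul, one_mul]
    simpa [abs_of_pos hl] using this
  refine ⟨J₀.mkContinuous 1 hJn, fun g => by simpa using hJn g, fun g => ?_, fun p hp => ?_⟩
  · have h1 := G.smul_mem l (e.symm g).2
    have h2 : l • (e.symm g).1 = (J₀ g, l • (J₀ g - g)) := by
      ext
      · simp [hJ₀]
      · have := he g
        simp only [Prod.smul_snd, hJ₀]
        rw [← sub_eq_iff_eq_add'.2 (sub_eq_iff_eq_add.1 this)]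
    simpa [h2] using h1
  · have h1 : e.symm (l • p.1 - p.2) = ⟨p, hp⟩ := by
      rw [LinearEquiv.symm_apply_eq]; exact (hS ⟨p, hp⟩).symm
    have h2 : J₀ (l • p.1 - p.2) = l • p.1 := by rw [hJ₀, h1]
    rw [map_sub, map_smul] at h2
    simp only [LinearMap.mkContinuous_apply]
    rw [smul_sub, ← h2]; abel

/-- **Hille–Yosida**, through the Yosida approximations: a closed, densely defined, dissipative
operator for which `λ - T` is onto for all large `λ` has a mild solution for all data. -/
theorem exists_isMild {G : Submodule ℝ (H × H)} (hGc : IsClosed (G : Set (H × H)))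
    (hG : ∀ p ∈ G, ⟪p.2, p.1⟫ ≤ 0) (hd : Dense {x : H | ∃ y, (x, y) ∈ G}) {l₀ : ℝ}
    (hl₀ : 0 ≤ l₀) (hs : ∀ l, l₀ < l → ∀ g, ∃ p ∈ G, l • p.1 - p.2 = g) (x : H) :
    ∃ f : C(ℝ≥0, H), IsMild G x f := by
  set l : ℕ → ℝ := fun n => l₀ + 1 + n with hl
  have hlpos : ∀ n, 0 < l n := fun n => by positivity
  have hlinv : Tendsto (fun n => (l n)⁻¹) atTop (𝓝 0) := by
    apply Tendsto.inv_tendsto_atTop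
    exact tendsto_atTop_add_const_left _ _ tendsto_natCast_atTop_atTop
  choose J hJn hJG hJc using fun n => exists_resolvent hG (hlpos n)
    (hs (l n) (by simp only [hl]; linarith [n.cast_nonneg (α := ℝ)]))
  have hJ1 : ∀ y, Tendsto (fun n => J n y) atTop (𝓝 y) := by
    have hdom : ∀ p ∈ G, ∀ n, ‖J n p.1 - p.1‖ ≤ (l n)⁻¹ * ‖p.2‖ := by
      intro p hp n
      have h1 : J n p.1 - p.1 = (l n)⁻¹ • J n p.2 := by
        rw [← hJc n p hp, smul_smul, inv_mul_cancel₀ (hlpos n).ne', one_smul]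
      rw [h1, norm_smul, norm_inv, Real.norm_of_nonneg (hlpos n).le]
      gcongr
      exact hJn n _
    intro y
    rw [Metric.tendsto_atTop]
    intro ε hε
    obtain ⟨z, hz, w, hw⟩ := Metric.dense_iff.1 hd y (ε / 4) (by positivity)
    have h0 : Tendsto (fun n => (l n)⁻¹ * ‖w‖) atTop (𝓝 0) := by
      simpa using hlinv.mul_const ‖w‖
    obtain ⟨N, hN⟩ := (h0.eventually
      (gt_mem_nhds (show 0 < ε / 4 by positivity))).exists_forall_of_atTop
    refine ⟨N, fun n hn => ?_⟩
    rw [dist_eq_norm]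
    have h1 := hN n hn
    have h2 := hdom _ hw n
    have h3 := hJn n (y - z)
    have h4 : ‖z - y‖ < ε / 4 := by simpa [dist_eq_norm] using hz
    have h5 : J n y - y = J n (y - z) + (J n z - z) + (z - y) := by rw [map_sub]; abel
    rw [h5]
    have h6 := norm_add₃_le (a := J n (y - z)) (b := J n z - z) (c := z - y)
    rw [norm_sub_rev] at h3
    simp only at h2
    linarith
  set A : ℕ → H →L[ℝ] H := fun n => l n • (J n - 1) with hA
  have hAapp : ∀ n y, A n y = l n • (J n y - y) := fun n y => by simp [hA]
  have hAd : ∀ n y, ⟪A n y, y⟫ ≤ 0 := by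
    intro n y
    rw [hAapp, real_inner_smul_left, inner_sub_left, real_inner_self_eq_norm_sq]
    have h1 := real_inner_le_norm (J n y) y
    have h2 := hJn n y
    have h3 := norm_nonneg y
    have : ‖J n y‖ * ‖y‖ ≤ ‖y‖ * ‖y‖ := by gcongr
    apply mul_nonpos_of_nonneg_of_nonpos (hlpos n).le
    nlinarith
  -- the resolvent form of dissipativity compares the orbits of two Yosida approximations
  have hdiff : ∀ p ∈ G, ∀ n m t, 0 ≤ t → ‖orbit (A n) p.1 t - orbit (A m) p.1 t‖ ^ 2 ≤
      4 * t * ‖p.2‖ ^ 2 * ((l n)⁻¹ + (l m)⁻¹) := by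
    intro p hp n m t ht
    have hAo : ∀ n t, 0 ≤ t → ‖A n (orbit (A n) p.1 t)‖ ≤ ‖p.2‖ := by
      intro n t ht
      rw [apply_orbit]
      refine (norm_orbit_le (hAd n) _ ht).trans ?_
      rw [hAapp, hJc n p hp]
      exact hJn n _
    have h1 := norm_sq_le_of_hasDerivAt (c := 2 * ‖p.2‖ ^ 2 * ((l n)⁻¹ + (l m)⁻¹))
      (fun t => (hasDerivAt_orbit (A n) p.1 t).sub (hasDerivAt_orbit (A m) p.1 t)) (by
        intro t ht
        set a := orbit (A n) p.1 t
        set b := orbit (A m) p.1 t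
        have ha := hAo n t ht
        have hb := hAo m t ht
        have e1 : ∀ n y, y = J n y - (l n)⁻¹ • A n y := by
          intro n y
          rw [hAapp, smul_smul, inv_mul_cancel₀ (hlpos n).ne', one_smul]; abel
        have e2 : a - b = (J n a - J m b) - ((l n)⁻¹ • A n a - (l m)⁻¹ • A m b) := by
          nth_rewrite 1 [e1 n a, e1 m b]; abel
        have e3 : ⟪A n a - A m b, J n a - J m b⟫ ≤ 0 := by
          have := hG _ (G.sub_mem (hJG n a) (hJG m b))
          simpa [hAapp] using this
        have e4 : -⟪A n a - A m b, (l n)⁻¹ • A n a - (l m)⁻¹ • A m b⟫ ≤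
            (2 * ‖p.2‖) * (((l n)⁻¹ + (l m)⁻¹) * ‖p.2‖) := by
          refine (neg_le_abs _).trans ((abs_real_inner_le_norm _ _).trans ?_)
          have hn := inv_pos.2 (hlpos n)
          have hm := inv_pos.2 (hlpos m)
          gcongr
          · exact (norm_sub_le _ _).trans (by linarith)
          · refine (norm_sub_le _ _).trans ?_
            rw [norm_smul, norm_smul, Real.norm_of_nonneg hn.le, Real.norm_of_nonneg hm.le, add_mul]
            gcongr
        change ⟪A n a - A m b, a - b⟫ ≤ _
        rw [e2, inner_sub_right]
        linarith) ht
    simp only [Pi.sub_apply, orbit_zero, sub_self, norm_zero] at h1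
    linarith
  have hcauchy : ∀ T ε : ℝ, 0 ≤ T → 0 < ε → ∃ N, ∀ n, N ≤ n → ∀ m, N ≤ m → ∀ t, 0 ≤ t → t ≤ T →
      ‖orbit (A n) x t - orbit (A m) x t‖ < ε := by
    intro T ε hT hε
    obtain ⟨z, hz, w, hw⟩ := Metric.dense_iff.1 hd x (ε / 4) (by positivity)
    have hz' : ‖x - z‖ < ε / 4 := by simpa [dist_eq_norm, norm_sub_rev] using hz
    have h0 : Tendsto (fun n => 4 * T * ‖w‖ ^ 2 * (2 * (l n)⁻¹)) atTop (𝓝 0) := by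
      simpa using (hlinv.const_mul 2).const_mul (4 * T * ‖w‖ ^ 2)
    obtain ⟨N, hN⟩ := (h0.eventually
      (gt_mem_nhds (show 0 < (ε / 2) ^ 2 by positivity))).exists_forall_of_atTop
    refine ⟨N, fun n hn m hm t ht htT => ?_⟩
    have hmono : ∀ k, N ≤ k → (l k)⁻¹ ≤ (l N)⁻¹ := fun k hk => by
      apply inv_anti₀ (hlpos N); simp only [hl]; gcongr
    have h1 := hdiff _ hw n m t ht
    have h2 : 4 * t * ‖w‖ ^ 2 * ((l n)⁻¹ + (l m)⁻¹) ≤ 4 * T * ‖w‖ ^ 2 * (2 * (l N)⁻¹) := by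
      have := hmono n hn
      have := hmono m hm
      have := inv_pos.2 (hlpos n)
      have := inv_pos.2 (hlpos m)
      gcongr
      linarith
    have h3 := hN N le_rfl
    have h4 : ‖orbit (A n) z t - orbit (A m) z t‖ < ε / 2 := by
      refine lt_of_pow_lt_pow_left₀ 2 (by positivity) ?_
      simp only at h1
      linarith
    have h5 : orbit (A n) x t - orbit (A m) x t = orbit (A n) (x - z) t
        + (orbit (A n) z t - orbit (A m) z t) - orbit (A m) (x - z) t := by
      rw [orbit_sub, orbit_sub]; abel
    have h6 := norm_orbit_le (hAd n) (x - z) ht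
    have h7 := norm_orbit_le (hAd m) (x - z) ht
    rw [h5]
    refine (norm_sub_le _ _).trans_lt ?_
    have := norm_add_le (orbit (A n) (x - z) t) (orbit (A n) z t - orbit (A m) z t)
    linarith
  have hlimex : ∀ t : ℝ≥0, ∃ y, Tendsto (fun n => orbit (A n) x t) atTop (𝓝 y) := by
    intro t
    apply cauchySeq_tendsto_of_complete
    rw [Metric.cauchySeq_iff]
    intro ε hε
    obtain ⟨N, hN⟩ := hcauchy t ε t.2 hε
    exact ⟨N, fun n hn m hm => by rw [dist_eq_norm]; exact hN n hn m hm t t.2 le_rfl⟩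
  choose f hf using hlimex
  have hfc : Continuous f := by
    have hoc : ∀ n, Continuous (fun t : ℝ≥0 => orbit (A n) x t) := fun n =>
      (continuous_iff_continuousAt.2 fun t => (hasDerivAt_orbit (A n) x t).continuousAt).comp
        NNReal.continuous_coe
    have hunif : TendstoLocallyUniformly (fun n (t : ℝ≥0) => orbit (A n) x t) f atTop := by
      rw [Metric.tendstoLocallyUniformly_iff]
      intro ε hε t
      obtain ⟨N, hN⟩ := hcauchy (t + 1) (ε / 2) (by positivity) (by positivity)
      refine ⟨Set.Iio (t + 1), Iio_mem_nhds (by simp), ?_⟩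
      filter_upwards [eventually_ge_atTop N] with n hn s hs
      have : dist (f s) (orbit (A n) x s) ≤ ε / 2 := by
        refine le_of_tendsto ((hf s).dist tendsto_const_nhds) ?_
        filter_upwards [eventually_ge_atTop N] with m hm
        rw [dist_eq_norm]
        exact (hN m hm n hn s s.2 (by exact_mod_cast (Set.mem_Iio.1 hs).le)).le
      linarith
    exact hunif.continuous (Frequently.of_forall hoc)
  refine ⟨⟨f, hfc⟩, ?_, fun t => ?_⟩
  · refine tendsto_nhds_unique (hf 0) ?_
    simp [orbit_zero]
  · have hint : Tendsto (fun n => ∫ s in (0 : ℝ)..t, orbit (A n) x s) atTop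
        (𝓝 (∫ s in (0 : ℝ)..t, f s.toNNReal)) := by
      refine intervalIntegral.tendsto_integral_filter_of_dominated_convergence (fun _ => ‖x‖)
        ?_ ?_ (by simp) ?_
      · refine Eventually.of_forall fun n => Continuous.aestronglyMeasurable ?_
        exact continuous_iff_continuousAt.2 fun t => (hasDerivAt_orbit (A n) x t).continuousAt
      · refine Eventually.of_forall fun n => Eventually.of_forall fun s hs => ?_
        rw [Set.uIoc_of_le (NNReal.coe_nonneg t)] at hs
        exact norm_orbit_le (hAd n) x hs.1.le
      · refine Eventually.of_forall fun s hs => ?_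
        rw [Set.uIoc_of_le (NNReal.coe_nonneg t)] at hs
        have := hf s.toNNReal
        rwa [Real.coe_toNNReal s hs.1.le] at this
    have hmem : ∀ n, (J n (∫ s in (0 : ℝ)..t, orbit (A n) x s), orbit (A n) x t - x) ∈ G := by
      intro n
      have hc : Continuous (orbit (A n) x) :=
        continuous_iff_continuousAt.2 fun t => (hasDerivAt_orbit (A n) x t).continuousAt
      have h1 : A n (∫ s in (0 : ℝ)..t, orbit (A n) x s) = orbit (A n) x t - x := by
        rw [← ContinuousLinearMap.intervalIntegral_comp_comm _ (hc.intervalIntegrable _ _)]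
        rw [intervalIntegral.integral_eq_sub_of_hasDerivAt
          (fun s _ => hasDerivAt_orbit (A n) x s)
          (((A n).continuous.comp hc).intervalIntegrable _ _), orbit_zero]
      have := hJG n (∫ s in (0 : ℝ)..t, orbit (A n) x s)
      rwa [← hAapp, h1] at this
    refine hGc.mem_of_tendsto (b := atTop) (Tendsto.prodMk_nhds ?_ ((hf t).sub_const x))
      (Eventually.of_forall hmem)
    set y := ∫ s in (0 : ℝ)..t, f s.toNNReal
    have h2 : Tendsto (fun n => J n ((∫ s in (0 : ℝ)..t, orbit (A n) x s) - y)) atTop (𝓝 0) := by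
      refine squeeze_zero_norm (fun n => hJn n _) ?_
      have := (hint.sub_const y).norm
      simpa using this
    simpa using h2.add (hJ1 y)

end Existence

/-! ### Operators on a core and their resolvents -/

section Abstract

variable {H : Type*} [NormedAddCommGroup H] [InnerProductSpace ℝ H] [CompleteSpace H]

/-- `R` behaves like the inverse of `1 + P` for a nonnegative self-adjoint `P`. The inequality says
that `⟪P u, u⟫` is nonnegative for `u = R g`. -/
structure IsResolvent (R : H →L[ℝ] H) : Prop where
  symm : ∀ g h, ⟪R g, h⟫ = ⟪g, R h⟫
  norm_sq_le : ∀ g, ‖R g‖ ^ 2 ≤ ⟪R g, g⟫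

namespace IsResolvent

variable {R : H →L[ℝ] H} (hR : IsResolvent R)
include hR

theorem norm_le (g : H) : ‖R g‖ ≤ ‖g‖ := by
  have h1 := hR.norm_sq_le g
  have h2 := real_inner_le_norm (R g) g
  rcases (norm_nonneg (R g)).eq_or_lt with h | h
  · rw [← h]; exact norm_nonneg _
  · refine le_of_mul_le_mul_left ?_ h
    linarith [sq (‖R g‖)]

theorem inner_sub_nonneg (g : H) : 0 ≤ ⟪g - R g, g⟫ := by
  have h1 := hR.norm_sq_le g
  have h2 : ⟪g - R g, g⟫ = ‖g - R g‖ ^ 2 + (⟪R g, g⟫ - ‖R g‖ ^ 2) := by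
    rw [@norm_sub_sq_real, inner_sub_left, real_inner_self_eq_norm_sq, real_inner_comm g (R g)]
    ring
  rw [h2]; nlinarith [sq_nonneg ‖g - R g‖]

theorem inner_apply_nonneg (g : H) : 0 ≤ ⟪R g, g⟫ := (sq_nonneg _).trans (hR.norm_sq_le g)

/-- If the kernel of `P` is the line of the unit vector `e`, then `α ⟪P u, u⟫ ≤ ‖P u‖ ^ 2` gives a
Poincaré inequality, here in terms of `1 - R = P R`: it is checked on the range of `1 - R`, which is
dense in the orthogonal complement of `e`. -/
theorem gap_of_kernel {e : H} (he : ‖e‖ = 1) (hRe : R e = e)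
    (hker : ∀ g, R g = g → ∃ c : ℝ, g = c • e) {α : ℝ} (hα : 0 < α)
    (hgap : ∀ g, α * ⟪g - R g, R g⟫ ≤ ‖g - R g‖ ^ 2) (g : H) :
    α * (‖g‖ ^ 2 - ⟪g, e⟫ ^ 2) ≤ (1 + α) * ⟪g - R g, g⟫ := by
  set S : H →L[ℝ] H := ContinuousLinearMap.id ℝ H - R with hS
  have hSa : ∀ g, S g = g - R g := fun g => by simp [hS]
  have hSs : ∀ g h, ⟪S g, h⟫ = ⟪g, S h⟫ := fun g h => by
    rw [hSa, hSa, inner_sub_left, inner_sub_right, hR.symm]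
  have hSgap : ∀ g, α * ⟪S g, g⟫ ≤ (1 + α) * ‖S g‖ ^ 2 := fun g => by
    have h1 := hgap g
    rw [← hSa] at h1
    have h2 : ⟪S g, g⟫ = ⟪S g, R g⟫ + ‖S g‖ ^ 2 := by
      rw [← real_inner_self_eq_norm_sq, ← inner_add_right, hSa]; simp
    rw [h2]; linarith
  have hSpos : ∀ g, 0 ≤ ⟪S g, g⟫ := fun g => by rw [hSa]; exact hR.inner_sub_nonneg g
  have hran : ∀ k, α * ‖S k‖ ^ 2 ≤ (1 + α) * ⟪S (S k), S k⟫ := fun k => by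
    -- expand the square of `S k - t k`, at the `t` that makes the other two terms cancel
    set t := α / (1 + α) with ht
    have hα1 : 0 < 1 + α := by linarith
    have h1 := hSpos (S k - t • k)
    have h2 := hSgap k
    simp only [map_sub, map_smul, inner_sub_left, inner_sub_right, real_inner_smul_left,
      real_inner_smul_right] at h1
    rw [hSs (S k) k, real_inner_self_eq_norm_sq] at h1
    have ht0 : 0 < t := by positivity
    have ht1 : t * (1 + α) = α := by rw [ht]; field_simp
    have h3 : t * ⟪S k, k⟫ ≤ ‖S k‖ ^ 2 := by
      rw [ht, div_mul_eq_mul_div, div_le_iff₀ hα1]; linarith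
    have h4 : t * ‖S k‖ ^ 2 ≤ ⟪S (S k), S k⟫ := by nlinarith
    nlinarith
  have hcl : ∀ g ∈ closure (S.range : Set H), α * ‖g‖ ^ 2 ≤ (1 + α) * ⟪S g, g⟫ := by
    intro g hg
    have hclosed : IsClosed {g : H | α * ‖g‖ ^ 2 ≤ (1 + α) * ⟪S g, g⟫} :=
      isClosed_le (by fun_prop) (by fun_prop)
    refine closure_minimal ?_ hclosed hg
    rintro _ ⟨k, rfl⟩
    exact hran k
  have hSe : S e = 0 := by rw [hSa, hRe, sub_self]
  set g₀ := g - ⟪g, e⟫ • e with hg₀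
  have hmem : g₀ ∈ closure (S.range : Set H) := by
    have h1 : g₀ ∈ (S.range)ᗮᗮ := by
      rw [Submodule.mem_orthogonal]
      intro u hu
      have hu0 : S u = 0 := by
        refine ext_inner_left ℝ fun w => ?_
        rw [← hSs, inner_zero_right]
        exact (Submodule.mem_orthogonal _ _).1 hu (S w) ⟨w, rfl⟩
      obtain ⟨c, rfl⟩ := hker u (by rw [hSa, sub_eq_zero] at hu0; exact hu0.symm)
      rw [real_inner_smul_left, hg₀, inner_sub_right, real_inner_smul_right,
        real_inner_self_eq_norm_sq, he, real_inner_comm]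
      ring
    rw [Submodule.orthogonal_orthogonal_eq_closure] at h1
    have := Submodule.topologicalClosure_coe S.range
    rwa [← SetLike.mem_coe, this] at h1
  have h1 := hcl g₀ hmem
  have h2 : ‖g₀‖ ^ 2 = ‖g‖ ^ 2 - ⟪g, e⟫ ^ 2 := by
    rw [hg₀, @norm_sub_sq_real, norm_smul, he, real_inner_smul_right, mul_one, Real.norm_eq_abs,
      sq_abs]
    ring
  have h3 : ⟪S g₀, g₀⟫ = ⟪S g, g⟫ := by
    have : S g₀ = S g := by rw [hg₀, map_sub, map_smul, hSe, smul_zero, sub_zero]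
    rw [this, hg₀, inner_sub_right, real_inner_smul_right, hSs g e, hSe]
    simp
  rw [h2, h3, hSa] at h1
  exact h1

end IsResolvent

section Core

variable {D : Type*} [AddCommGroup D] [Module ℝ D] {ι N : D →ₗ[ℝ] H}

/-- The resolvent of an operator given on a core `D`, where `N = 1 + P` and `ι` embeds `D` in `H`.
The density of the range of `N` stands for the essential self-adjointness of `P`. -/
theorem exists_isResolvent (hN : DenseRange N)
    (hs : ∀ φ ψ, ⟪N φ, ι ψ⟫ = ⟪ι φ, N ψ⟫) (hp : ∀ φ, ‖ι φ‖ ^ 2 ≤ ⟪N φ, ι φ⟫) :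
    ∃ R : H →L[ℝ] H, IsResolvent R ∧ ∀ φ, R (N φ) = ι φ := by
  have hb : ∀ φ, ‖ι φ‖ ≤ 1 * ‖N φ‖ := fun φ => by
    have h1 := hp φ
    have h2 := real_inner_le_norm (N φ) (ι φ)
    rw [one_mul]
    rcases (norm_nonneg (ι φ)).eq_or_lt with h | h
    · rw [← h]; exact norm_nonneg _
    · refine le_of_mul_le_mul_right ?_ h
      linarith [sq (‖ι φ‖)]
  have hRN : ∀ φ, ι.extendOfNorm N (N φ) = ι φ := ι.extendOfNorm_eq hN ⟨1, hb⟩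
  refine ⟨ι.extendOfNorm N, ⟨fun g h => ?_, fun g => ?_⟩, hRN⟩
  · refine hN.induction_on₂ (p := fun g h => ⟪ι.extendOfNorm N g, h⟫ = ⟪g, ι.extendOfNorm N h⟫)
      (isClosed_eq (by fun_prop) (by fun_prop)) (fun φ ψ => ?_) g h
    rw [hRN, hRN, hs]
  · refine hN.induction_on (p := fun g => ‖ι.extendOfNorm N g‖ ^ 2 ≤ ⟪ι.extendOfNorm N g, g⟫) g
      (isClosed_le (by fun_prop) (by fun_prop)) (fun φ => ?_)
    rw [hRN, real_inner_comm]; exact hp φ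

variable {R Pr : H →L[ℝ] H} (hR : IsResolvent R) (hRN : ∀ φ, R (N φ) = ι φ) (hN : DenseRange N)
include hR hRN hN

theorem resolvent_commute (hPs : ∀ g h, ⟪Pr g, h⟫ = ⟪g, Pr h⟫)
    (hc : ∀ φ ψ, ⟪N φ, Pr (ι ψ)⟫ = ⟪N ψ, Pr (ι φ)⟫) (g : H) : R (Pr g) = Pr (R g) := by
  refine hN.induction_on (p := fun g => R (Pr g) = Pr (R g)) g
    (isClosed_eq (by fun_prop) (by fun_prop)) fun ψ => ?_
  rw [hRN]
  refine hN.eq_of_inner_left (𝕜 := ℝ) fun φ => ?_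
  rw [hR.symm, hRN, real_inner_comm _ (Pr (ι ψ)), hc φ ψ, hPs]

/-- The range of `l - T` is dense, for the operator `T = X + γ (Pr - 1)`: a vector orthogonal to it
is tested, in the limit, against its own image under the resolvent of `P`. The hypothesis `hXP`
bounds the commutator of `X` and `P` in the sense of forms; here `N - ι` is `P`. -/
theorem denseRange_sub_generator (hι : DenseRange ι)
    (hPs : ∀ g h, ⟪Pr g, h⟫ = ⟪g, Pr h⟫) (hPP : ∀ g, Pr (Pr g) = Pr g)
    (hRP : ∀ g, R (Pr g) = Pr (R g)) {X : D →ₗ[ℝ] H} {c c' γ : ℝ} (hγ : 0 ≤ γ)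
    (hXN : ∀ φ, ‖X φ‖ ≤ c' * ‖N φ‖) (hX0 : ∀ φ, ⟪X φ, ι φ⟫ = 0)
    (hXP : ∀ φ, ⟪X φ, N φ - ι φ⟫ ≤ c * ⟪N φ - ι φ, ι φ⟫) {l : ℝ} (hc : 0 ≤ c) (hl : c < l) :
    DenseRange fun φ => l • ι φ - (X φ + γ • (Pr (ι φ) - ι φ)) := by
  let Λ : D →ₗ[ℝ] H := l • ι - (X + γ • (Pr.toLinearMap.comp ι - ι))
  have hΛ : ∀ φ, Λ φ = l • ι φ - (X φ + γ • (Pr (ι φ) - ι φ)) := fun φ => by simp [Λ]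
  have : (fun φ => l • ι φ - (X φ + γ • (Pr (ι φ) - ι φ))) = Λ := funext fun φ => (hΛ φ).symm
  rw [this]
  suffices h : (LinearMap.range Λ)ᗮ = ⊥ by
    have := (Submodule.topologicalClosure_eq_top_iff (K := LinearMap.range Λ)).2 h
    rw [DenseRange, ← LinearMap.coe_range, Submodule.dense_iff_topologicalClosure_eq_top]
    exact this
  rw [Submodule.eq_bot_iff]
  intro g hg
  have hg' : ∀ φ, ⟪Λ φ, g⟫ = 0 := fun φ => (Submodule.mem_orthogonal _ _).1 hg _ ⟨φ, rfl⟩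
  set XR : H →L[ℝ] H := X.extendOfNorm N with hXR
  have hXRN : ∀ φ, XR (N φ) = X φ := X.extendOfNorm_eq hN ⟨c', hXN⟩
  have h1 : l * ⟪R g, g⟫ - (⟪XR g, g⟫ + γ * (⟪Pr (R g), g⟫ - ⟪R g, g⟫)) = 0 := by
    have : ∀ k, l * ⟪R k, g⟫ - (⟪XR k, g⟫ + γ * (⟪Pr (R k), g⟫ - ⟪R k, g⟫)) = 0 := fun k => by
      refine hN.induction_on
        (p := fun k => l * ⟪R k, g⟫ - (⟪XR k, g⟫ + γ * (⟪Pr (R k), g⟫ - ⟪R k, g⟫)) = 0) k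
        (isClosed_eq (by fun_prop) (by fun_prop)) fun φ => ?_
      have := hg' φ
      rw [hΛ] at this
      rw [hRN, hXRN]
      simpa only [inner_sub_left, inner_add_left, real_inner_smul_left] using this
    exact this g
  have h2 : ⟪XR g, g⟫ ≤ c * ⟪g - R g, R g⟫ := by
    refine hN.induction_on (p := fun g => ⟪XR g, g⟫ ≤ c * ⟪g - R g, R g⟫) g
        (isClosed_le (by fun_prop) (by fun_prop)) fun φ => ?_
    have e1 := hXP φ
    rw [inner_sub_right, hX0, sub_zero] at e1
    rw [hRN, hXRN]
    exact e1
  have h3 : ⟪Pr (R g), g⟫ ≤ ⟪R g, g⟫ := by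
    have e1 := hR.inner_apply_nonneg (g - Pr g)
    rw [map_sub, inner_sub_left, inner_sub_right, inner_sub_right, hRP g, hPs (R g) (Pr g), hPP,
      ← hPs] at e1
    linarith
  have h4 : ⟪g - R g, R g⟫ ≤ ⟪R g, g⟫ := by
    rw [inner_sub_left, real_inner_comm]
    linarith [real_inner_self_nonneg (x := R g)]
  have h5 : ⟪R g, g⟫ ≤ 0 := by
    have h0 := hR.inner_apply_nonneg g
    nlinarith
  have h6 : R g = 0 := by
    have := hR.norm_sq_le g
    rw [← norm_eq_zero]
    nlinarith [norm_nonneg (R g)]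
  refine hι.eq_zero_of_inner_left (𝕜 := ℝ) fun φ => ?_
  rw [← hRN φ, ← hR.symm, h6, inner_zero_left]

end Core

end Abstract

/-! ### Decay by a modified norm -/

section Hypocoercivity

variable {H : Type*} [NormedAddCommGroup H] [InnerProductSpace ℝ H] [CompleteSpace H]

/-- The weight of the corrector in the modified norm, up to a factor proportional to the
macroscopic spectral gap. -/
def correctorWeight (γ a b : ℝ) : ℝ :=
  ((2 * a / γ + (b + γ * √a) ^ 2) / γ + 2 * √a / γ + 1 / γ ^ 3)⁻¹

theorem correctorWeight_pos {γ : ℝ} (hγ : 0 < γ) {a : ℝ} (ha : 0 ≤ a) (b : ℝ) :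
    0 < correctorWeight γ a b := by
  unfold correctorWeight; positivity

/-- The three ways in which the corrector has to be small: the modified norm stays comparable to the
norm, and the microscopic dissipation absorbs the terms that the corrector adds. -/
theorem correctorWeight_spec {γ a b m : ℝ} (hγ : 0 < γ) (ha : 0 ≤ a) (hb : 0 ≤ b) (hm0 : 0 < m)
    (hmγ : m ≤ 1 / γ) :
    correctorWeight γ a b * m * √a ≤ 1 / 2 ∧ correctorWeight γ a b * m ^ 2 ≤ γ ∧
      correctorWeight γ a b * (2 * a * m + (b + γ * √a) ^ 2) ≤ γ := by
  have hw0 := correctorWeight_pos hγ ha b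
  set w := correctorWeight γ a b with hw
  have hden : w * ((2 * a / γ + (b + γ * √a) ^ 2) / γ + 2 * √a / γ + 1 / γ ^ 3) = 1 := by
    rw [hw, correctorWeight]
    exact inv_mul_cancel₀ (ne_of_gt (by positivity))
  set B := b + γ * √a with hB
  have hB0 : 0 ≤ B := by positivity
  have hw1 : w * (2 * a / γ + B ^ 2) ≤ γ := by
    have t1 : 0 ≤ w * (2 * √a / γ + 1 / γ ^ 3) := by positivity
    have t2 : w * ((2 * a / γ + B ^ 2) / γ) ≤ 1 := by linarith
    rw [← mul_div_assoc, div_le_one hγ] at t2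
    exact t2
  have hw2 : w * (2 * √a / γ) ≤ 1 := by
    have t1 : 0 ≤ w * ((2 * a / γ + B ^ 2) / γ + 1 / γ ^ 3) := by positivity
    linarith
  have hw3 : w * (1 / γ ^ 3) ≤ 1 := by
    have t1 : 0 ≤ w * ((2 * a / γ + B ^ 2) / γ + 2 * √a / γ) := by positivity
    linarith
  have hεa : w * m * √a ≤ 1 / 2 := by
    have : w * m * √a ≤ w * (1 / γ) * √a := by gcongr
    have h' : w * (1 / γ) * √a = w * (2 * √a / γ) / 2 := by ring
    linarith
  have hwm : w * m ^ 2 ≤ γ := by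
    have : w * m ^ 2 ≤ w * (1 / γ) ^ 2 := by gcongr
    have h' : w * (1 / γ) ^ 2 = γ * (w * (1 / γ ^ 3)) := by field_simp
    nlinarith
  have hw4 : w * (2 * a * m + B ^ 2) ≤ γ := by
    refine le_trans ?_ hw1
    gcongr
    calc 2 * a * m ≤ 2 * a * (1 / γ) := by gcongr
      _ = 2 * a / γ := by ring
  exact ⟨hεa, hwm, hw4⟩

/-- The constant `A` of the decay rate `α ^ 2 / A`. -/
def decayConstant (γ a b : ℝ) : ℝ := 3 / 2 * (γ * (1 + γ)) ^ 2 / correctorWeight γ a b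

theorem decayConstant_pos {γ : ℝ} (hγ : 0 < γ) {a : ℝ} (ha : 0 ≤ a) (b : ℝ) :
    0 < decayConstant γ a b := by
  have := correctorWeight_pos hγ ha b
  unfold decayConstant; positivity

/-- The square of the distance of `y` to the line spanned by the unit vector `e`. -/
def distSq (e y : H) : ℝ := ‖y‖ ^ 2 - ⟪y, e⟫ ^ 2

/-- The square of the modified norm: the squared distance to the equilibria, and a cross term whose
derivative along the equation supplies the missing macroscopic dissipation. -/
def modifiedNorm (K : H →L[ℝ] H) (e : H) (ε : ℝ) (y : H) : ℝ := distSq e y - 2 * ε * ⟪K y, y⟫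

/-- The derivative of `modifiedNorm` at `y`. -/
def modifiedNormDeriv (K : H →L[ℝ] H) (e : H) (ε : ℝ) (y : H) : H →L[ℝ] ℝ :=
  2 • innerSL ℝ y - (2 * ⟪y, e⟫) • innerSL ℝ e
    - (2 * ε) • (innerSL ℝ (K y) + (innerSL ℝ y).comp K)

theorem modifiedNormDeriv_apply (K : H →L[ℝ] H) (e : H) (ε : ℝ) (y z : H) :
    modifiedNormDeriv K e ε y z =
      2 * ⟪y, z⟫ - 2 * ⟪y, e⟫ * ⟪e, z⟫ - 2 * ε * (⟪K y, z⟫ + ⟪y, K z⟫) := by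
  simp [modifiedNormDeriv]
  ring

theorem hasFDerivAt_modifiedNorm (K : H →L[ℝ] H) (e : H) (ε : ℝ) (y : H) :
    HasFDerivAt (modifiedNorm K e ε) (modifiedNormDeriv K e ε y) y := by
  have h1 : HasFDerivAt (fun y : H => ‖y‖ ^ 2) (2 • innerSL ℝ y) y :=
    (hasStrictFDerivAt_norm_sq y).hasFDerivAt
  have h2 : HasFDerivAt (fun y : H => ⟪y, e⟫) (innerSL ℝ e) y := by
    refine ((innerSL ℝ e).hasFDerivAt).congr_of_eventuallyEq ?_
    exact Eventually.of_forall fun y => by simp [real_inner_comm]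
  have h3 := hasFDerivAt_inner_apply K y
  have h4 := (h1.sub (h2.pow 2)).sub (h3.const_mul (2 * ε))
  refine h4.congr_fderiv ?_
  ext z
  simp [modifiedNormDeriv]

/-- The structural facts behind the decay, for the equation `y' = X y + γ (Pr - 1) y` on the core
`D`. Here `Pr` averages over the velocities, `R` is the resolvent `(1 + P)⁻¹` of the reference
operator `P`, `e` is the equilibrium, and the corrector `K` is `X R Pr`. The constants `a` and `b`
bound the corrector and its transport, and `α` is the spectral gap of `P`. The field
`corrector_transport` is the macroscopic coercivity, up to an error in the microscopic part. -/
structure IsHypocoercive {D : Type*} [AddCommGroup D] [Module ℝ D] (ι X : D →ₗ[ℝ] H)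
    (Pr R K : H →L[ℝ] H) (e : H) (γ a b α : ℝ) : Prop where
  resolvent : IsResolvent R
  symm : ∀ g h, ⟪Pr g, h⟫ = ⟪g, Pr h⟫
  idem : ∀ g, Pr (Pr g) = Pr g
  commute : ∀ g, R (Pr g) = Pr (R g)
  norm_eq : ‖e‖ = 1
  proj_eq : Pr e = e
  resolvent_eq : R e = e
  antisymm : ∀ φ, ⟪X φ, ι φ⟫ = 0
  mass : ∀ φ, ⟪X φ, e⟫ = 0
  corrector_inner : ∀ g φ, ⟪K g, ι φ⟫ = -⟪Pr (R g), X φ⟫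
  corrector_norm : ∀ g, ‖K g‖ ^ 2 ≤ a * ⟪g - R g, Pr (R g)⟫
  proj_corrector : ∀ g, Pr (K g) = 0
  corrector_transport : ∀ g φ, γ⁻¹ * ⟪g - R g, Pr (ι φ)⟫
    - b * √(‖Pr g‖ ^ 2 - ⟪g, e⟫ ^ 2) * ‖ι φ - Pr (ι φ)‖ ≤ ⟪K g, X φ⟫
  gap : ∀ g, α * (‖g‖ ^ 2 - ⟪g, e⟫ ^ 2) ≤ (1 + α) * ⟪g - R g, g⟫

namespace IsHypocoercive

variable {D : Type*} [AddCommGroup D] [Module ℝ D] {ι X : D →ₗ[ℝ] H}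
    {Pr R K : H →L[ℝ] H} {e : H} {γ a b α : ℝ} (h : IsHypocoercive ι X Pr R K e γ a b α)
include h

theorem inner_proj_eq (g : H) : ⟪Pr g, e⟫ = ⟪g, e⟫ := by rw [h.symm, h.proj_eq]

theorem norm_proj_sq (g : H) : ‖Pr g‖ ^ 2 = ⟪Pr g, g⟫ := by
  rw [← real_inner_self_eq_norm_sq, h.symm, h.idem, ← h.symm]

theorem distSq_eq (g : H) : distSq e g = ‖g - Pr g‖ ^ 2 + distSq e (Pr g) := by
  unfold distSq
  rw [h.inner_proj_eq, @norm_sub_sq_real, h.norm_proj_sq, real_inner_comm g (Pr g)]; ring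

theorem distSq_proj_nonneg (g : H) : 0 ≤ distSq e (Pr g) := by
  have h1 := abs_real_inner_le_norm (Pr g) e
  rw [h.norm_eq, mul_one] at h1
  have := sq_le_sq' (by linarith [neg_abs_le ⟪Pr g, e⟫]) ((le_abs_self _).trans h1)
  unfold distSq; linarith

theorem norm_corrector_sq_le (ha : 0 ≤ a) (g : H) : ‖K g‖ ^ 2 ≤ a * distSq e (Pr g) := by
  refine (h.corrector_norm g).trans (mul_le_mul_of_nonneg_left ?_ ha)
  have hRs := h.resolvent.symm
  set u := Pr g - ⟪g, e⟫ • e with hu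
  have h1 : ⟪g - R g, Pr (R g)⟫ = ⟪Pr g - R (Pr g), R (Pr g)⟫ := by
    rw [h.commute, ← h.idem (R g), ← h.symm, map_sub, h.idem]
  have h2 : u - R u = Pr g - R (Pr g) := by
    rw [hu, map_sub, map_smul, h.resolvent_eq]; abel
  have h3 : ⟪Pr g - R (Pr g), e⟫ = 0 := by
    rw [inner_sub_left, hRs, h.resolvent_eq, sub_self]
  have h4 : ⟪g - R g, Pr (R g)⟫ = ⟪u - R u, R u⟫ := by
    rw [h1, h2, hu, map_sub, map_smul, h.resolvent_eq, inner_sub_right, real_inner_smul_right, h3]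
    simp
  have h5 : ‖u‖ ^ 2 = distSq e (Pr g) := by
    rw [hu, @norm_sub_sq_real, norm_smul, h.norm_eq, real_inner_smul_right, mul_one,
      Real.norm_eq_abs, sq_abs, distSq, h.inner_proj_eq]
    ring
  rw [h4, ← h5, inner_sub_left, real_inner_self_eq_norm_sq]
  have h6 := real_inner_le_norm u (R u)
  have h7 := h.resolvent.norm_le u
  nlinarith [norm_nonneg u, sq_nonneg ‖R u‖]

theorem abs_inner_corrector_le (ha : 0 ≤ a) (g : H) :
    |⟪K g, g⟫| ≤ √a / 2 * distSq e g := by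
  have h1 : ⟪K g, g⟫ = ⟪K g, g - Pr g⟫ := by
    rw [inner_sub_right, ← h.symm, h.proj_corrector, inner_zero_left, sub_zero]
  have h2 : ‖K g‖ ≤ √a * √(distSq e (Pr g)) := by
    rw [← Real.sqrt_mul ha]
    exact Real.le_sqrt_of_sq_le (h.norm_corrector_sq_le ha g)
  have h3 := abs_real_inner_le_norm (K g) (g - Pr g)
  rw [h1, h.distSq_eq]
  have h4 := Real.sq_sqrt (h.distSq_proj_nonneg g)
  set q := √(distSq e (Pr g))
  have h5 : ‖K g‖ * ‖g - Pr g‖ ≤ √a * q * ‖g - Pr g‖ := by gcongr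
  rw [← h4]
  nlinarith [Real.sqrt_nonneg a, sq_nonneg (q - ‖g - Pr g‖),
    mul_nonneg (Real.sqrt_nonneg a) (sq_nonneg (q - ‖g - Pr g‖))]

/-- The dissipation of the modified norm along the equation, on the core. -/
theorem modifiedNormDeriv_le (hγ : 0 < γ) (ha : 0 ≤ a) (hb : 0 ≤ b) (hα : 0 < α) (hαγ : α ≤ γ)
    (φ : D) :
    modifiedNormDeriv K e (correctorWeight γ a b * (γ⁻¹ * (α / (1 + α)))) (ι φ)
        (X φ + γ • (Pr (ι φ) - ι φ)) ≤
      -(α ^ 2 / decayConstant γ a b) *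
        modifiedNorm K e (correctorWeight γ a b * (γ⁻¹ * (α / (1 + α)))) (ι φ) := by
  set y := ι φ with hy
  set z := X φ + γ • (Pr y - y) with hz
  set m := γ⁻¹ * (α / (1 + α)) with hm
  set w := correctorWeight γ a b with hw
  have hα1 : 0 < 1 + α := by linarith
  have hm0 : 0 < m := by positivity
  have hmγ : m ≤ 1 / γ := by
    rw [hm, one_div]
    refine mul_le_of_le_one_right (by positivity) ?_
    rw [div_le_one hα1]; linarith
  have hw0 : 0 < w := correctorWeight_pos hγ ha b
  set p := ‖y - Pr y‖ with hp
  set q := √(distSq e (Pr y)) with hq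
  have hq2 : q ^ 2 = distSq e (Pr y) := Real.sq_sqrt (h.distSq_proj_nonneg y)
  have hp0 : 0 ≤ p := norm_nonneg _
  have hq0 : 0 ≤ q := Real.sqrt_nonneg _
  have hdist : distSq e y = p ^ 2 + q ^ 2 := by rw [h.distSq_eq, hq2]
  -- the transport is antisymmetric, so the norm itself only dissipates the microscopic part
  have hzy : ⟪y, z⟫ = -γ * p ^ 2 := by
    rw [hz, inner_add_right, real_inner_comm, h.antisymm, real_inner_smul_right, inner_sub_right,
      real_inner_self_eq_norm_sq, hp, @norm_sub_sq_real, h.norm_proj_sq, real_inner_comm y (Pr y)]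
    ring
  have hze : ⟪e, z⟫ = 0 := by
    rw [hz, real_inner_comm, inner_add_left, h.mass, real_inner_smul_left, inner_sub_left,
      h.inner_proj_eq]
    ring
  have hPz : Pr z = Pr (X φ) := by
    rw [hz, map_add, map_smul, map_sub, h.idem, sub_self, smul_zero, add_zero]
  -- `⟪R z, Pr z⟫` is the value sought, and it also controls `‖K z‖ ^ 2`: the estimate closes
  have hKz : -⟪y, K z⟫ ≤ a * p ^ 2 := by
    set k := ⟪R z, Pr z⟫ with hk
    have e1 : -⟪y, K z⟫ = k := by
      rw [real_inner_comm, hy, h.corrector_inner, neg_neg, h.symm, ← hPz]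
    have e2 : ‖K z‖ ^ 2 ≤ a * k := by
      refine (h.corrector_norm z).trans (mul_le_mul_of_nonneg_left ?_ ha)
      rw [inner_sub_left, ← h.symm, real_inner_comm, ← h.symm (R z) (R z), ← h.norm_proj_sq]
      linarith [sq_nonneg ‖Pr (R z)‖]
    have e3 : -⟪y, K z⟫ ≤ ‖K z‖ * p := by
      have : ⟪y, K z⟫ = ⟪y - Pr y, K z⟫ := by
        rw [inner_sub_left, h.symm, h.proj_corrector, inner_zero_right, sub_zero]
      rw [this, mul_comm]
      exact (neg_le_abs _).trans (abs_real_inner_le_norm _ _)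
    rw [e1] at e3 ⊢
    by_contra hcon
    push Not at hcon
    have hk0 : 0 < k := lt_of_le_of_lt (by positivity) hcon
    have : k ^ 2 ≤ (‖K z‖ * p) ^ 2 := pow_le_pow_left₀ hk0.le e3 2
    nlinarith [sq_nonneg p, mul_pow ‖K z‖ p 2]
  have hKy : -⟪K y, z⟫ ≤ -m * q ^ 2 + (b + γ * √a) * (p * q) := by
    have e1 := h.corrector_transport y φ
    rw [← hy, ← h.inner_proj_eq y] at e1
    change _ - b * q * p ≤ _ at e1
    have e2 : ⟪y - R y, Pr y⟫ = ⟪Pr y - R (Pr y), Pr y⟫ := by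
      rw [h.commute, ← map_sub, h.symm (y - R y), h.idem]
    have e3 := h.gap (Pr y)
    change α * distSq e (Pr y) ≤ _ at e3
    rw [← hq2] at e3
    have e4 : m * q ^ 2 ≤ γ⁻¹ * ⟪y - R y, Pr y⟫ := by
      rw [e2, hm, mul_assoc]
      refine mul_le_mul_of_nonneg_left ?_ (by positivity)
      rw [div_mul_eq_mul_div, div_le_iff₀ hα1]; linarith
    have e5 : ‖K y‖ ≤ √a * q := by
      rw [hq, ← Real.sqrt_mul ha]
      exact Real.le_sqrt_of_sq_le (h.norm_corrector_sq_le ha y)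
    have e6 : -⟪K y, z⟫ = -⟪K y, X φ⟫ + γ * ⟪K y, y - Pr y⟫ := by
      rw [hz, inner_add_right, real_inner_smul_right, inner_sub_right, inner_sub_right]; ring
    have e7 : ⟪K y, y - Pr y⟫ ≤ √a * q * p :=
      (real_inner_le_norm _ _).trans (by gcongr)
    rw [e6]
    linarith [mul_le_mul_of_nonneg_left e7 hγ.le]
  obtain ⟨hεa, hwm, hw4⟩ := correctorWeight_spec hγ ha hb hm0 hmγ
  rw [← hw] at hεa hwm hw4
  set B := b + γ * √a with hB
  have hB0 : 0 ≤ B := by positivity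
  rw [modifiedNormDeriv_apply, hzy, hze]
  have hmain : 2 * (-γ * p ^ 2) - 2 * ⟪y, e⟫ * 0 - 2 * (w * m) * (⟪K y, z⟫ + ⟪y, K z⟫) ≤
      -(w * m ^ 2) * (p ^ 2 + q ^ 2) := by
    have t0 : 0 ≤ w * m := by positivity
    have t1 : 2 * (w * m) * (-⟪K y, z⟫ + -⟪y, K z⟫) ≤
        2 * (w * m) * (-m * q ^ 2 + B * (p * q) + a * p ^ 2) := by gcongr
    have t2 : 2 * m * (B * (p * q)) ≤ B ^ 2 * p ^ 2 + m ^ 2 * q ^ 2 := by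
      nlinarith [sq_nonneg (B * p - m * q)]
    have t3 := mul_le_mul_of_nonneg_left t2 hw0.le
    have t4 := mul_le_mul_of_nonneg_right hw4 (sq_nonneg p)
    have t5 := mul_le_mul_of_nonneg_right hwm (sq_nonneg p)
    linarith
  refine hmain.trans ?_
  have hF : modifiedNorm K e (w * m) y ≤ 3 / 2 * (p ^ 2 + q ^ 2) := by
    have t1 := h.abs_inner_corrector_le ha y
    rw [hdist] at t1
    have t2 := neg_abs_le ⟪K y, y⟫
    have t3 : 2 * (w * m) * |⟪K y, y⟫| ≤ 2 * (w * m) * (√a / 2 * (p ^ 2 + q ^ 2)) := by gcongr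
    have t4 := mul_le_mul_of_nonneg_right hεa (show 0 ≤ p ^ 2 + q ^ 2 by positivity)
    have t5 : 2 * (w * m) * -|⟪K y, y⟫| ≤ 2 * (w * m) * ⟪K y, y⟫ := by gcongr
    rw [modifiedNorm, hdist]
    linarith
  have hrate : α ^ 2 / decayConstant γ a b ≤ 2 / 3 * (w * m ^ 2) := by
    -- `α ≤ γ` is used to have a constant independent of `α`
    have t1 : α / (1 + γ) ≤ α / (1 + α) := by gcongr
    have t2 : γ⁻¹ * (α / (1 + γ)) ≤ m := by rw [hm]; gcongr
    have t3 : 2 / 3 * (w * (γ⁻¹ * (α / (1 + γ))) ^ 2) ≤ 2 / 3 * (w * m ^ 2) := by gcongr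
    refine le_trans (le_of_eq ?_) t3
    rw [decayConstant, ← hw]
    field_simp
  have hr0 : 0 ≤ α ^ 2 / decayConstant γ a b := by
    have := decayConstant_pos hγ ha b
    positivity
  have t6 := mul_le_mul_of_nonneg_left hF hr0
  have t7 := mul_le_mul_of_nonneg_right hrate (show 0 ≤ p ^ 2 + q ^ 2 by positivity)
  linarith

/-- Exponential decay of mild solutions to the equilibrium: the modified norm decays along the
equation, and is comparable to the distance to the equilibria. -/
theorem decay (hγ : 0 < γ) (ha : 0 ≤ a) (hb : 0 ≤ b) (hα : 0 < α) (hαγ : α ≤ γ)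
    {G : Submodule ℝ (H × H)}
    (hG : (G : Set (H × H)) ⊆ closure (Set.range fun φ => (ι φ, X φ + γ • (Pr (ι φ) - ι φ))))
    {x : H} {f : C(ℝ≥0, H)} (hf : IsMild G x f) (t : ℝ≥0) :
    distSq e (f t) ≤ 3 * Real.exp (-(α ^ 2 / decayConstant γ a b) * t) * distSq e x := by
  set ε := correctorWeight γ a b * (γ⁻¹ * (α / (1 + α))) with hε
  have hw0 : 0 < correctorWeight γ a b := correctorWeight_pos hγ ha b
  have hα1 : 0 < 1 + α := by linarith
  have hε0 : 0 ≤ ε := by positivity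
  have hεa : ε * √a ≤ 1 / 2 := by
    refine (correctorWeight_spec hγ ha hb (by positivity) ?_).1
    rw [one_div]
    refine mul_le_of_le_one_right (by positivity) ?_
    rw [div_le_one hα1]; linarith
  have hcmp : ∀ y, |2 * ε * ⟪K y, y⟫| ≤ 1 / 2 * distSq e y := by
    intro y
    have t1 := h.abs_inner_corrector_le ha y
    have t0 : 0 ≤ distSq e y := by
      rw [h.distSq_eq]; have := h.distSq_proj_nonneg y; positivity
    rw [abs_mul, abs_of_nonneg (by positivity : 0 ≤ 2 * ε)]
    have t2 : 2 * ε * |⟪K y, y⟫| ≤ 2 * ε * (√a / 2 * distSq e y) := by gcongr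
    linarith [mul_le_mul_of_nonneg_right hεa t0]
  have key := hf.lyapunov (hasFDerivAt_modifiedNorm K e ε) (κ := α ^ 2 / decayConstant γ a b) (by
    have hcl : IsClosed {p : H × H | modifiedNormDeriv K e ε p.1 p.2 ≤
        -(α ^ 2 / decayConstant γ a b) * modifiedNorm K e ε p.1} := by
      simp only [modifiedNormDeriv_apply, modifiedNorm, distSq]
      exact isClosed_le (by fun_prop) (by fun_prop)
    intro p hp
    refine closure_minimal ?_ hcl (hG hp)
    rintro _ ⟨φ, rfl⟩
    exact h.modifiedNormDeriv_le hγ ha hb hα hαγ φ) t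
  have h1 := abs_le.1 (hcmp (f t))
  have h2 := abs_le.1 (hcmp x)
  rw [modifiedNorm, modifiedNorm] at key
  have h3 : Real.exp (-(α ^ 2 / decayConstant γ a b) * t) * (distSq e x - 2 * ε * ⟪K x, x⟫) ≤
      Real.exp (-(α ^ 2 / decayConstant γ a b) * t) * (3 / 2 * distSq e x) := by
    gcongr; linarith
  linarith

end IsHypocoercive

end Hypocoercivity

/-! ### From the core to the whole space -/

section Core

variable {H : Type*} [NormedAddCommGroup H] [InnerProductSpace ℝ H] [CompleteSpace H]
  {D : Type*} [AddCommGroup D] [Module ℝ D] {ι N X κ : D →ₗ[ℝ] H} {Pr : H →L[ℝ] H} {e : H}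

/-- What has to be checked on the core `D` for `IsHypocoercive`. The operator `N` is `1 + P`, and
`κ ψ` is `X Pr ψ`, so that `κ ψ` is the value of the corrector at `N ψ`. The field `kernel` says
that the closure of `P` has the kernel spanned by `e`. -/
structure CoreEstimates (ι N X κ : D →ₗ[ℝ] H) (Pr : H →L[ℝ] H) (e : H) (γ a b : ℝ) : Prop where
  symm : ∀ φ ψ, ⟪N φ, ι ψ⟫ = ⟪ι φ, N ψ⟫
  norm_sq_le : ∀ φ, ‖ι φ‖ ^ 2 ≤ ⟪N φ, ι φ⟫
  proj_symm : ∀ g h, ⟪Pr g, h⟫ = ⟪g, Pr h⟫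
  proj_idem : ∀ g, Pr (Pr g) = Pr g
  proj_commute : ∀ φ ψ, ⟪N φ, Pr (ι ψ)⟫ = ⟪N ψ, Pr (ι φ)⟫
  norm_eq : ‖e‖ = 1
  proj_eq : Pr e = e
  inner_eq : ∀ φ, ⟪N φ, e⟫ = ⟪ι φ, e⟫
  antisymm : ∀ φ, ⟪X φ, ι φ⟫ = 0
  mass : ∀ φ, ⟪X φ, e⟫ = 0
  corrector_inner : ∀ ψ φ, ⟪κ ψ, ι φ⟫ = -⟪Pr (ι ψ), X φ⟫
  corrector_norm : ∀ ψ, ‖κ ψ‖ ^ 2 ≤ a * ⟪N ψ - ι ψ, Pr (ι ψ)⟫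
  proj_corrector : ∀ ψ, Pr (κ ψ) = 0
  corrector_transport : ∀ ψ φ, γ⁻¹ * ⟪N ψ - ι ψ, Pr (ι φ)⟫
    - b * √(‖Pr (N ψ)‖ ^ 2 - ‖Pr (ι ψ)‖ ^ 2) * ‖ι φ - Pr (ι φ)‖ ≤ ⟪κ ψ, X φ⟫
  kernel : ∀ g, (∀ ε > 0, ∃ φ, ‖N φ - g‖ < ε ∧ ‖ι φ - g‖ < ε) → ∃ c : ℝ, g = c • e

theorem IsResolvent.apply_eq_of_inner {R : H →L[ℝ] H} (hR : IsResolvent R)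
    (hRN : ∀ φ, R (N φ) = ι φ) (hN : DenseRange N) {x y : H} (h : ∀ φ, ⟪N φ, x⟫ = ⟪ι φ, y⟫) :
    R y = x := by
  refine hN.eq_of_inner_left (𝕜 := ℝ) fun φ => ?_
  rw [hR.symm, hRN, real_inner_comm, real_inner_comm _ x, h]

/-- The range of `N` being dense, the resolvent and the corrector extend from it by continuity, and
so do the estimates. -/
theorem CoreEstimates.exists_isHypocoercive {γ a b : ℝ} (h : CoreEstimates ι N X κ Pr e γ a b)
    (ha : 0 ≤ a) (hb : 0 ≤ b) (hN : DenseRange N) {α : ℝ} (hα : 0 < α)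
    (hgap : ∀ φ, α * ⟪N φ - ι φ, ι φ⟫ ≤ ‖N φ - ι φ‖ ^ 2) :
    ∃ R K : H →L[ℝ] H, (∀ φ, R (N φ) = ι φ) ∧ IsHypocoercive ι X Pr R K e γ a b α := by
  obtain ⟨R, hR, hRN⟩ := exists_isResolvent hN h.symm h.norm_sq_le
  have hRe : R e = e := hR.apply_eq_of_inner hRN hN h.inner_eq
  have hPn : ∀ g, ‖Pr g‖ ≤ ‖g‖ := fun g => by
    have h1 : ‖Pr g‖ ^ 2 = ⟪Pr g, g⟫ := by
      rw [← real_inner_self_eq_norm_sq, h.proj_symm, h.proj_idem, ← h.proj_symm]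
    have h2 := real_inner_le_norm (Pr g) g
    rcases (norm_nonneg (Pr g)).eq_or_lt with h3 | h3
    · rw [← h3]; exact norm_nonneg _
    · refine le_of_mul_le_mul_left ?_ h3
      linarith [sq (‖Pr g‖)]
  have hκb : ∀ ψ, ‖κ ψ‖ ≤ √(2 * a) * ‖N ψ‖ := fun ψ => by
    have h1 := h.corrector_norm ψ
    have h3 : ‖ι ψ‖ ≤ ‖N ψ‖ := by rw [← hRN]; exact hR.norm_le _
    have h2 : ⟪N ψ - ι ψ, Pr (ι ψ)⟫ ≤ 2 * ‖N ψ‖ * ‖N ψ‖ :=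
      calc ⟪N ψ - ι ψ, Pr (ι ψ)⟫ ≤ ‖N ψ - ι ψ‖ * ‖Pr (ι ψ)‖ := real_inner_le_norm _ _
        _ ≤ (‖N ψ‖ + ‖ι ψ‖) * ‖ι ψ‖ := by
          gcongr
          · exact norm_sub_le _ _
          · exact hPn _
        _ ≤ (‖N ψ‖ + ‖N ψ‖) * ‖N ψ‖ := by gcongr
        _ = _ := by ring
    have h4 : ‖κ ψ‖ ^ 2 ≤ (√(2 * a) * ‖N ψ‖) ^ 2 := by
      rw [mul_pow, Real.sq_sqrt (by positivity)]
      nlinarith [mul_le_mul_of_nonneg_left h2 ha]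
    exact (pow_le_pow_iff_left₀ (norm_nonneg _) (by positivity) two_ne_zero).1 h4
  set K := κ.extendOfNorm N with hK
  have hKN : ∀ ψ, K (N ψ) = κ ψ := κ.extendOfNorm_eq hN ⟨_, hκb⟩
  refine ⟨R, K, hRN, ?_⟩
  refine
    { resolvent := hR
      symm := h.proj_symm
      idem := h.proj_idem
      commute := resolvent_commute hR hRN hN h.proj_symm h.proj_commute
      norm_eq := h.norm_eq
      proj_eq := h.proj_eq
      resolvent_eq := hRe
      antisymm := h.antisymm
      mass := h.mass
      corrector_inner := fun g φ => ?_
      corrector_norm := fun g => ?_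
      proj_corrector := fun g => ?_
      corrector_transport := fun g φ => ?_
      gap := ?_ }
  · refine hN.induction_on (p := fun g => ⟪K g, ι φ⟫ = -⟪Pr (R g), X φ⟫) g
      (isClosed_eq (by fun_prop) (by fun_prop)) fun ψ => ?_
    rw [hKN, hRN]; exact h.corrector_inner ψ φ
  · refine hN.induction_on (p := fun g => ‖K g‖ ^ 2 ≤ a * ⟪g - R g, Pr (R g)⟫) g
      (isClosed_le (by fun_prop) (by fun_prop)) fun ψ => ?_
    rw [hKN, hRN]; exact h.corrector_norm ψ
  · refine hN.induction_on (p := fun g => Pr (K g) = 0) g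
      (isClosed_eq (by fun_prop) (by fun_prop)) fun ψ => ?_
    rw [hKN]; exact h.proj_corrector ψ
  · refine hN.induction_on (p := fun g => γ⁻¹ * ⟪g - R g, Pr (ι φ)⟫
      - b * √(‖Pr g‖ ^ 2 - ⟪g, e⟫ ^ 2) * ‖ι φ - Pr (ι φ)‖ ≤ ⟪K g, X φ⟫) g
      (isClosed_le (by fun_prop) (by fun_prop)) fun ψ => ?_
    rw [hKN, hRN]
    refine le_trans ?_ (h.corrector_transport ψ φ)
    have h1 : ⟪N ψ, e⟫ ^ 2 ≤ ‖Pr (ι ψ)‖ ^ 2 := by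
      have h2 := abs_real_inner_le_norm (Pr (ι ψ)) e
      rw [h.norm_eq, mul_one, h.proj_symm, h.proj_eq, ← h.inner_eq] at h2
      exact sq_le_sq' (by linarith [neg_abs_le ⟪N ψ, e⟫]) ((le_abs_self _).trans h2)
    gcongr
  · refine hR.gap_of_kernel h.norm_eq hRe (fun g hg => h.kernel g fun ε hε => ?_) hα fun g => ?_
    · obtain ⟨_, hφ, ⟨φ, rfl⟩⟩ := Metric.dense_iff.1 hN g ε hε
      have h1 : ‖N φ - g‖ < ε := by simpa [dist_eq_norm] using hφ
      refine ⟨φ, h1, lt_of_le_of_lt ?_ h1⟩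
      have h2 : ι φ - g = R (N φ - g) := by rw [map_sub, hRN, hg]
      rw [h2]; exact hR.norm_le _
    · refine hN.induction_on (p := fun g => α * ⟪g - R g, R g⟫ ≤ ‖g - R g‖ ^ 2) g
        (isClosed_le (by fun_prop) (by fun_prop)) fun ψ => ?_
      rw [hRN]; exact hgap ψ

end Core

/-! ### Calculus for Gibbs measures -/

section Gibbs

/-- The directional derivative. -/
def pd {F 𝕜 : Type*} [NormedAddCommGroup F] [NormedSpace ℝ F] [NormedAddCommGroup 𝕜]
    [NormedSpace ℝ 𝕜] (e : F) (φ : F → 𝕜) (z : F) : 𝕜 := fderiv ℝ φ z e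

section Calculus

variable {F 𝕜 : Type*} [NormedAddCommGroup F] [NormedSpace ℝ F] [NormedAddCommGroup 𝕜]
    [NormedSpace ℝ 𝕜]

/-- Smooth functions with compact support. -/
def IsTest (φ : F → 𝕜) : Prop := ContDiff ℝ ∞ φ ∧ HasCompactSupport φ

@[fun_prop]
theorem contDiff_pd {φ : F → 𝕜} (hφ : ContDiff ℝ ∞ φ) (e : F) : ContDiff ℝ ∞ (pd e φ) :=
  (hφ.fderiv_right (m := ∞) (by simp)).clm_apply contDiff_const

theorem _root_.HasCompactSupport.pd {φ : F → 𝕜} (hφ : HasCompactSupport φ) (e : F) :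
    HasCompactSupport (pd e φ) := hφ.fderiv_apply (𝕜 := ℝ) e

theorem IsTest.pd {φ : F → 𝕜} (hφ : IsTest φ) (e : F) : IsTest (pd e φ) :=
  ⟨contDiff_pd hφ.1 e, hφ.2.pd e⟩

theorem _root_.ContDiff.hasFDerivAt' {φ : F → 𝕜} (hφ : ContDiff ℝ ∞ φ) (z : F) :
    HasFDerivAt φ (fderiv ℝ φ z) z :=
  (hφ.differentiable (by simp) z).hasFDerivAt

theorem pd_comm {φ : F → 𝕜} (hφ : ContDiff ℝ ∞ φ) (e e' : F) :
    pd e (pd e' φ) = pd e' (pd e φ) := by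
  funext z
  have h : ∀ e e', pd e (pd e' φ) z = fderiv ℝ (fderiv ℝ φ) z e e' := by
    intro e e'
    have h1 : HasFDerivAt (fderiv ℝ φ) (fderiv ℝ (fderiv ℝ φ) z) z :=
      (hφ.fderiv_right (m := ∞) (by simp)).hasFDerivAt' z
    have h2 := h1.clm_apply (hasFDerivAt_const e' z)
    have h3 : pd e' φ = fun y => fderiv ℝ φ y e' := rfl
    rw [pd, h3, h2.fderiv]
    simp
  rw [h, h]
  exact (hφ.contDiffAt.isSymmSndFDerivAt (by
    simp only [minSmoothness_of_isRCLikeNormedField]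
    exact WithTop.coe_le_coe.2 (le_top : (2 : ℕ∞) ≤ ⊤))) e e'

theorem pd_mul {𝕜 : Type*} [RCLike 𝕜] {φ ψ : F → 𝕜} (hφ : ContDiff ℝ ∞ φ) (hψ : ContDiff ℝ ∞ ψ)
    (e z : F) : pd e (fun z => φ z * ψ z) z = pd e φ z * ψ z + φ z * pd e ψ z := by
  rw [pd, ((hφ.hasFDerivAt' z).fun_mul (hψ.hasFDerivAt' z)).fderiv]
  simp [pd]; ring

theorem pd_smul {g : F → ℝ} {ψ : F → 𝕜} (hg : ContDiff ℝ ∞ g) (hψ : ContDiff ℝ ∞ ψ)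
    (e z : F) : pd e (fun z => g z • ψ z) z = pd e g z • ψ z + g z • pd e ψ z := by
  rw [pd, ((hg.hasFDerivAt' z).fun_smul (hψ.hasFDerivAt' z)).fderiv]
  simp [pd]; abel

theorem pd_add {φ ψ : F → 𝕜} (hφ : ContDiff ℝ ∞ φ) (hψ : ContDiff ℝ ∞ ψ)
    (e z : F) : pd e (fun z => φ z + ψ z) z = pd e φ z + pd e ψ z := by
  rw [pd, ((hφ.hasFDerivAt' z).fun_add (hψ.hasFDerivAt' z)).fderiv]
  simp [pd]

theorem pd_sub {φ ψ : F → 𝕜} (hφ : ContDiff ℝ ∞ φ) (hψ : ContDiff ℝ ∞ ψ)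
    (e z : F) : pd e (fun z => φ z - ψ z) z = pd e φ z - pd e ψ z := by
  rw [pd, ((hφ.hasFDerivAt' z).fun_sub (hψ.hasFDerivAt' z)).fderiv]
  simp [pd]

theorem pd_sum {ι : Type*} (s : Finset ι) {φ : ι → F → 𝕜} (hφ : ∀ i, ContDiff ℝ ∞ (φ i)) (e z : F) :
    pd e (fun z => ∑ i ∈ s, φ i z) z = ∑ i ∈ s, pd e (φ i) z := by
  rw [pd, (HasFDerivAt.fun_sum fun i _ => (hφ i).hasFDerivAt' z).fderiv]
  simp [pd]

theorem pd_neg {φ : F → 𝕜} (e z : F) : pd e (fun z => -φ z) z = -pd e φ z := by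
  rw [pd, fderiv_fun_neg]; simp [pd]

theorem pd_const_smul {φ : F → 𝕜} (hφ : ContDiff ℝ ∞ φ) (c : ℝ) (e z : F) :
    pd e (fun z => c • φ z) z = c • pd e φ z := by
  rw [pd, ((hφ.hasFDerivAt' z).fun_const_smul c).fderiv]; simp [pd]

namespace IsTest

variable {φ ψ : F → 𝕜}

theorem add (hφ : IsTest φ) (hψ : IsTest ψ) : IsTest fun z => φ z + ψ z :=
  ⟨ContDiff.add hφ.1 hψ.1, hφ.2.add hψ.2⟩

theorem sub (hφ : IsTest φ) (hψ : IsTest ψ) : IsTest fun z => φ z - ψ z :=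
  ⟨ContDiff.sub hφ.1 hψ.1, hφ.2.sub hψ.2⟩

theorem neg (hφ : IsTest φ) : IsTest fun z => -φ z := ⟨ContDiff.neg hφ.1, hφ.2.neg⟩

theorem smul_left (hφ : IsTest φ) {g : F → ℝ} (hg : ContDiff ℝ ∞ g) : IsTest fun z => g z • φ z :=
  ⟨by have := hφ.1; fun_prop, HasCompactSupport.smul_left hφ.2⟩

theorem const_smul (hφ : IsTest φ) (c : ℝ) : IsTest fun z => c • φ z := hφ.smul_left contDiff_const

theorem sum {ι : Type*} (s : Finset ι) {φ : ι → F → 𝕜} (hφ : ∀ i, IsTest (φ i)) :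
    IsTest fun z => ∑ i ∈ s, φ i z := by
  refine ⟨ContDiff.sum fun i _ => (hφ i).1, ?_⟩
  classical
  induction s using Finset.induction_on with
  | empty => simp only [Finset.sum_empty]; exact HasCompactSupport.zero
  | insert i s hi ih =>
    simp_rw [Finset.sum_insert hi]
    exact (hφ i).2.add ih

variable {𝕜 : Type*} [RCLike 𝕜] {φ ψ : F → 𝕜}

theorem mul_left (hφ : IsTest φ) (hψ : ContDiff ℝ ∞ ψ) : IsTest fun z => ψ z * φ z :=
  ⟨by have := hφ.1; fun_prop, HasCompactSupport.mul_left hφ.2⟩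

theorem mul_right (hφ : IsTest φ) (hψ : ContDiff ℝ ∞ ψ) : IsTest fun z => φ z * ψ z :=
  ⟨by have := hφ.1; fun_prop, HasCompactSupport.mul_right hφ.2⟩

theorem sq (hφ : IsTest φ) : IsTest fun z => φ z ^ 2 := by
  simp_rw [_root_.sq]; exact hφ.mul_left hφ.1

end IsTest

end Calculus

variable {F : Type*} [NormedAddCommGroup F] [NormedSpace ℝ F] [FiniteDimensional ℝ F]
  [MeasureSpace F] [BorelSpace F]

/-- The measure with density `δ` with respect to the volume. -/
def gibbs (δ : F → ℝ) : Measure F := volume.withDensity fun z => ENNReal.ofReal (δ z)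

/-- `δ` is a constant multiple of `exp (-W)`, which is encoded by its logarithmic derivative. -/
structure IsGibbs (W δ : F → ℝ) : Prop where
  smooth_potential : ContDiff ℝ ∞ W
  smooth : ContDiff ℝ ∞ δ
  pos : ∀ z, 0 < δ z
  pd_eq : ∀ e z, pd e δ z = -(δ z * pd e W z)

variable {W δ : F → ℝ}

theorem integral_gibbs {𝕜 : Type*} [NormedAddCommGroup 𝕜] [NormedSpace ℝ 𝕜] (hδ : Continuous δ)
    (hpos : ∀ z, 0 < δ z) (f : F → 𝕜) : ∫ z, f z ∂(gibbs δ) = ∫ z, δ z • f z := by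
  have := integral_withDensity_eq_integral_smul (μ := (volume : Measure F))
    (f := fun z => (δ z).toNNReal) hδ.measurable.real_toNNReal f
  rw [gibbs]
  refine this.trans ?_
  congr 1
  ext z
  rw [NNReal.smul_def, Real.coe_toNNReal _ (hpos z).le]

variable (h : IsGibbs W δ)
include h

variable [(volume : Measure F).IsAddHaarMeasure]

theorem IsGibbs.isLocallyFiniteMeasure : IsLocallyFiniteMeasure (gibbs δ) :=
  IsLocallyFiniteMeasure.withDensity_ofReal h.smooth.continuous

theorem IsGibbs.integrable {𝕜 : Type*} [NormedAddCommGroup 𝕜] [NormedSpace ℝ 𝕜] {f : F → 𝕜}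
    (hf : IsTest f) : Integrable f (gibbs δ) := by
  have := h.isLocallyFiniteMeasure
  exact hf.1.continuous.integrable_of_hasCompactSupport hf.2

section

variable {𝕜 : Type*} [RCLike 𝕜]

/-- Integration by parts against the Gibbs measure. -/
theorem IsGibbs.integral_pd {χ : F → 𝕜} (hχ : ContDiff ℝ 1 χ) (hc : HasCompactSupport χ) (e : F) :
    ∫ z, pd e χ z ∂(gibbs δ) = ∫ z, pd e W z • χ z ∂(gibbs δ) := by
  rw [integral_gibbs h.smooth.continuous h.pos, integral_gibbs h.smooth.continuous h.pos]
  have hχd : Continuous (pd e χ) := (hχ.continuous_fderiv one_ne_zero).clm_apply continuous_const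
  have hδd : Continuous (pd e δ) := (contDiff_pd h.smooth e).continuous
  have := integral_smul_fderiv_eq_neg_fderiv_smul_of_integrable (μ := (volume : Measure F))
    (f := δ) (g := χ) (v := e)
    ((hδd.smul hχ.continuous).integrable_of_hasCompactSupport hc.smul_left)
    ((h.smooth.continuous.smul hχd).integrable_of_hasCompactSupport (hc.pd e).smul_left)
    ((h.smooth.continuous.smul hχ.continuous).integrable_of_hasCompactSupport hc.smul_left)
    (fun z _ => h.smooth.differentiable (by simp) z)
    (fun z _ => hχ.differentiable one_ne_zero z)
  rw [show (∫ z, δ z • pd e χ z) = _ from this, ← integral_neg]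
  congr 1
  ext z
  have h1 := h.pd_eq e z
  rw [pd] at h1
  rw [h1, neg_smul, neg_neg, mul_smul]

variable {ι : Type*} [Fintype ι] (E : ι → F)

omit h in
/-- The weighted Laplacian `∑ ∂ᵢ* ∂ᵢ`, along the family `E` of directions. -/
def gibbsLap (E : ι → F) (W : F → ℝ) (φ : F → 𝕜) (z : F) : 𝕜 :=
  ∑ i, (pd (E i) W z • pd (E i) φ z - pd (E i) (pd (E i) φ) z)

omit h in
@[fun_prop]
theorem contDiff_gibbsLap {φ : F → 𝕜} (hφ : ContDiff ℝ ∞ φ) (hW : ContDiff ℝ ∞ W) :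
    ContDiff ℝ ∞ (gibbsLap E W φ) := by
  unfold gibbsLap
  fun_prop

theorem IsGibbs.isTest_gibbsLap {φ : F → 𝕜} (hφ : IsTest φ) : IsTest (gibbsLap E W φ) :=
  IsTest.sum _ fun _ => ((hφ.pd _).smul_left (contDiff_pd h.smooth_potential _)).sub
    ((hφ.pd _).pd _)

theorem IsGibbs.integral_gibbsLap_mul {φ ψ : F → 𝕜} (hφ : ContDiff ℝ ∞ φ) (hψ : ContDiff ℝ ∞ ψ)
    (hc : HasCompactSupport φ ∨ HasCompactSupport ψ) :
    ∫ z, gibbsLap E W φ z * ψ z ∂(gibbs δ) =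
      ∑ i, ∫ z, pd (E i) φ z * pd (E i) ψ z ∂(gibbs δ) := by
  have hT : ∀ {a b : F → 𝕜}, ContDiff ℝ ∞ a → ContDiff ℝ ∞ b →
      (HasCompactSupport φ → HasCompactSupport a) →
      (HasCompactSupport ψ → HasCompactSupport b) → IsTest fun z => a z * b z := by
    intro a b ha hb ha' hb'
    rcases hc with hc | hc
    · exact IsTest.mul_right ⟨ha, ha' hc⟩ hb
    · exact IsTest.mul_left ⟨hb, hb' hc⟩ ha
  have hW := h.smooth_potential
  have t1 : ∀ i, IsTest fun z => pd (E i) φ z * ψ z := fun i =>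
    hT (by fun_prop) hψ (fun hc => hc.pd _) id
  have t2 : ∀ i, IsTest fun z => pd (E i) (pd (E i) φ) z * ψ z := fun i =>
    hT (by fun_prop) hψ (fun hc => (hc.pd _).pd _) id
  have t3 : ∀ i, IsTest fun z => pd (E i) φ z * pd (E i) ψ z := fun i =>
    hT (by fun_prop) (by fun_prop) (fun hc => hc.pd _) (fun hc => hc.pd _)
  have t4 : ∀ i, IsTest fun z => pd (E i) W z • (pd (E i) φ z * ψ z) := fun i =>
    (t1 i).smul_left (by fun_prop)
  have h3 : ∀ i z, (pd (E i) W z • pd (E i) φ z - pd (E i) (pd (E i) φ) z) * ψ z =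
      pd (E i) W z • (pd (E i) φ z * ψ z) - pd (E i) (pd (E i) φ) z * ψ z := fun i z => by
    rw [sub_mul, smul_mul_assoc]
  simp_rw [gibbsLap, Finset.sum_mul, h3]
  rw [integral_finsetSum _ fun i _ => h.integrable ((t4 i).sub (t2 i))]
  refine Finset.sum_congr rfl fun i _ => ?_
  have h1 := h.integral_pd ((t1 i).1.of_le (by simp)) (t1 i).2 (E i)
  have h2 : pd (E i) (fun z => pd (E i) φ z * ψ z) = fun z =>
      pd (E i) (pd (E i) φ) z * ψ z + pd (E i) φ z * pd (E i) ψ z := by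
    ext z; exact pd_mul (by fun_prop) hψ _ _
  rw [h2, integral_add (h.integrable (t2 i)) (h.integrable (t3 i))] at h1
  rw [integral_sub (h.integrable (t4 i)) (h.integrable (t2 i)), ← h1]
  ring

end

variable {ι : Type*} [Fintype ι] (E : ι → F)

/-- The commutator of a derivative with the weighted Laplacian is the Hessian of the potential. -/
theorem IsGibbs.pd_gibbsLap {φ : F → ℝ} (hφ : ContDiff ℝ ∞ φ) (e z : F) :
    pd e (gibbsLap E W φ) z = gibbsLap E W (pd e φ) z
      + ∑ j, pd e (pd (E j) W) z * pd (E j) φ z := by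
  have hW := h.smooth_potential
  have h1 : pd e (gibbsLap E W φ) z = ∑ i, pd e (fun z => pd (E i) W z • pd (E i) φ z
      - pd (E i) (pd (E i) φ) z) z := pd_sum Finset.univ (fun i => by fun_prop) e z
  rw [h1, gibbsLap, ← Finset.sum_add_distrib]
  refine Finset.sum_congr rfl fun i _ => ?_
  have hφi := contDiff_pd hφ (E i)
  rw [pd_sub (by fun_prop) (by fun_prop), pd_smul (by fun_prop) hφi, pd_comm hφ e (E i),
    pd_comm hφi e (E i), pd_comm hφ e (E i)]
  simp only [smul_eq_mul]
  ring

/-- **Bochner's formula**, integrated. -/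
theorem IsGibbs.integral_gibbsLap_sq {φ : F → ℝ} (hφ : IsTest φ) :
    ∫ z, gibbsLap E W φ z ^ 2 ∂(gibbs δ) =
      ∑ i, ∑ j, ∫ z, (pd (E j) (pd (E i) φ) z ^ 2
        + pd (E i) (pd (E j) W) z * pd (E i) φ z * pd (E j) φ z) ∂(gibbs δ) := by
  have hW := h.smooth_potential
  simp_rw [sq (gibbsLap E W φ _)]
  rw [h.integral_gibbsLap_mul E hφ.1 (contDiff_gibbsLap E hφ.1 hW) (Or.inl hφ.2)]
  refine Finset.sum_congr rfl fun i _ => ?_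
  have hφi := hφ.pd (E i)
  have h1 : ∀ z, pd (E i) φ z * pd (E i) (gibbsLap E W φ) z =
      gibbsLap E W (pd (E i) φ) z * pd (E i) φ z
        + ∑ j, pd (E i) (pd (E j) W) z * pd (E i) φ z * pd (E j) φ z := by
    intro z
    rw [h.pd_gibbsLap E hφ.1, mul_add, Finset.mul_sum, mul_comm]
    congr 1
    exact Finset.sum_congr rfl fun j _ => by ring
  have hint1 : ∀ j, Integrable (fun z => pd (E i) (pd (E j) W) z * pd (E i) φ z * pd (E j) φ z)
      (gibbs δ) := fun j =>
    h.integrable ((hφ.pd (E j)).mul_left (by have := hφi.1; fun_prop))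
  have hint2 : ∀ j, Integrable (fun z => pd (E j) (pd (E i) φ) z ^ 2) (gibbs δ) := fun j =>
    h.integrable (hφi.pd (E j)).sq
  simp_rw [h1]
  rw [integral_add (h.integrable ((h.isTest_gibbsLap E hφi).mul_right hφi.1))
    (integrable_finsetSum _ fun j _ => hint1 j), integral_finsetSum _ fun j _ => hint1 j,
    h.integral_gibbsLap_mul E hφi.1 hφi.1 (Or.inl hφi.2), ← Finset.sum_add_distrib]
  refine Finset.sum_congr rfl fun j _ => ?_
  rw [integral_add (hint2 j) (hint1 j)]
  simp_rw [sq]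

/-- The norm of `∂* u`, where `∂* u = ∂W u - ∂u` is the adjoint of `∂` for the measure. -/
theorem IsGibbs.integral_adjoint_sq (e : F) {u : F → ℝ} (hu : IsTest u) :
    ∫ z, (pd e W z * u z - pd e u z) ^ 2 ∂(gibbs δ) =
      ∫ z, (pd e u z ^ 2 + pd e (pd e W) z * u z ^ 2) ∂(gibbs δ) := by
  have hW := h.smooth_potential
  have hWe := contDiff_pd hW e
  have hu' := hu.pd e
  have ha : IsTest fun z => pd e W z * u z - pd e u z := (hu.mul_left hWe).sub hu'
  -- the two integrands differ by the derivative of `u ∂* u` against the measure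
  set χ : F → ℝ := fun z => u z * (pd e W z * u z - pd e u z) with hχ
  have hχt : IsTest χ := ha.mul_left hu.1
  have h1 := h.integral_pd (hχt.1.of_le (by simp)) hχt.2 e
  have h2 : ∀ z, pd e χ z = pd e u z * (pd e W z * u z - pd e u z)
      + u z * (pd e (pd e W) z * u z + pd e W z * pd e u z - pd e (pd e u) z) := by
    intro z
    rw [hχ, pd_mul hu.1 ha.1, pd_sub (hu.mul_left hWe).1 hu'.1, pd_mul hWe hu.1]
  have h5 := h.integral_gibbsLap_mul (fun _ : Unit => e) hu.1 hu.1 (Or.inl hu.2)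
  simp only [gibbsLap, Finset.univ_unique, Finset.sum_singleton, smul_eq_mul] at h5
  have i1 : Integrable (fun z => pd e χ z) (gibbs δ) := h.integrable (hχt.pd e)
  have i2 : Integrable (fun z => pd e W z • χ z) (gibbs δ) := h.integrable (hχt.smul_left hWe)
  have i3 : Integrable (fun z => pd e u z * pd e u z) (gibbs δ) :=
    h.integrable (hu'.mul_left hu'.1)
  have i4 : Integrable (fun z => (pd e W z * pd e u z - pd e (pd e u) z) * u z) (gibbs δ) :=
    h.integrable (hu.mul_left (by have := hu.1; fun_prop))
  have i5 : Integrable (fun z => (pd e W z * u z - pd e u z) ^ 2) (gibbs δ) := h.integrable ha.sq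
  have i6 : Integrable (fun z => (pd e u z ^ 2 + pd e (pd e W) z * u z ^ 2)) (gibbs δ) :=
    h.integrable (hu'.sq.add (hu.sq.mul_left (by fun_prop)))
  have h6 : ∀ z, (pd e W z * u z - pd e u z) ^ 2 - (pd e u z ^ 2 + pd e (pd e W) z * u z ^ 2) =
      (pd e W z • χ z - pd e χ z)
        + ((pd e W z * pd e u z - pd e (pd e u) z) * u z - pd e u z * pd e u z) := by
    intro z
    rw [h2]; simp only [hχ, smul_eq_mul]; ring
  have h7 : ∫ z, ((pd e W z * u z - pd e u z) ^ 2
      - (pd e u z ^ 2 + pd e (pd e W) z * u z ^ 2)) ∂(gibbs δ) = 0 := by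
    simp_rw [h6]
    have j1 : Integrable (fun z => pd e W z • χ z - pd e χ z) (gibbs δ) := i2.sub i1
    have j2 : Integrable (fun z => (pd e W z * pd e u z - pd e (pd e u) z) * u z
      - pd e u z * pd e u z) (gibbs δ) := i4.sub i3
    rw [integral_add j1 j2, integral_sub i2 i1, integral_sub i4 i3, h1, h5]
    ring
  rw [integral_sub i5 i6] at h7
  linarith

end Gibbs

/-! ### The Maxwellian and Gaussian moments -/

section Maxwellian

variable {d : ℕ}

/-- The unit vector of the coordinate `j`. -/
abbrev ebasis (j : Fin d) : E d := EuclideanSpace.single j 1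

/-- The coordinate directions of phase space: positions first, then velocities. -/
def phaseDir : Fin d ⊕ Fin d → E d × E d :=
  Sum.elim (fun j => (ebasis j, 0)) (fun j => (0, ebasis j))

/-- The potential of the global Maxwellian `M`, up to a constant. -/
def phasePot (V : E d → ℝ) (z : E d × E d) : ℝ := V z.1 + ‖z.2‖ ^ 2 / 2

theorem norm_ebasis (j : Fin d) : ‖(ebasis j : E d)‖ = 1 := by simp [ebasis]

theorem dX_eq {𝕜 : Type} [RCLike 𝕜] (j : Fin d) (φ : E d × E d → 𝕜) :
    dX j φ = pd (phaseDir (Sum.inl j)) φ := rfl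

theorem dV_eq {𝕜 : Type} [RCLike 𝕜] (j : Fin d) (φ : E d × E d → 𝕜) :
    dV j φ = pd (phaseDir (Sum.inr j)) φ := rfl

theorem gradV_eq (V : E d → ℝ) (j : Fin d) : gradV V j = pd (ebasis j) V := rfl

theorem contDiff_half_norm_sq : ContDiff ℝ ∞ fun v : E d => ‖v‖ ^ 2 / 2 :=
  (contDiff_norm_sq ℝ).div_const _

theorem pd_half_norm_sq (j : Fin d) (v : E d) :
    pd (ebasis j) (fun v : E d => ‖v‖ ^ 2 / 2) v = v j := by
  have h1 : HasFDerivAt (fun v : E d => ‖v‖ ^ 2) (2 • innerSL ℝ v) v :=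
    (hasStrictFDerivAt_norm_sq v).hasFDerivAt
  have h2 := h1.mul_const (2⁻¹ : ℝ)
  have h3 : (fun v : E d => ‖v‖ ^ 2 / 2) = fun v => ‖v‖ ^ 2 * 2⁻¹ := by
    ext; rw [div_eq_mul_inv]
  rw [pd, h3, h2.fderiv]
  simp [ebasis, EuclideanSpace.inner_single_right]

theorem pd_comp_fst {𝕜 : Type*} [NormedAddCommGroup 𝕜] [NormedSpace ℝ 𝕜] {w : E d → 𝕜}
    (hw : ContDiff ℝ ∞ w) (e z : E d × E d) :
    pd e (fun z : E d × E d => w z.1) z = pd e.1 w z.1 := by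
  have := (hw.hasFDerivAt' z.1).comp z (hasFDerivAt_fst (𝕜 := ℝ) (p := z))
  have h2 : (fun z : E d × E d => w z.1) = w ∘ Prod.fst := rfl
  rw [pd, h2, this.fderiv]; rfl

theorem pd_comp_snd {𝕜 : Type*} [NormedAddCommGroup 𝕜] [NormedSpace ℝ 𝕜] {w : E d → 𝕜}
    (hw : ContDiff ℝ ∞ w) (e z : E d × E d) :
    pd e (fun z : E d × E d => w z.2) z = pd e.2 w z.2 := by
  have := (hw.hasFDerivAt' z.2).comp z (hasFDerivAt_snd (𝕜 := ℝ) (p := z))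
  have h2 : (fun z : E d × E d => w z.2) = w ∘ Prod.snd := rfl
  rw [pd, h2, this.fderiv]; rfl

variable {V : E d → ℝ}

theorem contDiff_phasePot (hV : ContDiff ℝ ∞ V) : ContDiff ℝ ∞ (phasePot V) :=
  (hV.comp contDiff_fst).add (contDiff_half_norm_sq.comp contDiff_snd)

theorem pd_phasePot (hV : ContDiff ℝ ∞ V) (e z : E d × E d) :
    pd e (phasePot V) z = pd e.1 V z.1 + pd e.2 (fun v : E d => ‖v‖ ^ 2 / 2) z.2 := by
  have h1 : ContDiff ℝ ∞ fun z : E d × E d => V z.1 := hV.comp contDiff_fst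
  have h2 : ContDiff ℝ ∞ fun z : E d × E d => ‖z.2‖ ^ 2 / 2 :=
    contDiff_half_norm_sq.comp contDiff_snd
  have h3 := pd_add h1 h2 e z
  rw [pd_comp_fst hV, pd_comp_snd contDiff_half_norm_sq] at h3
  exact h3

theorem pd_zero {F 𝕜 : Type*} [NormedAddCommGroup F] [NormedSpace ℝ F] [NormedAddCommGroup 𝕜]
    [NormedSpace ℝ 𝕜] (φ : F → 𝕜) (z : F) : pd 0 φ z = 0 := by simp [pd]

theorem pd_inl_phasePot (hV : ContDiff ℝ ∞ V) (j : Fin d) :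
    pd (phaseDir (Sum.inl j)) (phasePot V) = fun z => gradV V j z.1 := by
  ext z
  rw [pd_phasePot hV]
  simp [phaseDir, gradV_eq, pd_zero]

theorem pd_inr_phasePot (hV : ContDiff ℝ ∞ V) (j : Fin d) :
    pd (phaseDir (Sum.inr j)) (phasePot V) = fun z => z.2 j := by
  ext z
  rw [pd_phasePot hV]
  simp [phaseDir, pd_zero, pd_half_norm_sq]

theorem contDiff_coord (j : Fin d) : ContDiff ℝ ∞ fun v : E d => v j :=
  (EuclideanSpace.proj (𝕜 := ℝ) j).contDiff

theorem pd_coord (e : E d) (j : Fin d) (v : E d) : pd e (fun v : E d => v j) v = e j := by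
  have : (fun v : E d => v j) = EuclideanSpace.proj (𝕜 := ℝ) j := rfl
  rw [pd, this, ContinuousLinearMap.fderiv]; rfl

theorem contDiff_gradV (hV : ContDiff ℝ ∞ V) (j : Fin d) : ContDiff ℝ ∞ (gradV V j) :=
  contDiff_pd hV _

theorem contDiff_phase_coord (j : Fin d) : ContDiff ℝ ∞ fun z : E d × E d => z.2 j :=
  (contDiff_coord j).comp contDiff_snd

theorem contDiff_phase_gradV (hV : ContDiff ℝ ∞ V) (j : Fin d) :
    ContDiff ℝ ∞ fun z : E d × E d => gradV V j z.1 :=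
  (contDiff_gradV hV j).comp contDiff_fst

theorem abs_pd_gradV_le (hV : ContDiff ℝ ∞ V) {C : ℝ} (hC : ∀ x, ‖iteratedFDeriv ℝ 2 V x‖ ≤ C)
    (i j : Fin d) (x : E d) : |pd (ebasis i) (gradV V j) x| ≤ C := by
  have h1 : pd (ebasis i) (gradV V j) x = iteratedFDeriv ℝ 2 V x ![ebasis i, ebasis j] := by
    rw [iteratedFDeriv_two_apply]
    have h1 : HasFDerivAt (fderiv ℝ V) (fderiv ℝ (fderiv ℝ V) x) x :=
      (hV.fderiv_right (m := ∞) (by simp)).hasFDerivAt' x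
    have h2 := h1.clm_apply (hasFDerivAt_const (ebasis j) x)
    have h3 : gradV V j = fun y => fderiv ℝ V y (ebasis j) := rfl
    rw [pd, h3, h2.fderiv]
    simp
  rw [h1, ← Real.norm_eq_abs]
  refine ((iteratedFDeriv ℝ 2 V x).le_opNorm _).trans ?_
  simpa using hC x

theorem muInf_pos (v : E d) : 0 < muInf v := by unfold muInf; positivity

theorem continuous_muInf : Continuous (muInf : E d → ℝ) := by unfold muInf; fun_prop

theorem isGibbs_of_exp {F : Type*} [NormedAddCommGroup F] [NormedSpace ℝ F] {W δ : F → ℝ} {c : ℝ}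
    (hc : 0 < c) (hW : ContDiff ℝ ∞ W) (h : δ = fun z => c * Real.exp (-W z)) : IsGibbs W δ := by
  subst h
  refine ⟨hW, by fun_prop, fun z => by positivity, fun e z => ?_⟩
  rw [pd, (((hW.hasFDerivAt' z).fun_neg.exp).const_mul c).fderiv]
  simp [pd, mul_assoc]

theorem isGibbs_muInf : IsGibbs (fun v : E d => ‖v‖ ^ 2 / 2) (muInf : E d → ℝ) := by
  refine isGibbs_of_exp (c := ((2 * Real.pi) ^ ((d : ℝ) / 2))⁻¹) (by positivity)
    contDiff_half_norm_sq ?_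
  ext v
  rw [muInf, div_eq_inv_mul, neg_div]

theorem integral_exp_pos (hV : IsConfining V) : 0 < ∫ y, Real.exp (-V y) := by
  refine (integral_pos_iff_support_of_nonneg (fun y => (Real.exp_pos _).le) hV.integrable).2 ?_
  have : Function.support (fun y => Real.exp (-V y)) = Set.univ := by
    ext y; simp [Real.exp_ne_zero]
  rw [this]
  exact Measure.measure_univ_pos.2 (NeZero.ne _)

theorem rhoInf_pos (hV : IsConfining V) (x : E d) : 0 < rhoInf V x :=
  div_pos (Real.exp_pos _) (integral_exp_pos hV)

theorem isGibbs_rhoInf (hV : IsConfining V) : IsGibbs V (rhoInf V) := by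
  refine isGibbs_of_exp (c := (∫ y, Real.exp (-V y))⁻¹) (inv_pos.2 (integral_exp_pos hV))
    hV.smooth ?_
  ext v
  rw [rhoInf, div_eq_inv_mul]

theorem isGibbs_maxwellian (hV : IsConfining V) : IsGibbs (phasePot V) (maxwellian V) := by
  have h0 := integral_exp_pos hV
  refine isGibbs_of_exp (c := (∫ y, Real.exp (-V y))⁻¹ * ((2 * Real.pi) ^ ((d : ℝ) / 2))⁻¹)
    (by positivity) (contDiff_phasePot hV.smooth) ?_
  ext z
  rw [maxwellian, rhoInf, muInf, phasePot, neg_add, Real.exp_add]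
  rw [div_eq_inv_mul, div_eq_inv_mul, neg_div]
  ring

theorem maxwellian_pos (hV : IsConfining V) (z : E d × E d) : 0 < maxwellian V z :=
  (isGibbs_maxwellian hV).pos z

theorem integrable_rhoInf (hV : IsConfining V) : Integrable (rhoInf V) :=
  hV.integrable.div_const _

theorem integral_rhoInf (hV : IsConfining V) : ∫ x, rhoInf V x = 1 := by
  simp_rw [rhoInf]
  rw [integral_div, div_self (integral_exp_pos hV).ne']

theorem integrable_exp_neg_mul_norm_sq {b : ℝ} (hb : 0 < b) :
    Integrable fun v : E d => Real.exp (-b * ‖v‖ ^ 2) := by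
  have := GaussianFourier.integrable_cexp_neg_mul_sq_norm_add (V := E d) (b := (b : ℂ))
    (by simpa using hb) 0 0
  have h2 := this.norm
  refine h2.congr (Eventually.of_forall fun v => ?_)
  simp only [Complex.norm_exp]
  congr 1
  simp [← Complex.ofReal_pow, ← Complex.ofReal_mul, ← Complex.ofReal_neg]

theorem integral_muInf : ∫ v : E d, muInf v = 1 := by
  have h1 := GaussianFourier.integral_rexp_neg_mul_sq_norm (V := E d) (b := 1 / 2) (by norm_num)
  have h2 : (Real.pi / (1 / 2)) = 2 * Real.pi := by ring
  rw [h2, finrank_euclideanSpace_fin] at h1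
  simp_rw [muInf]
  rw [integral_div, div_eq_one_iff_eq (by positivity), ← h1]
  congr 1
  ext v
  congr 1
  ring

theorem integrable_pow_mul_muInf (k : ℕ) : Integrable fun v : E d => ‖v‖ ^ (2 * k) * muInf v := by
  have h1 : Integrable fun v : E d => Real.exp (-(1 / 4 : ℝ) * ‖v‖ ^ 2) :=
    integrable_exp_neg_mul_norm_sq (by norm_num)
  refine (h1.const_mul (4 ^ k * (k.factorial : ℝ) * ((2 * Real.pi) ^ ((d : ℝ) / 2))⁻¹)).mono'
    (by have := continuous_muInf (d := d); fun_prop) (Eventually.of_forall fun v => ?_)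
  have hm := muInf_pos v
  rw [Real.norm_of_nonneg (by positivity), muInf, div_eq_inv_mul]
  have h2 := Real.pow_div_factorial_le_exp (x := ‖v‖ ^ 2 / 4) (by positivity) k
  rw [div_le_iff₀ (by positivity), div_pow, div_le_iff₀ (by positivity), ← pow_mul] at h2
  have h3 : Real.exp (-‖v‖ ^ 2 / 2)
      = Real.exp (-(1 / 4 : ℝ) * ‖v‖ ^ 2) * Real.exp (-(‖v‖ ^ 2 / 4)) := by
    rw [← Real.exp_add]; congr 1; ring
  have h4 : Real.exp (‖v‖ ^ 2 / 4) * Real.exp (-(‖v‖ ^ 2 / 4)) = 1 := by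
    rw [← Real.exp_add]; simp
  rw [h3]
  set P := ((2 * Real.pi) ^ ((d : ℝ) / 2))⁻¹ with hP
  have hP0 : 0 < P := by positivity
  calc ‖v‖ ^ (2 * k) * (P * (Real.exp (-(1 / 4 : ℝ) * ‖v‖ ^ 2) * Real.exp (-(‖v‖ ^ 2 / 4))))
      ≤ (Real.exp (‖v‖ ^ 2 / 4) * k.factorial * 4 ^ k) *
        (P * (Real.exp (-(1 / 4 : ℝ) * ‖v‖ ^ 2) * Real.exp (-(‖v‖ ^ 2 / 4)))) := by gcongr
    _ = 4 ^ k * (k.factorial : ℝ) * P * Real.exp (-(1 / 4 : ℝ) * ‖v‖ ^ 2) *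
        (Real.exp (‖v‖ ^ 2 / 4) * Real.exp (-(‖v‖ ^ 2 / 4))) := by ring
    _ = _ := by rw [h4, mul_one]

theorem integrable_muInf : Integrable (muInf : E d → ℝ) := by
  simpa using integrable_pow_mul_muInf (d := d) 0

/-- The measure `μ_∞ (v) dv`. -/
abbrev gaussMeas (d : ℕ) : Measure (E d) := gibbs muInf

/-- The measure `ρ_∞ (x) dx`. -/
abbrev rhoMeas (V : E d → ℝ) : Measure (E d) := gibbs (rhoInf V)

/-- The measure `M dx dv`. -/
abbrev phaseMeas (V : E d → ℝ) : Measure (E d × E d) := gibbs (maxwellian V)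

theorem isProbabilityMeasure_gibbs {F : Type*} [NormedAddCommGroup F] [NormedSpace ℝ F]
    [MeasureSpace F] {δ : F → ℝ} (hpos : ∀ z, 0 < δ z) (hi : Integrable δ)
    (h1 : ∫ z, δ z = 1) : IsProbabilityMeasure (gibbs δ) := by
  constructor
  rw [gibbs, withDensity_apply _ MeasurableSet.univ, Measure.restrict_univ,
    ← ofReal_integral_eq_lintegral_ofReal hi (Eventually.of_forall fun z => (hpos z).le), h1]
  simp

instance : IsProbabilityMeasure (gaussMeas d) :=
  isProbabilityMeasure_gibbs muInf_pos integrable_muInf integral_muInf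

theorem isProbabilityMeasure_rhoMeas (hV : IsConfining V) : IsProbabilityMeasure (rhoMeas V) :=
  isProbabilityMeasure_gibbs (rhoInf_pos hV) (integrable_rhoInf hV) (integral_rhoInf hV)

theorem phaseMeas_eq_prod (hV : IsConfining V) :
    phaseMeas V = (rhoMeas V).prod (gaussMeas d) := by
  have := isProbabilityMeasure_rhoMeas hV
  have h1 : Measurable fun x => ENNReal.ofReal (rhoInf V x) :=
    (isGibbs_rhoInf hV).smooth.continuous.measurable.ennreal_ofReal
  have h2 : Measurable fun x : E d => ENNReal.ofReal (muInf x) :=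
    continuous_muInf.measurable.ennreal_ofReal
  have h3 : SFinite (volume.withDensity fun x : E d => ENNReal.ofReal (rhoInf V x)) := by
    change SFinite (rhoMeas V); infer_instance
  have h4 : SFinite (volume.withDensity fun x : E d => ENNReal.ofReal (muInf x)) := by
    change SFinite (gaussMeas d); infer_instance
  rw [gaussMeas, rhoMeas, gibbs, gibbs, prod_withDensity h1 h2, ← Measure.volume_eq_prod,
    phaseMeas, gibbs]
  congr 1
  ext z
  rw [maxwellian, ENNReal.ofReal_mul (rhoInf_pos hV _).le]

theorem isProbabilityMeasure_phaseMeas (hV : IsConfining V) :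
    IsProbabilityMeasure (phaseMeas V) := by
  have := isProbabilityMeasure_rhoMeas hV
  rw [phaseMeas_eq_prod hV]; infer_instance

theorem integrable_gaussMeas_iff {f : E d → ℝ} :
    Integrable f (gaussMeas d) ↔ Integrable fun v => f v * muInf v := by
  rw [gaussMeas, gibbs, integrable_withDensity_iff continuous_muInf.measurable.ennreal_ofReal
    (by simp)]
  simp_rw [ENNReal.toReal_ofReal (muInf_pos _).le]

theorem integral_gaussMeas (f : E d → ℝ) :
    ∫ v, f v ∂(gaussMeas d) = ∫ v, f v * muInf v := by
  rw [integral_gibbs continuous_muInf muInf_pos]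
  simp_rw [smul_eq_mul, mul_comm]

theorem integrable_gaussMeas_of_le {f : E d → ℝ} (hf : Continuous f) {C : ℝ}
    (h : ∀ v, |f v| ≤ C * (1 + ‖v‖ ^ 4)) : Integrable f (gaussMeas d) := by
  have h0 : Integrable (fun v : E d => ‖v‖ ^ 4) (gaussMeas d) :=
    integrable_gaussMeas_iff.2 (integrable_pow_mul_muInf 2)
  exact (((integrable_const 1).add h0).const_mul C).mono' hf.aestronglyMeasurable
    (Eventually.of_forall h)

theorem abs_coord_le (v : E d) (j : Fin d) : |v j| ≤ ‖v‖ := PiLp.norm_apply_le v j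

theorem integrable_coord (i : Fin d) : Integrable (fun v : E d => v i) (gaussMeas d) := by
  refine integrable_gaussMeas_of_le (C := 1) (by fun_prop) fun v => ?_
  have h1 := abs_coord_le v i
  nlinarith [sq_nonneg (‖v‖ - 1), sq_nonneg (‖v‖ ^ 2 - 1), norm_nonneg v]

theorem integrable_coord_mul_coord (i j : Fin d) :
    Integrable (fun v : E d => v i * v j) (gaussMeas d) := by
  refine integrable_gaussMeas_of_le (C := 1) (by fun_prop) fun v => ?_
  have h1 := mul_le_mul (abs_coord_le v i) (abs_coord_le v j) (abs_nonneg _) (norm_nonneg v)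
  rw [← abs_mul] at h1
  nlinarith [sq_nonneg (‖v‖ ^ 2 - 1), norm_nonneg v]

theorem pd_muInf (j : Fin d) (v : E d) : fderiv ℝ muInf v (ebasis j) = -(muInf v * v j) := by
  have := isGibbs_muInf.pd_eq (ebasis j) v
  rwa [pd_half_norm_sq] at this

/-- Integration by parts against the Gaussian, for functions without compact support. -/
theorem integral_mul_coord {f : E d → ℝ} (hf : ContDiff ℝ ∞ f) (j : Fin d)
    (h0 : Integrable f (gaussMeas d)) (h1 : Integrable (pd (ebasis j) f) (gaussMeas d))
    (h2 : Integrable (fun v => f v * v j) (gaussMeas d)) :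
    ∫ v, f v * v j ∂(gaussMeas d) = ∫ v, pd (ebasis j) f v ∂(gaussMeas d) := by
  rw [integrable_gaussMeas_iff] at h0 h1 h2
  rw [integral_gaussMeas, integral_gaussMeas]
  have hs := (isGibbs_muInf (d := d)).smooth
  have := integral_mul_fderiv_eq_neg_fderiv_mul_of_integrable (μ := (volume : Measure (E d)))
    (f := f) (g := muInf) (v := ebasis j) h1 (by
      simp_rw [pd_muInf]
      refine h2.neg.congr (Eventually.of_forall fun v => ?_)
      simp; ring) h0
    (fun z _ => hf.differentiable (by simp) z) (fun z _ => hs.differentiable (by simp) z)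
  rw [← neg_eq_iff_eq_neg, ← integral_neg] at this
  rw [show (∫ v, pd (ebasis j) f v * muInf v) = _ from this.symm]
  congr 1
  ext v
  rw [pd_muInf]; ring

theorem integral_coord (j : Fin d) : ∫ v, v j ∂(gaussMeas d) = 0 := by
  have h1 : pd (ebasis j) (fun _ : E d => (1 : ℝ)) = fun _ => 0 := by ext v; simp [pd]
  have := integral_mul_coord (f := fun _ : E d => (1 : ℝ)) contDiff_const j (integrable_const _)
    (by rw [h1]; exact integrable_zero _ _ _) (by simpa using integrable_coord j)
  simpa [pd] using this

theorem integral_coord_mul_coord (i j : Fin d) :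
    ∫ v, v i * v j ∂(gaussMeas d) = if i = j then 1 else 0 := by
  have h1 : pd (ebasis j) (fun v : E d => v i) = fun _ => if i = j then 1 else 0 := by
    ext v
    rw [pd_coord]; simp [ebasis]
  have := integral_mul_coord (f := fun v : E d => v i) (contDiff_coord i) j (integrable_coord i)
    (by rw [h1]; exact integrable_const _) (integrable_coord_mul_coord i j)
  rw [this, h1]
  simp

end Maxwellian

/-! ### The weighted space `B²` in terms of `f / M` -/

section Embedding

instance {d : ℕ} : (volume : Measure (E d × E d)).IsAddHaarMeasure := by
  rw [Measure.volume_eq_prod]; infer_instance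

variable {𝕜 : Type} [RCLike 𝕜] {d : ℕ} {V : E d → ℝ}

/-- Continuous functions that are square integrable against the Maxwellian. -/
def SqInt (V : E d → ℝ) (h : E d × E d → 𝕜) : Prop :=
  Continuous h ∧ Integrable (fun z => ‖h z‖ ^ 2) (phaseMeas V)

open Classical in
/-- The element `h M` of `B²`, for `h` square integrable against the Maxwellian `M`, and `0`
otherwise. -/
def emb (V : E d → ℝ) (h : E d × E d → 𝕜) : B2 𝕜 V :=
  if hh : MemLp (fun z => maxwellian V z • h z) 2 (weight V) then hh.toLp _ else 0

theorem continuous_maxwellian (hV : IsConfining V) : Continuous (maxwellian V) :=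
  (isGibbs_maxwellian hV).smooth.continuous

theorem continuous_inv_maxwellian (hV : IsConfining V) :
    Continuous fun z => (maxwellian V z)⁻¹ :=
  (continuous_maxwellian hV).inv₀ fun z => (maxwellian_pos hV z).ne'

theorem inv_maxwellian_pos (hV : IsConfining V) (z : E d × E d) : 0 < (maxwellian V z)⁻¹ :=
  inv_pos.2 (maxwellian_pos hV z)

theorem integral_weight (hV : IsConfining V) {X : Type*} [NormedAddCommGroup X] [NormedSpace ℝ X]
    (f : E d × E d → X) : ∫ z, f z ∂(weight V) = ∫ z, (maxwellian V z)⁻¹ • f z :=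
  integral_gibbs (continuous_inv_maxwellian hV) (inv_maxwellian_pos hV) f

theorem integrable_gibbs_iff {F X : Type*} [NormedAddCommGroup F] [NormedSpace ℝ F]
    [MeasureSpace F] [BorelSpace F] [NormedAddCommGroup X] [NormedSpace ℝ X] {δ : F → ℝ}
    (hδ : Continuous δ) (hpos : ∀ z, 0 < δ z) {f : F → X} :
    Integrable f (gibbs δ) ↔ Integrable fun z => δ z • f z := by
  have := integrable_withDensity_iff_integrable_smul (μ := (volume : Measure F))
    (f := fun z => (δ z).toNNReal) hδ.measurable.real_toNNReal (g := f)
  refine this.trans ?_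
  have h2 : (fun z => (δ z).toNNReal • f z) = fun z => δ z • f z := by
    ext z; rw [NNReal.smul_def, Real.coe_toNNReal _ (hpos z).le]
  rw [h2]

theorem integrable_weight_iff (hV : IsConfining V) {X : Type*} [NormedAddCommGroup X]
    [NormedSpace ℝ X] {f : E d × E d → X} :
    Integrable f (weight V) ↔ Integrable fun z => (maxwellian V z)⁻¹ • f z :=
  integrable_gibbs_iff (continuous_inv_maxwellian hV) (inv_maxwellian_pos hV)

theorem integrable_phaseMeas_iff (hV : IsConfining V) {X : Type*} [NormedAddCommGroup X]
    [NormedSpace ℝ X] {f : E d × E d → X} :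
    Integrable f (phaseMeas V) ↔ Integrable fun z => maxwellian V z • f z :=
  integrable_gibbs_iff (continuous_maxwellian hV) (maxwellian_pos hV)

theorem integral_phaseMeas (hV : IsConfining V) {X : Type*} [NormedAddCommGroup X]
    [NormedSpace ℝ X] (f : E d × E d → X) :
    ∫ z, f z ∂(phaseMeas V) = ∫ z, maxwellian V z • f z :=
  integral_gibbs (continuous_maxwellian hV) (maxwellian_pos hV) f

theorem ae_weight_iff (hV : IsConfining V) {p : E d × E d → Prop} :
    (∀ᵐ z ∂(weight V), p z) ↔ ∀ᵐ z, p z := by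
  constructor
  · intro h
    refine (withDensity_absolutelyContinuous' ?_ ?_).ae_le h
    · exact (continuous_inv_maxwellian hV).measurable.ennreal_ofReal.aemeasurable
    · exact Eventually.of_forall fun z => (ENNReal.ofReal_pos.2 (inv_maxwellian_pos hV z)).ne'
  · exact fun h => (withDensity_absolutelyContinuous _ _).ae_le h

variable {h k : E d × E d → 𝕜}

theorem SqInt.memLp (hV : IsConfining V) (hh : SqInt V h) :
    MemLp (fun z => maxwellian V z • h z) 2 (weight V) := by
  have hc : Continuous fun z => maxwellian V z • h z := (continuous_maxwellian hV).smul hh.1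
  rw [memLp_two_iff_integrable_sq_norm hc.aestronglyMeasurable, integrable_weight_iff hV]
  refine ((integrable_phaseMeas_iff hV).1 hh.2).congr (Eventually.of_forall fun z => ?_)
  have h1 := maxwellian_pos hV z
  simp only [norm_smul, Real.norm_of_nonneg h1.le, smul_eq_mul]
  field_simp

theorem SqInt.coeFn_emb (hV : IsConfining V) (hh : SqInt V h) :
    emb V h =ᵐ[weight V] fun z => maxwellian V z • h z := by
  rw [emb, dif_pos (hh.memLp hV)]
  exact MemLp.coeFn_toLp _

theorem SqInt.memLp_phaseMeas (hh : SqInt V h) : MemLp h 2 (phaseMeas V) :=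
  (memLp_two_iff_integrable_sq_norm hh.1.aestronglyMeasurable).2 hh.2

theorem SqInt.of_memLp (hc : Continuous h) (hh : MemLp h 2 (phaseMeas V)) : SqInt V h :=
  ⟨hc, (memLp_two_iff_integrable_sq_norm hc.aestronglyMeasurable).1 hh⟩

theorem SqInt.add (hh : SqInt V h) (hk : SqInt V k) : SqInt V fun z => h z + k z :=
  .of_memLp (hh.1.add hk.1) (hh.memLp_phaseMeas.add hk.memLp_phaseMeas)

theorem SqInt.sub (hh : SqInt V h) (hk : SqInt V k) : SqInt V fun z => h z - k z :=
  .of_memLp (hh.1.sub hk.1) (hh.memLp_phaseMeas.sub hk.memLp_phaseMeas)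

theorem SqInt.const_smul (hh : SqInt V h) (c : 𝕜) : SqInt V fun z => c • h z :=
  .of_memLp (hh.1.const_smul c) (hh.memLp_phaseMeas.const_smul c)

theorem IsTest.sqInt (hV : IsConfining V) (hh : IsTest h) : SqInt V h := by
  refine ⟨hh.1.continuous, ?_⟩
  have := (isGibbs_maxwellian hV).isLocallyFiniteMeasure
  refine (hh.1.continuous.norm.pow 2).integrable_of_hasCompactSupport ?_
  have h2 : (fun z => ‖h z‖) ^ 2 = fun z => ‖h z‖ * ‖h z‖ := funext fun z => pow_two _
  rw [h2]
  exact HasCompactSupport.mul_left hh.2.norm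

theorem emb_congr_ae (hV : IsConfining V) (hh : SqInt V h) {f : B2 𝕜 V}
    (hf : f =ᵐ[weight V] fun z => maxwellian V z • h z) : f = emb V h :=
  Lp.ext (hf.trans (hh.coeFn_emb hV).symm)

theorem emb_add (hV : IsConfining V) (hh : SqInt V h) (hk : SqInt V k) :
    emb V (fun z => h z + k z) = emb V h + emb V k := by
  refine (emb_congr_ae hV (hh.add hk) ?_).symm
  filter_upwards [Lp.coeFn_add (emb V h) (emb V k), hh.coeFn_emb hV, hk.coeFn_emb hV]
    with z h1 h2 h3
  rw [h1, Pi.add_apply, h2, h3, smul_add]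

theorem emb_sub (hV : IsConfining V) (hh : SqInt V h) (hk : SqInt V k) :
    emb V (fun z => h z - k z) = emb V h - emb V k := by
  refine (emb_congr_ae hV (hh.sub hk) ?_).symm
  filter_upwards [Lp.coeFn_sub (emb V h) (emb V k), hh.coeFn_emb hV, hk.coeFn_emb hV]
    with z h1 h2 h3
  rw [h1, Pi.sub_apply, h2, h3, smul_sub]

theorem emb_smul (hV : IsConfining V) (hh : SqInt V h) (c : 𝕜) :
    emb V (fun z => c • h z) = c • emb V h := by
  refine (emb_congr_ae hV (hh.const_smul c) ?_).symm
  filter_upwards [Lp.coeFn_smul c (emb V h), hh.coeFn_emb hV] with z h1 h2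
  rw [h1, Pi.smul_apply, h2, smul_comm]

theorem inner_emb (hV : IsConfining V) (hh : SqInt V h) (hk : SqInt V k) :
    inner 𝕜 (emb V h) (emb V k) = ∫ z, inner 𝕜 (h z) (k z) ∂(phaseMeas V) := by
  rw [L2.inner_def, integral_phaseMeas hV]
  have h1 : ∫ z, inner 𝕜 (emb V h z) (emb V k z) ∂(weight V) =
      ∫ z, inner 𝕜 (maxwellian V z • h z) (maxwellian V z • k z) ∂(weight V) := by
    refine integral_congr_ae ?_
    filter_upwards [hh.coeFn_emb hV, hk.coeFn_emb hV] with z h1 h2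
    rw [h1, h2]
  rw [h1, integral_weight hV]
  congr 1
  ext z
  have h1 := (maxwellian_pos hV z).ne'
  rw [← algebraMap_smul 𝕜 (maxwellian V z) (h z), ← algebraMap_smul 𝕜 (maxwellian V z) (k z),
    inner_smul_left, inner_smul_right, RCLike.algebraMap_eq_ofReal, RCLike.conj_ofReal,
    RCLike.real_smul_eq_coe_mul, RCLike.real_smul_eq_coe_mul, RCLike.ofReal_inv]
  have h2 : ((maxwellian V z : ℝ) : 𝕜) ≠ 0 := by exact_mod_cast h1
  field_simp

theorem SqInt.integrable_inner (hh : SqInt V h) (hk : SqInt V k) :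
    Integrable (fun z => inner 𝕜 (h z) (k z)) (phaseMeas V) := by
  refine (L2.integrable_inner (𝕜 := 𝕜) hh.memLp_phaseMeas.toLp hk.memLp_phaseMeas.toLp).congr ?_
  filter_upwards [hh.memLp_phaseMeas.coeFn_toLp, hk.memLp_phaseMeas.coeFn_toLp] with z h1 h2
  rw [h1, h2]

variable (𝕜 d) in
/-- The smooth functions with compact support, as a space. -/
def testSpace : Submodule 𝕜 (E d × E d → 𝕜) where
  carrier := {φ | IsTest φ}
  add_mem' h1 h2 := IsTest.add h1 h2
  zero_mem' := ⟨contDiff_const, HasCompactSupport.zero⟩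
  smul_mem' _ _ h1 := IsTest.mul_left h1 contDiff_const

/-- The linear map from test functions to `B²` given by an operator `A` that is linear on test
functions. -/
def opLin (hV : IsConfining V) (A : (E d × E d → 𝕜) → E d × E d → 𝕜)
    (hA : ∀ φ, IsTest φ → SqInt V (A φ))
    (hadd : ∀ φ ψ, IsTest φ → IsTest ψ → A (φ + ψ) = fun z => A φ z + A ψ z)
    (hsmul : ∀ (c : 𝕜) φ, IsTest φ → A (c • φ) = fun z => c • A φ z) :
    testSpace 𝕜 d →ₗ[𝕜] B2 𝕜 V where
  toFun φ := emb V (A φ)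
  map_add' φ ψ := by
    rw [Submodule.coe_add, hadd _ _ φ.2 ψ.2, emb_add hV (hA _ φ.2) (hA _ ψ.2)]
  map_smul' c φ := by
    rw [Submodule.coe_smul, hsmul c _ φ.2, emb_smul hV (hA _ φ.2), RingHom.id_apply]

/-- An operator `P` on `f` becomes `A` on `h = f / M`, and the closure of its graph from test
functions is then the one of `A`. -/
theorem closureGraph_eq (hV : IsConfining V) {P A : (E d × E d → 𝕜) → E d × E d → 𝕜}
    (hA : ∀ φ, IsTest φ → SqInt V (A φ))
    (hPA : ∀ φ, IsTest φ → P (fun z => maxwellian V z • φ z) = fun z => maxwellian V z • A φ z) :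
    closureGraph V P =
      closure (Set.range fun φ : testSpace 𝕜 d => (emb V (φ : E d × E d → 𝕜), emb V (A φ))) := by
  rw [closureGraph]
  congr 1
  ext p
  constructor
  · rintro ⟨φ, hφ, hc, h1, h2⟩
    have hM := (isGibbs_maxwellian hV).smooth
    have hψ : IsTest fun z => (maxwellian V z)⁻¹ • φ z :=
      IsTest.smul_left ⟨hφ, hc⟩ (hM.inv fun z => (maxwellian_pos hV z).ne')
    have hφψ : φ = fun z => maxwellian V z • (maxwellian V z)⁻¹ • φ z := by
      ext z; rw [smul_smul, mul_inv_cancel₀ (maxwellian_pos hV z).ne', one_smul]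
    refine ⟨⟨_, hψ⟩, Prod.ext ?_ ?_⟩
    · refine (emb_congr_ae hV (hψ.sqInt hV) ?_).symm
      rw [← hφψ]; exact h1
    · refine (emb_congr_ae hV (hA _ hψ) ?_).symm
      rw [← hPA _ hψ, ← hφψ]; exact h2
  · rintro ⟨φ, rfl⟩
    have hM := (isGibbs_maxwellian hV).smooth
    have hφ' : IsTest fun z => maxwellian V z • (φ : E d × E d → 𝕜) z := φ.2.smul_left hM
    refine ⟨_, hφ'.1, hφ'.2, (φ.2.sqInt hV).coeFn_emb hV, ?_⟩
    rw [hPA _ φ.2]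
    exact (hA _ φ.2).coeFn_emb hV

/-- Test functions are dense in `B²`. -/
theorem dense_test (hV : IsConfining V) :
    DenseRange fun φ : testSpace 𝕜 d => emb V (φ : E d × E d → 𝕜) := by
  have hloc : IsLocallyFiniteMeasure (weight V) :=
    IsLocallyFiniteMeasure.withDensity_ofReal (continuous_inv_maxwellian hV)
  have := Lp.dense_hasCompactSupport_contDiff (F := 𝕜) (p := 2) (μ := weight V) (by simp)
  refine this.mono ?_
  rintro f ⟨g, hfg, hg1, hg2⟩
  have hM := (isGibbs_maxwellian hV).smooth
  have hψ : IsTest fun z => (maxwellian V z)⁻¹ • g z :=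
    IsTest.smul_left ⟨hg2, hg1⟩ (hM.inv fun z => (maxwellian_pos hV z).ne')
  refine ⟨⟨_, hψ⟩, (emb_congr_ae hV (hψ.sqInt hV) ?_).symm⟩
  refine hfg.trans (Eventually.of_forall fun z => ?_)
  simp only
  rw [smul_smul, mul_inv_cancel₀ (maxwellian_pos hV z).ne', one_smul]

end Embedding

/-! ### Velocity averages and the transport operator -/

section Average

variable {d : ℕ} {V : E d → ℝ}

/-- The velocity average against the Gaussian: the density of `h M` relative to `ρ_∞`. -/
def vavg (h : E d × E d → ℝ) (x : E d) : ℝ := ∫ v, h (x, v) ∂(gaussMeas d)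

/-- Continuous functions of at most quadratic growth in the velocity are square integrable. -/
theorem SqInt.of_le (hV : IsConfining V) {h : E d × E d → ℝ} (hc : Continuous h) {C : ℝ}
    (hC : ∀ z, |h z| ≤ C * (1 + ‖z.2‖ ^ 2)) : SqInt V h := by
  refine ⟨hc, ?_⟩
  have := isProbabilityMeasure_rhoMeas hV
  have h0 : Integrable (fun v : E d => C ^ 2 * (2 * (1 + ‖v‖ ^ 4))) (gaussMeas d) :=
    integrable_gaussMeas_of_le (C := C ^ 2 * 2) (by fun_prop) fun v => by
      rw [abs_of_nonneg (by positivity)]; linarith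
  have h1 : Integrable (fun z : E d × E d => C ^ 2 * (2 * (1 + ‖z.2‖ ^ 4))) (phaseMeas V) := by
    rw [phaseMeas_eq_prod hV]
    exact h0.comp_snd _
  refine h1.mono' (hc.norm.pow 2).aestronglyMeasurable (Eventually.of_forall fun z => ?_)
  have h2 := hC z
  rw [Real.norm_of_nonneg (by positivity), Real.norm_eq_abs]
  calc |h z| ^ 2 ≤ (C * (1 + ‖z.2‖ ^ 2)) ^ 2 := by gcongr
    _ ≤ C ^ 2 * (2 * (1 + ‖z.2‖ ^ 4)) := by
      rw [mul_pow]
      gcongr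
      nlinarith [sq_nonneg (‖z.2‖ ^ 2 - 1)]

theorem integral_vavg (hV : IsConfining V) {h : E d × E d → ℝ} (hh : Integrable h (phaseMeas V)) :
    ∫ x, vavg h x ∂(rhoMeas V) = ∫ z, h z ∂(phaseMeas V) := by
  have := isProbabilityMeasure_rhoMeas hV
  rw [phaseMeas_eq_prod hV] at hh ⊢
  rw [integral_prod _ hh]; rfl

theorem vavg_mul_fst (h : E d × E d → ℝ) (w : E d → ℝ) (x : E d) :
    vavg (fun z => h z * w z.1) x = vavg h x * w x := by
  simp only [vavg, integral_mul_const]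

theorem vavg_fst_mul (w : E d → ℝ) (h : E d × E d → ℝ) (x : E d) :
    vavg (fun z => w z.1 * h z) x = w x * vavg h x := by
  simp only [vavg, integral_const_mul]

theorem vavg_fst (w : E d → ℝ) (x : E d) : vavg (fun z => w z.1) x = w x := by
  simp [vavg]

/-- The velocity average as the value at `0` of a convolution with the position as a parameter, so
that the differentiability of convolutions applies to it. -/
theorem vavg_eq_convolution (h : E d × E d → ℝ) (x : E d) :
    vavg h x = convolution muInf (fun v => h (x, -v)) (ContinuousLinearMap.lsmul ℝ ℝ)
      (volume : Measure (E d)) 0 := by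
  simp only [convolution, ContinuousLinearMap.lsmul_apply, zero_sub, neg_neg]
  exact integral_gibbs continuous_muInf muInf_pos _

theorem IsTest.slice {h : E d × E d → ℝ} (hh : IsTest h) (x : E d) : IsTest fun v => h (x, v) := by
  refine ⟨by have := hh.1; fun_prop, ?_⟩
  exact hh.2.comp_isClosedEmbedding (Topology.IsClosedEmbedding.of_continuous_injective_isClosedMap
    (by fun_prop) (fun _ _ hab => (Prod.mk.inj hab).2) (isClosedMap_prodMk_left x))

theorem IsTest.integrable_slice {h : E d × E d → ℝ} (hh : IsTest h) (x : E d) :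
    Integrable (fun v => h (x, v)) (gaussMeas d) := isGibbs_muInf.integrable (hh.slice x)

theorem isTest_vavg_and_pd_vavg {h : E d × E d → ℝ} (hh : IsTest h) :
    IsTest (vavg h) ∧ ∀ e x, pd e (vavg h) x = vavg (pd (e, 0) h) x := by
  have hloc : LocallyIntegrable (muInf : E d → ℝ) volume := integrable_muInf.locallyIntegrable
  set g : E d → E d → ℝ := fun x v => h (x, -v) with hg
  have hgs : ContDiff ℝ ∞ (Function.uncurry g) := by
    have := hh.1
    have h2 : Function.uncurry g = fun p : E d × E d => h (p.1, -p.2) := rfl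
    rw [h2]; fun_prop
  set k : Set (E d) := (fun z : E d × E d => -z.2) '' tsupport h with hk
  have hkc : IsCompact k := hh.2.isCompact.image (by fun_prop)
  have hgk : ∀ p, ∀ x, p ∈ (Set.univ : Set (E d)) → x ∉ k → g p x = 0 := by
    intro p x _ hx
    by_contra h0
    exact hx ⟨(p, -x), subset_tsupport _ h0, by simp⟩
  have hv : vavg h = fun x => (convolution muInf (g x) (ContinuousLinearMap.lsmul ℝ ℝ) volume) 0 :=
    funext fun x => vavg_eq_convolution h x
  refine ⟨⟨?_, ?_⟩, fun e x => ?_⟩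
  · rw [← contDiffOn_univ, hv]
    exact contDiffOn_convolution_right_with_param_comp (n := ⊤) (v := fun _ => (0 : E d)) _
      contDiffOn_const isOpen_univ hkc hgk hloc hgs.contDiffOn
  · refine HasCompactSupport.intro (hh.2.isCompact.image continuous_fst) fun x hx => ?_
    rw [vavg]
    refine integral_eq_zero_of_ae (Eventually.of_forall fun v => ?_)
    by_contra h0
    exact hx ⟨(x, v), subset_tsupport _ h0, rfl⟩
  · have h1 := hasFDerivAt_convolution_right_with_param (ContinuousLinearMap.lsmul ℝ ℝ)
      (μ := (volume : Measure (E d))) isOpen_univ hkc hgk hloc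
      ((hgs.of_le (by simp)).contDiffOn) (x, 0) (Set.mem_univ _)
    have h2 : HasFDerivAt (fun x : E d => (x, (0 : E d))) (ContinuousLinearMap.inl ℝ (E d) (E d)) x :=
      (ContinuousLinearMap.inl ℝ (E d) (E d)).hasFDerivAt
    have h3 := h1.comp x h2
    have hv' : vavg h = (fun q : E d × E d =>
      (convolution muInf (g q.1) (ContinuousLinearMap.lsmul ℝ ℝ) volume) q.2) ∘ fun x => (x, 0) := hv
    have h4 := h3
    rw [← hv'] at h4
    have h8 : ∀ v, fderiv ℝ (Function.uncurry g) (x, v) = (fderiv ℝ h (x, -v)).comp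
        ((ContinuousLinearMap.fst ℝ (E d) (E d)).prod (-ContinuousLinearMap.snd ℝ (E d) (E d))) := by
      intro v
      have h6 : HasFDerivAt (fun p : E d × E d => (p.1, -p.2))
          ((ContinuousLinearMap.fst ℝ (E d) (E d)).prod (-ContinuousLinearMap.snd ℝ (E d) (E d)))
          (x, v) := hasFDerivAt_fst.prodMk hasFDerivAt_snd.neg
      exact ((hh.1.hasFDerivAt' (x, -v)).comp (x, v) h6).fderiv
    have h9 : HasCompactSupport fun v => fderiv ℝ (Function.uncurry g) (x, v) := by
      refine HasCompactSupport.intro hkc fun v hv0 => ?_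
      rw [h8, fderiv_of_notMem_tsupport ℝ fun h9 => hv0 ⟨(x, -v), h9, by simp⟩,
        ContinuousLinearMap.zero_comp]
    have h10 : Continuous fun v => fderiv ℝ (Function.uncurry g) (x, v) :=
      (hgs.continuous_fderiv (by simp)).comp (by fun_prop)
    rw [pd, h4.fderiv, ContinuousLinearMap.comp_apply, ContinuousLinearMap.inl_apply]
    refine (convolution_precompR_apply (ContinuousLinearMap.lsmul ℝ ℝ) hloc h9 h10 0 (e, 0)).trans ?_
    rw [vavg_eq_convolution]
    congr 1
    ext v
    rw [h8]
    simp [pd]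

theorem IsTest.vavg {h : E d × E d → ℝ} (hh : IsTest h) : IsTest (vavg h) :=
  (isTest_vavg_and_pd_vavg hh).1

theorem pd_vavg {h : E d × E d → ℝ} (hh : IsTest h) (e x : E d) :
    pd e (vavg h) x = vavg (pd (e, 0) h) x := (isTest_vavg_and_pd_vavg hh).2 e x

/-- The velocity average intertwines the weighted Laplacians. -/
theorem vavg_gibbsLap (hV : ContDiff ℝ ∞ V) {h : E d × E d → ℝ} (hh : IsTest h) (x : E d) :
    vavg (gibbsLap phaseDir (phasePot V) h) x = gibbsLap ebasis V (vavg h) x := by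
  have hW := contDiff_phasePot hV
  have ht : ∀ i, IsTest fun z => pd (phaseDir i) (phasePot V) z • pd (phaseDir i) h z
      - pd (phaseDir i) (pd (phaseDir i) h) z := fun i =>
    ((hh.pd _).smul_left (contDiff_pd hW _)).sub ((hh.pd _).pd _)
  have h1 : vavg (gibbsLap phaseDir (phasePot V) h) x = ∑ i, vavg (fun z =>
      pd (phaseDir i) (phasePot V) z • pd (phaseDir i) h z
      - pd (phaseDir i) (pd (phaseDir i) h) z) x := by
    simp only [RelaxationBoltzmann.vavg, gibbsLap]
    exact integral_finsetSum _ fun i _ => (ht i).integrable_slice x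
  rw [h1, Fintype.sum_sum_type, gibbsLap]
  have h2 : ∀ j : Fin d, vavg (fun z => pd (phaseDir (Sum.inr j)) (phasePot V) z •
      pd (phaseDir (Sum.inr j)) h z - pd (phaseDir (Sum.inr j)) (pd (phaseDir (Sum.inr j)) h) z) x
      = 0 := by
    intro j
    have h4 := (hh.pd (phaseDir (Sum.inr j))).slice x
    have h3 := isGibbs_muInf.integral_pd (h4.1.of_le (by simp)) h4.2 (ebasis j)
    have h5 : ∀ v, pd (ebasis j) (fun v => pd (phaseDir (Sum.inr j)) h (x, v)) v
        = pd (phaseDir (Sum.inr j)) (pd (phaseDir (Sum.inr j)) h) (x, v) := by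
      intro v
      have h6 : HasFDerivAt (fun v : E d => (x, v)) (ContinuousLinearMap.inr ℝ (E d) (E d)) v :=
        hasFDerivAt_prodMk_right x v
      have h7 := ((hh.pd (phaseDir (Sum.inr j))).1.hasFDerivAt' (x, v)).comp v h6
      rw [pd, show (fun v => pd (phaseDir (Sum.inr j)) h (x, v)) =
        pd (phaseDir (Sum.inr j)) h ∘ fun v => (x, v) from rfl, h7.fderiv]
      simp [pd, phaseDir]
    simp only [h5, pd_half_norm_sq] at h3
    have i1 := (((hh.pd (phaseDir (Sum.inr j))).smul_left
      (contDiff_pd hW (phaseDir (Sum.inr j)))).integrable_slice x)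
    have i2 := ((hh.pd (phaseDir (Sum.inr j))).pd (phaseDir (Sum.inr j))).integrable_slice x
    simp only [pd_inr_phasePot hV] at i1 ⊢
    rw [RelaxationBoltzmann.vavg, integral_sub i1 i2, h3, sub_self]
  rw [Finset.sum_congr rfl fun j _ => h2 j, Finset.sum_const_zero, add_zero]
  refine Finset.sum_congr rfl fun j _ => ?_
  have hj := hh.pd (phaseDir (Sum.inl j))
  have i1 := (hj.smul_left (contDiff_pd hW (phaseDir (Sum.inl j)))).integrable_slice x
  have i2 := (hj.pd (phaseDir (Sum.inl j))).integrable_slice x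
  have h3 : pd (ebasis j) (vavg h) = vavg (pd (phaseDir (Sum.inl j)) h) :=
    funext fun x => pd_vavg hh _ _
  have h4 : pd (ebasis j) (vavg (pd (phaseDir (Sum.inl j)) h)) x =
    vavg (pd (phaseDir (Sum.inl j)) (pd (phaseDir (Sum.inl j)) h)) x := pd_vavg hj _ _
  rw [h3, h4]
  simp only [pd_inl_phasePot hV, gradV_eq] at i1 ⊢
  simp only [RelaxationBoltzmann.vavg]
  rw [integral_sub i1 i2]
  simp only [smul_eq_mul, integral_const_mul]

end Average

section Transport

variable {d : ℕ} {V : E d → ℝ}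

/-- The transport operator `X = -v · ∂_x + ∂_x V · ∂_v`. It has the same form on `f` and on
`h = f / M`, because the Maxwellian is stationary. -/
def transport (V : E d → ℝ) (h : E d × E d → ℝ) (z : E d × E d) : ℝ :=
  -(∑ j, z.2 j * pd (phaseDir (Sum.inl j)) h z)
    + ∑ j, gradV V j z.1 * pd (phaseDir (Sum.inr j)) h z

@[fun_prop]
theorem contDiff_transport (hV : ContDiff ℝ ∞ V) {h : E d × E d → ℝ} (hh : ContDiff ℝ ∞ h) :
    ContDiff ℝ ∞ (transport V h) := by
  have h1 := contDiff_phase_gradV hV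
  have h2 := contDiff_phase_coord (d := d)
  unfold transport
  fun_prop

theorem IsTest.transport (hV : ContDiff ℝ ∞ V) {h : E d × E d → ℝ} (hh : IsTest h) :
    IsTest (transport V h) := by
  have h1 := contDiff_phase_gradV hV
  have h2 := contDiff_phase_coord (d := d)
  exact (IsTest.sum _ fun j => (hh.pd _).mul_left (h2 j)).neg.add
    (IsTest.sum _ fun j => (hh.pd _).mul_left (h1 j))

theorem transport_mul {φ ψ : E d × E d → ℝ} (hφ : ContDiff ℝ ∞ φ) (hψ : ContDiff ℝ ∞ ψ)
    (z : E d × E d) :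
    transport V (fun z => φ z * ψ z) z = transport V φ z * ψ z + φ z * transport V ψ z := by
  simp only [transport, pd_mul hφ hψ, neg_mul, add_mul, mul_neg, mul_add, Finset.sum_mul,
    Finset.mul_sum, Finset.sum_add_distrib]
  have h1 : ∀ a b : Fin d → ℝ, ∑ j, a j * (φ z * b j) = ∑ j, φ z * (a j * b j) := fun a b =>
    Finset.sum_congr rfl fun j _ => by ring
  have h2 : ∀ a b : Fin d → ℝ, ∑ j, a j * (b j * ψ z) = ∑ j, a j * b j * ψ z := fun a b =>
    Finset.sum_congr rfl fun j _ => by ring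
  rw [h1, h1, h2, h2]
  ring

/-- The measure `M dx dv` is invariant under the transport. -/
theorem integral_transport (hV : IsConfining V) {χ : E d × E d → ℝ} (hχ : ContDiff ℝ 1 χ)
    (hc : HasCompactSupport χ) : ∫ z, transport V χ z ∂(phaseMeas V) = 0 := by
  have hG := isGibbs_maxwellian hV
  have := hG.isLocallyFiniteMeasure
  have h1 : ∀ j, ContDiff ℝ 1 fun z : E d × E d => gradV V j z.1 := fun j =>
    (contDiff_phase_gradV hV.smooth j).of_le (by simp)
  have h2 : ∀ j, ContDiff ℝ 1 fun z : E d × E d => z.2 j := fun j =>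
    (contDiff_phase_coord j).of_le (by simp)
  have hd : ∀ e, Continuous (pd e χ) := fun e =>
    (hχ.continuous_fderiv one_ne_zero).clm_apply continuous_const
  have i1 : ∀ j, Integrable (fun z : E d × E d => z.2 j * pd (phaseDir (Sum.inl j)) χ z)
      (phaseMeas V) := fun j => ((h2 j).continuous.mul (hd _)).integrable_of_hasCompactSupport
    (hc.pd _).mul_left
  have i2 : ∀ j, Integrable (fun z : E d × E d => gradV V j z.1 * pd (phaseDir (Sum.inr j)) χ z)
      (phaseMeas V) := fun j => ((h1 j).continuous.mul (hd _)).integrable_of_hasCompactSupport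
    (hc.pd _).mul_left
  have hpd : ∀ (e : E d × E d) (g : E d × E d → ℝ), ContDiff ℝ 1 g → (∀ z, pd e g z = 0) →
      ∫ z, g z * pd e χ z ∂(phaseMeas V) = ∫ z, pd e (phasePot V) z * (g z * χ z) ∂(phaseMeas V) := by
    intro e g hg h0
    have := hG.integral_pd (𝕜 := ℝ) (χ := fun z => g z * χ z) (hg.mul hχ) hc.mul_left e
    simp only [smul_eq_mul] at this
    rw [← this]
    congr 1
    ext z
    have h3 := ((hg.differentiable one_ne_zero z).hasFDerivAt.fun_mul
      (hχ.differentiable one_ne_zero z).hasFDerivAt).fderiv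
    rw [pd, pd, h3]
    have := h0 z
    rw [pd] at this
    simp [this]
  simp only [transport]
  have i3 : Integrable (fun z : E d × E d => -∑ j, z.2 j * pd (phaseDir (Sum.inl j)) χ z)
      (phaseMeas V) := (integrable_finsetSum _ fun j _ => i1 j).neg
  rw [integral_add i3 (integrable_finsetSum _ fun j _ => i2 j), integral_neg,
    integral_finsetSum _ fun j _ => i1 j, integral_finsetSum _ fun j _ => i2 j, neg_add_eq_zero]
  refine Finset.sum_congr rfl fun j _ => ?_
  rw [hpd _ _ (h2 j) fun z => ?_, hpd _ _ (h1 j) fun z => ?_]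
  · simp only [pd_inl_phasePot hV.smooth, pd_inr_phasePot hV.smooth]
    congr 1; ext z; ring
  · rw [pd_comp_fst (contDiff_gradV hV.smooth j)]; simp [phaseDir, pd_zero]
  · rw [pd_comp_snd (contDiff_coord j)]; simp [phaseDir, pd_zero]

/-- The transport operator is antisymmetric. -/
theorem integral_transport_mul (hV : IsConfining V) {φ ψ : E d × E d → ℝ} (hφ : IsTest φ)
    (hψ : ContDiff ℝ ∞ ψ) :
    ∫ z, transport V φ z * ψ z ∂(phaseMeas V) = -∫ z, φ z * transport V ψ z ∂(phaseMeas V) := by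
  have hG := isGibbs_maxwellian hV
  have h1 := hφ.mul_right hψ
  have h2 := integral_transport hV (h1.1.of_le (by simp)) h1.2
  simp only [transport_mul hφ.1 hψ] at h2
  rw [integral_add (hG.integrable ((hφ.transport hV.smooth).mul_right hψ))
    (hG.integrable (hφ.mul_right (contDiff_transport hV.smooth hψ)))] at h2
  linarith

/-- The kinetic operator in terms of `h = f / M`. -/
theorem kinetic_maxwellian_smul (hV : IsConfining V) (γ : ℝ) {φ : E d × E d → ℝ} (hφ : IsTest φ) :
    kinetic V γ (fun z => maxwellian V z • φ z) = fun z =>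
      maxwellian V z • (transport V φ z + γ • (vavg φ z.1 - φ z)) := by
  have hG := isGibbs_maxwellian hV
  ext z
  have h1 : ∀ e, pd e (fun z => maxwellian V z * φ z) z =
      maxwellian V z * (pd e φ z - pd e (phasePot V) z * φ z) := fun e => by
    rw [pd_mul hG.smooth hφ.1, hG.pd_eq]; ring
  have h2 : ∫ w, maxwellian V (z.1, w) * φ (z.1, w) = rhoInf V z.1 * vavg φ z.1 := by
    rw [vavg, integral_gibbs continuous_muInf muInf_pos, ← integral_const_mul]
    congr 1; ext w; simp only [maxwellian, smul_eq_mul]; ring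
  simp only [smul_eq_mul]
  rw [kinetic, collision, h2]
  simp only [dX_eq, dV_eq, h1, pd_inl_phasePot hV.smooth, pd_inr_phasePot hV.smooth, transport,
    smul_eq_mul]
  have h3 : ∀ j, gradV V j z.1 * (maxwellian V z * (pd (phaseDir (Sum.inr j)) φ z - z.2 j * φ z))
      = maxwellian V z * (gradV V j z.1 * pd (phaseDir (Sum.inr j)) φ z)
        - maxwellian V z * φ z * (gradV V j z.1 * z.2 j) := fun j => by ring
  have h4 : ∀ j, z.2 j * (maxwellian V z * (pd (phaseDir (Sum.inl j)) φ z - gradV V j z.1 * φ z))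
      = maxwellian V z * (z.2 j * pd (phaseDir (Sum.inl j)) φ z)
        - maxwellian V z * φ z * (gradV V j z.1 * z.2 j) := fun j => by ring
  simp only [h3, h4, Finset.sum_sub_distrib, ← Finset.mul_sum]
  have h5 : maxwellian V z = rhoInf V z.1 * muInf z.2 := rfl
  rw [h5]; ring

/-- The operator `Λ² - 1` in terms of `h = f / M`. -/
theorem lambdaSqSubOne_maxwellian_smul {𝕜 : Type} [RCLike 𝕜] (hV : IsConfining V) (γ : ℝ)
    {φ : E d × E d → 𝕜} (hφ : IsTest φ) :
    lambdaSqSubOne V γ (fun z => maxwellian V z • φ z) = fun z =>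
      maxwellian V z • (γ • gibbsLap phaseDir (phasePot V) φ z) := by
  have hG := isGibbs_maxwellian hV
  ext z
  have h1 : ∀ e, (fun y => pd e (fun z => maxwellian V z • φ z) y
      + pd e (phasePot V) y • (maxwellian V y • φ y)) = fun y => maxwellian V y • pd e φ y := by
    intro e; ext y
    rw [pd_smul hG.smooth hφ.1, hG.pd_eq, neg_smul, mul_comm, mul_smul]; abel
  have h2 : ∀ e, pd e (fun y => maxwellian V y • pd e φ y) z =
      -(maxwellian V z • (pd e (phasePot V) z • pd e φ z - pd e (pd e φ) z)) := by
    intro e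
    rw [pd_smul hG.smooth (hφ.pd e).1, hG.pd_eq, smul_sub, neg_smul, mul_smul]; abel
  have h3 : ∀ i, pd (phaseDir i) (fun y => pd (phaseDir i) (fun z => maxwellian V z • φ z) y
      + pd (phaseDir i) (phasePot V) y • (maxwellian V y • φ y)) z =
      -(maxwellian V z • (pd (phaseDir i) (phasePot V) z • pd (phaseDir i) φ z
        - pd (phaseDir i) (pd (phaseDir i) φ) z)) := fun i => by rw [h1, h2]
  have h4 := fun j : Fin d => h3 (Sum.inl j)
  have h5 := fun j : Fin d => h3 (Sum.inr j)
  simp only [pd_inl_phasePot hV.smooth, pd_inr_phasePot hV.smooth] at h4 h5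
  rw [lambdaSqSubOne, gibbsLap, Fintype.sum_sum_type]
  simp only [dX_eq, dV_eq, h4, h5, pd_inl_phasePot hV.smooth, pd_inr_phasePot hV.smooth]
  simp only [Finset.sum_neg_distrib, smul_neg, neg_neg, smul_add, ← Finset.smul_sum]
  rw [smul_comm γ, smul_comm γ, sub_neg_eq_add, add_comm]

end Transport

/-! ### The projection onto local equilibria and the weighted Laplacian -/

section Projection

variable {d : ℕ} {V : E d → ℝ}

theorem inner_emb_real (hV : IsConfining V) {h k : E d × E d → ℝ} (hh : SqInt V h)
    (hk : SqInt V k) : ⟪emb V h, emb V k⟫ = ∫ z, h z * k z ∂(phaseMeas V) := by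
  rw [inner_emb hV hh hk]
  congr 1; ext z; simp [mul_comm]

theorem SqInt.integrable_mul {h k : E d × E d → ℝ} (hh : SqInt V h) (hk : SqInt V k) :
    Integrable (fun z => h z * k z) (phaseMeas V) := by
  refine (hh.integrable_inner hk).congr (Eventually.of_forall fun z => ?_)
  simp [mul_comm]

theorem norm_emb_sq (hV : IsConfining V) {h : E d × E d → ℝ} (hh : SqInt V h) :
    ‖emb V h‖ ^ 2 = ∫ z, h z ^ 2 ∂(phaseMeas V) := by
  rw [← real_inner_self_eq_norm_sq, inner_emb_real hV hh hh]
  simp_rw [sq]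

theorem IsTest.exists_bound {F : Type*} [NormedAddCommGroup F] [NormedSpace ℝ F] {w : F → ℝ}
    (hw : IsTest w) : ∃ C, 0 ≤ C ∧ ∀ x, |w x| ≤ C := by
  obtain ⟨C, hC⟩ := hw.2.exists_bound_of_continuous hw.1.continuous
  exact ⟨C, (norm_nonneg _).trans (hC 0), hC⟩

theorem IsTest.sqInt_fst (hV : IsConfining V) {w : E d → ℝ} (hw : IsTest w) :
    SqInt V fun z => w z.1 := by
  obtain ⟨C, hC0, hC⟩ := hw.exists_bound
  refine SqInt.of_le hV (hw.1.continuous.comp continuous_fst) (C := C) fun z => ?_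
  nlinarith [hC z.1, mul_nonneg hC0 (sq_nonneg ‖z.2‖)]

/-- The embedding of the test functions into `B²`. -/
def coreEmb (hV : IsConfining V) : testSpace ℝ d →ₗ[ℝ] B2 ℝ V :=
  opLin hV (fun φ => φ) (fun _ h => h.sqInt hV) (fun _ _ _ _ => rfl) (fun _ _ _ => rfl)

theorem coreEmb_apply (hV : IsConfining V) (φ : testSpace ℝ d) :
    coreEmb hV φ = emb V (φ : E d × E d → ℝ) := rfl

theorem coreEmb_denseRange (hV : IsConfining V) : DenseRange (coreEmb hV) := dense_test hV

theorem vavg_add {φ ψ : E d × E d → ℝ} (hφ : IsTest φ) (hψ : IsTest ψ) (x : E d) :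
    vavg (φ + ψ) x = vavg φ x + vavg ψ x :=
  integral_add (hφ.integrable_slice x) (hψ.integrable_slice x)

theorem vavg_smul (c : ℝ) (φ : E d × E d → ℝ) (x : E d) : vavg (c • φ) x = c * vavg φ x :=
  integral_const_mul _ _

/-- The velocity average of test functions, as a map into `B²`. -/
def averageLin (hV : IsConfining V) : testSpace ℝ d →ₗ[ℝ] B2 ℝ V :=
  opLin hV (fun φ z => vavg φ z.1) (fun _ h => h.vavg.sqInt_fst hV)
    (fun _ _ hφ hψ => funext fun z => vavg_add hφ hψ z.1)
    (fun c φ _ => funext fun z => vavg_smul c φ z.1)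

theorem inner_averageLin (hV : IsConfining V) (φ : testSpace ℝ d) {k : E d × E d → ℝ}
    (hk : SqInt V k) : ⟪averageLin hV φ, emb V k⟫ =
      ∫ x, vavg φ x * vavg k x ∂(rhoMeas V) := by
  have h1 := φ.2.vavg.sqInt_fst hV
  rw [show averageLin hV φ = emb V (fun z => vavg φ z.1) from rfl, inner_emb_real hV h1 hk,
    ← integral_vavg hV (h1.integrable_mul hk)]
  simp_rw [vavg_fst_mul]

theorem norm_averageLin_le (hV : IsConfining V) (φ : testSpace ℝ d) :
    ‖averageLin hV φ‖ ≤ 1 * ‖coreEmb hV φ‖ := by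
  have h1 := φ.2.vavg.sqInt_fst hV
  have h2 : ‖averageLin hV φ‖ ^ 2 = ⟪averageLin hV φ, coreEmb hV φ⟫ := by
    rw [← real_inner_self_eq_norm_sq, coreEmb_apply, inner_averageLin hV φ (φ.2.sqInt hV),
      show ⟪averageLin hV φ, averageLin hV φ⟫ = ⟪averageLin hV φ, emb V (fun z => vavg φ z.1)⟫
        from rfl, inner_averageLin hV φ h1]
    simp_rw [vavg_fst]
  have h3 := real_inner_le_norm (averageLin hV φ) (coreEmb hV φ)
  rw [one_mul]
  rcases (norm_nonneg (averageLin hV φ)).eq_or_lt with h | h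
  · rw [← h]; exact norm_nonneg _
  · refine le_of_mul_le_mul_left ?_ h
    linarith [sq (‖averageLin hV φ‖)]

/-- The projection `f ↦ μ_∞ ∫ f dv` of `B²` onto the local equilibria. -/
def proj (hV : IsConfining V) : B2 ℝ V →L[ℝ] B2 ℝ V :=
  (averageLin hV).extendOfNorm (coreEmb hV)

theorem proj_coreEmb (hV : IsConfining V) (φ : testSpace ℝ d) :
    proj hV (coreEmb hV φ) = emb V (fun z => vavg φ z.1) :=
  (averageLin hV).extendOfNorm_eq (coreEmb_denseRange hV) ⟨1, norm_averageLin_le hV⟩ φ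

theorem inner_proj_coreEmb (hV : IsConfining V) (φ : testSpace ℝ d) {k : E d × E d → ℝ}
    (hk : SqInt V k) : ⟪proj hV (coreEmb hV φ), emb V k⟫ =
      ∫ x, vavg φ x * vavg k x ∂(rhoMeas V) := by
  rw [proj_coreEmb]; exact inner_averageLin hV φ hk

theorem proj_symm (hV : IsConfining V) (g h : B2 ℝ V) : ⟪proj hV g, h⟫ = ⟪g, proj hV h⟫ := by
  have hd := coreEmb_denseRange hV
  refine hd.induction_on₂ (p := fun g h => ⟪proj hV g, h⟫ = ⟪g, proj hV h⟫)
    (isClosed_eq (by fun_prop) (by fun_prop)) (fun φ ψ => ?_) g h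
  rw [real_inner_comm (proj hV (coreEmb hV ψ)), coreEmb_apply, coreEmb_apply, ← coreEmb_apply hV φ,
    inner_proj_coreEmb hV _ (ψ.2.sqInt hV), coreEmb_apply, ← coreEmb_apply hV ψ,
    inner_proj_coreEmb hV _ (φ.2.sqInt hV)]
  simp_rw [mul_comm]

/-- The projection of a function that is not compactly supported, from its velocity average. -/
theorem proj_emb (hV : IsConfining V) {h : E d × E d → ℝ} {w : E d → ℝ} (hh : SqInt V h)
    (hw : SqInt V fun z => w z.1) (hhw : ∀ x, vavg h x = w x) :
    proj hV (emb V h) = emb V fun z => w z.1 := by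
  refine (coreEmb_denseRange hV).eq_of_inner_left (𝕜 := ℝ) fun φ => ?_
  rw [proj_symm, real_inner_comm, inner_proj_coreEmb hV _ hh, real_inner_comm, coreEmb_apply,
    inner_emb_real hV (φ.2.sqInt hV) hw,
    ← integral_vavg hV ((φ.2.sqInt hV).integrable_mul hw)]
  simp_rw [vavg_mul_fst, hhw]

theorem proj_idem (hV : IsConfining V) (g : B2 ℝ V) : proj hV (proj hV g) = proj hV g := by
  refine (coreEmb_denseRange hV).induction_on (p := fun g => proj hV (proj hV g) = proj hV g) g
    (isClosed_eq (by fun_prop) (by fun_prop)) fun φ => ?_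
  have h1 := φ.2.vavg.sqInt_fst hV
  rw [proj_coreEmb, proj_emb hV h1 h1 fun x => vavg_fst _ x]

theorem sqInt_one (hV : IsConfining V) : SqInt V fun _ : E d × E d => (1 : ℝ) :=
  SqInt.of_le hV continuous_const (C := 1) fun z => by
    rw [abs_one]; nlinarith [sq_nonneg ‖z.2‖]

/-- The Maxwellian, as an element of `B²`. -/
def equil (V : E d → ℝ) : B2 ℝ V := emb V fun _ => 1

theorem norm_equil (hV : IsConfining V) : ‖equil V‖ = 1 := by
  have := isProbabilityMeasure_phaseMeas hV
  have h1 := norm_emb_sq hV (sqInt_one hV)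
  have h2 : ‖equil V‖ ^ 2 = 1 := by rw [equil, h1]; simp
  exact (pow_eq_one_iff_of_nonneg (norm_nonneg _) two_ne_zero).1 h2

theorem proj_equil (hV : IsConfining V) : proj hV (equil V) = equil V :=
  proj_emb hV (sqInt_one hV) (w := fun _ => 1) (sqInt_one hV) fun x => by simp [vavg]

end Projection

section Operators

variable {d : ℕ} {V : E d → ℝ}

/-- The transport operator on test functions. -/
def transportLin (hV : IsConfining V) : testSpace ℝ d →ₗ[ℝ] B2 ℝ V :=
  opLin hV (transport V) (fun _ h => (h.transport hV.smooth).sqInt hV)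
    (fun φ ψ hφ hψ => funext fun z => by
      have : ∀ e, pd e (φ + ψ) z = pd e φ z + pd e ψ z := fun e => pd_add hφ.1 hψ.1 e z
      simp only [transport, this, mul_add, Finset.sum_add_distrib]; ring)
    (fun c φ hφ => funext fun z => by
      have : ∀ e, pd e (c • φ) z = c * pd e φ z := fun e => pd_const_smul hφ.1 c e z
      simp only [transport, this, mul_left_comm _ c, ← Finset.mul_sum, smul_eq_mul]; ring)

theorem transportLin_apply (hV : IsConfining V) (φ : testSpace ℝ d) :
    transportLin hV φ = emb V (transport V φ) := rfl

theorem gibbsLap_add {F 𝕜 : Type*} [NormedAddCommGroup F] [NormedSpace ℝ F] [RCLike 𝕜]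
    {ι : Type*} [Fintype ι] (b : ι → F) {W : F → ℝ} {φ ψ : F → 𝕜}
    (hφ : ContDiff ℝ ∞ φ) (hψ : ContDiff ℝ ∞ ψ) (z : F) :
    gibbsLap b W (φ + ψ) z = gibbsLap b W φ z + gibbsLap b W ψ z := by
  have h1 : ∀ e, pd e (φ + ψ) = fun z => pd e φ z + pd e ψ z := fun e => funext fun z =>
    pd_add hφ hψ e z
  simp only [gibbsLap, h1, pd_add (contDiff_pd hφ _) (contDiff_pd hψ _), smul_add,
    ← Finset.sum_add_distrib]
  exact Finset.sum_congr rfl fun i _ => by abel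

theorem gibbsLap_smul {F 𝕜 : Type*} [NormedAddCommGroup F] [NormedSpace ℝ F] [RCLike 𝕜]
    {ι : Type*} [Fintype ι] (b : ι → F) {W : F → ℝ} (c : 𝕜) {φ : F → 𝕜}
    (hφ : ContDiff ℝ ∞ φ) (z : F) : gibbsLap b W (c • φ) z = c • gibbsLap b W φ z := by
  have h1 : ∀ (e : F) {φ : F → 𝕜}, ContDiff ℝ ∞ φ → pd e (c • φ) = c • pd e φ := fun e φ hφ =>
    funext fun z => by rw [pd, ((hφ.hasFDerivAt' z).const_smul c).fderiv]; rfl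
  simp only [gibbsLap, h1 _ hφ, h1 _ (contDiff_pd hφ _), Finset.smul_sum, smul_sub, Pi.smul_apply]
  exact Finset.sum_congr rfl fun i _ => by rw [smul_comm]

/-- The weighted Laplacian of phase space on test functions, in terms of `h = f / M`. -/
def laplaceLin (𝕜 : Type) [RCLike 𝕜] (hV : IsConfining V) : testSpace 𝕜 d →ₗ[𝕜] B2 𝕜 V :=
  opLin hV (gibbsLap phaseDir (phasePot V))
    (fun _ h => ((isGibbs_maxwellian hV).isTest_gibbsLap phaseDir h).sqInt hV)
    (fun _ _ hφ hψ => funext fun z => gibbsLap_add _ hφ.1 hψ.1 z)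
    (fun c _ hφ => funext fun z => gibbsLap_smul _ c hφ.1 z)

theorem laplaceLin_apply (hV : IsConfining V) (φ : testSpace ℝ d) :
    laplaceLin ℝ hV φ = emb V (gibbsLap phaseDir (phasePot V) φ) := rfl

theorem inner_laplaceLin (hV : IsConfining V) (φ : testSpace ℝ d) {ψ : E d × E d → ℝ}
    (hψ : ContDiff ℝ ∞ ψ) (hψ' : SqInt V ψ) : ⟪laplaceLin ℝ hV φ, emb V ψ⟫ =
      ∑ i, ∫ z, pd (phaseDir i) φ z * pd (phaseDir i) ψ z ∂(phaseMeas V) := by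
  have hG := isGibbs_maxwellian hV
  rw [laplaceLin_apply, inner_emb_real hV ((hG.isTest_gibbsLap phaseDir φ.2).sqInt hV) hψ',
    hG.integral_gibbsLap_mul phaseDir φ.2.1 hψ (Or.inl φ.2.2)]

theorem inner_laplaceLin_equil (hV : IsConfining V) (φ : testSpace ℝ d) :
    ⟪laplaceLin ℝ hV φ, equil V⟫ = 0 := by
  rw [equil, inner_laplaceLin hV φ contDiff_const (sqInt_one hV)]
  simp [pd]

/-- The Dirichlet form of the densities. -/
theorem inner_laplaceLin_proj (hV : IsConfining V) (φ ψ : testSpace ℝ d) :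
    ⟪laplaceLin ℝ hV φ, proj hV (coreEmb hV ψ)⟫ =
      ∑ j, ∫ x, pd (ebasis j) (vavg φ) x * pd (ebasis j) (vavg ψ) x ∂(rhoMeas V) := by
  have hψ := ψ.2.vavg
  have hψ1 : ContDiff ℝ ∞ fun z : E d × E d => vavg ψ z.1 := hψ.1.comp contDiff_fst
  rw [proj_coreEmb, inner_laplaceLin hV φ hψ1 (hψ.sqInt_fst hV),
    Fintype.sum_sum_type]
  simp only [pd_comp_fst hψ.1]
  have h1 : ∀ j : Fin d, ∫ z, pd (phaseDir (Sum.inr j)) φ z *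
      pd (phaseDir (Sum.inr j) : E d × E d).1 (vavg ψ) z.1 ∂(phaseMeas V) = 0 := fun j => by
    simp [phaseDir, pd_zero]
  rw [Finset.sum_congr rfl fun j _ => h1 j, Finset.sum_const_zero, add_zero]
  refine Finset.sum_congr rfl fun j _ => ?_
  have hj := φ.2.pd (phaseDir (Sum.inl j))
  have h2 : SqInt V fun z : E d × E d => pd (ebasis j) (vavg ψ) z.1 := (hψ.pd _).sqInt_fst hV
  change ∫ z, pd (phaseDir (Sum.inl j)) φ z * pd (ebasis j) (vavg ψ) z.1 ∂(phaseMeas V) = _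
  rw [← integral_vavg hV ((hj.sqInt hV).integrable_mul h2)]
  simp_rw [vavg_mul_fst, pd_vavg φ.2]
  rfl

theorem proj_laplaceLin (hV : IsConfining V) (φ : testSpace ℝ d) :
    proj hV (laplaceLin ℝ hV φ) = emb V fun z => gibbsLap ebasis V (vavg φ) z.1 := by
  have h1 := (isGibbs_maxwellian hV).isTest_gibbsLap phaseDir φ.2
  have h2 := (isGibbs_rhoInf hV).isTest_gibbsLap ebasis φ.2.vavg
  exact proj_emb hV (h1.sqInt hV) (h2.sqInt_fst hV) fun x => vavg_gibbsLap hV.smooth φ.2 x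

end Operators

/-! ### The corrector -/

section Corrector

variable {d : ℕ} {V : E d → ℝ}

theorem integral_gauss_linear (a : Fin d → ℝ) :
    ∫ v, (∑ j, v j * a j) ∂(gaussMeas d) = 0 := by
  rw [integral_finsetSum _ fun j _ => (integrable_coord j).mul_const _]
  simp [integral_mul_const, integral_coord]

theorem integral_gauss_quadratic (A : Fin d → Fin d → ℝ) :
    ∫ v, (∑ i, ∑ j, v i * v j * A i j) ∂(gaussMeas d) = ∑ i, A i i := by
  have h1 : ∀ i j, Integrable (fun v : E d => v i * v j * A i j) (gaussMeas d) := fun i j =>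
    (integrable_coord_mul_coord i j).mul_const _
  rw [integral_finsetSum _ fun i _ => integrable_finsetSum _ fun j _ => h1 i j]
  refine Finset.sum_congr rfl fun i _ => ?_
  rw [integral_finsetSum _ fun j _ => h1 i j]
  simp [integral_mul_const, integral_coord_mul_coord]

theorem transport_fst {w : E d → ℝ} (hw : ContDiff ℝ ∞ w) :
    transport V (fun z => w z.1) = fun z => -∑ j, z.2 j * pd (ebasis j) w z.1 := by
  ext z
  simp only [transport, pd_comp_fst hw]
  simp [phaseDir, pd_zero]

theorem transport_transport_fst {w : E d → ℝ} (hw : ContDiff ℝ ∞ w)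
    (z : E d × E d) :
    transport V (transport V fun z => w z.1) z =
      (∑ i, ∑ j, z.2 i * z.2 j * pd (ebasis i) (pd (ebasis j) w) z.1)
        - ∑ j, gradV V j z.1 * pd (ebasis j) w z.1 := by
  have hc := contDiff_phase_coord (d := d)
  have hp : ∀ j, ContDiff ℝ ∞ fun z : E d × E d => pd (ebasis j) w z.1 := fun j =>
    (contDiff_pd hw _).comp contDiff_fst
  have h1 : ∀ e : E d × E d, pd e (fun z : E d × E d => -∑ j, z.2 j * pd (ebasis j) w z.1) z =
      -∑ j, (e.2 j * pd (ebasis j) w z.1 + z.2 j * pd e.1 (pd (ebasis j) w) z.1) := fun e => by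
    rw [pd_neg, pd_sum _ fun j => (hc j).mul (hp j)]
    congr 1
    refine Finset.sum_congr rfl fun j _ => ?_
    rw [pd_mul (hc j) (hp j), pd_comp_snd (contDiff_coord j), pd_comp_fst (contDiff_pd hw _),
      pd_coord]
  rw [transport_fst hw]
  simp only [transport, h1]
  have h2 : ∀ i : Fin d, gradV V i z.1 * -∑ j, ((phaseDir (Sum.inr i) : E d × E d).2 j *
      pd (ebasis j) w z.1 + z.2 j * pd (phaseDir (Sum.inr i) : E d × E d).1 (pd (ebasis j) w) z.1)
      = -(gradV V i z.1 * pd (ebasis i) w z.1) := fun i => by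
    simp [phaseDir, pd_zero, ebasis]
  have h3 : ∀ i : Fin d, z.2 i * -∑ j, ((phaseDir (Sum.inl i) : E d × E d).2 j *
      pd (ebasis j) w z.1 + z.2 j * pd (phaseDir (Sum.inl i) : E d × E d).1 (pd (ebasis j) w) z.1)
      = -∑ j, z.2 i * z.2 j * pd (ebasis i) (pd (ebasis j) w) z.1 := fun i => by
    simp [phaseDir, Finset.mul_sum, mul_assoc]
  rw [Finset.sum_congr rfl fun i _ => h2 i, Finset.sum_congr rfl fun i _ => h3 i,
    Finset.sum_neg_distrib, Finset.sum_neg_distrib]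
  ring

theorem sqInt_transport_fst (hV : IsConfining V) {w : E d → ℝ} (hw : IsTest w) :
    SqInt V (transport V fun z => w z.1) := by
  choose C hC0 hC using fun j => (hw.pd (ebasis j)).exists_bound
  have hc := contDiff_transport hV.smooth (hw.1.comp (contDiff_fst (E := E d) (F := E d)))
  refine SqInt.of_le hV hc.continuous (C := ∑ j, C j) fun z => ?_
  rw [transport_fst hw.1, abs_neg, Finset.sum_mul]
  refine (Finset.abs_sum_le_sum_abs _ _).trans (Finset.sum_le_sum fun j _ => ?_)
  rw [abs_mul, mul_comm]
  refine mul_le_mul (hC j _) ((abs_coord_le _ _).trans ?_) (abs_nonneg _) (hC0 j)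
  nlinarith [sq_nonneg (‖z.2‖ - 1)]

/-- The operator `X Π` on test functions, where `Π` is the projection onto the local equilibria. -/
def correctorLin (hV : IsConfining V) : testSpace ℝ d →ₗ[ℝ] B2 ℝ V :=
  opLin hV (fun φ => transport V fun z => vavg φ z.1)
    (fun _ h => sqInt_transport_fst hV h.vavg)
    (fun φ ψ hφ hψ => by
      have h1 : (vavg (φ + ψ)) = fun x => vavg φ x + vavg ψ x := funext (vavg_add hφ hψ)
      simp only [h1, transport_fst hφ.vavg.1, transport_fst hψ.vavg.1,
        transport_fst (hφ.vavg.add hψ.vavg).1]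
      ext z
      simp only [pd_add hφ.vavg.1 hψ.vavg.1, mul_add, Finset.sum_add_distrib]; ring)
    (fun c φ hφ => by
      have h1 : vavg (c • φ) = fun x => c • vavg φ x := funext (vavg_smul c φ)
      have h2 : ∀ e x, pd e (fun x => c • vavg φ x) x = c • pd e (vavg φ) x :=
        pd_const_smul hφ.vavg.1 c
      simp only [h1, transport_fst hφ.vavg.1, transport_fst (hφ.vavg.const_smul c).1]
      ext z
      simp only [h2]
      simp only [smul_eq_mul, mul_left_comm _ c, ← Finset.mul_sum, mul_neg])

theorem correctorLin_apply (hV : IsConfining V) (φ : testSpace ℝ d) :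
    correctorLin hV φ = emb V (transport V fun z => vavg φ z.1) := rfl

theorem proj_correctorLin (hV : IsConfining V) (φ : testSpace ℝ d) :
    proj hV (correctorLin hV φ) = 0 := by
  have h0 : SqInt V fun _ : E d × E d => (0 : ℝ) := by
    simpa using (sqInt_one hV).const_smul (0 : ℝ)
  rw [correctorLin_apply, proj_emb hV (sqInt_transport_fst hV φ.2.vavg) (w := fun _ => 0) h0]
  · have := emb_smul hV (sqInt_one hV) (0 : ℝ)
    simpa using this
  · intro x
    rw [transport_fst φ.2.vavg.1]
    simp only [vavg]
    rw [integral_neg, integral_gauss_linear, neg_zero]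

theorem correctorLin_inner (hV : IsConfining V) (ψ φ : testSpace ℝ d) :
    ⟪correctorLin hV ψ, coreEmb hV φ⟫ = -⟪proj hV (coreEmb hV ψ), transportLin hV φ⟫ := by
  have h1 := ψ.2.vavg.1.comp (contDiff_fst (E := E d) (F := E d))
  rw [correctorLin_apply, coreEmb_apply, proj_coreEmb, transportLin_apply, real_inner_comm,
    inner_emb_real hV (φ.2.sqInt hV) (sqInt_transport_fst hV ψ.2.vavg), real_inner_comm,
    inner_emb_real hV ((φ.2.transport hV.smooth).sqInt hV) (ψ.2.vavg.sqInt_fst hV)]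
  have := integral_transport_mul hV φ.2 h1
  simp only [Function.comp_def] at this
  linarith

/-- The Gaussian has covariance `1`, so `‖X Π ψ‖ ^ 2` is the Dirichlet form of the density. -/
theorem norm_correctorLin_sq (hV : IsConfining V) (ψ : testSpace ℝ d) :
    ‖correctorLin hV ψ‖ ^ 2 = ⟪laplaceLin ℝ hV ψ, proj hV (coreEmb hV ψ)⟫ := by
  have hw := ψ.2.vavg
  have hs := sqInt_transport_fst hV hw
  have hi : ∀ j, Integrable (fun x => pd (ebasis j) (vavg ψ) x * pd (ebasis j) (vavg ψ) x)
      (rhoMeas V) := fun j =>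
    (isGibbs_rhoInf hV).integrable ((hw.pd _).mul_left (hw.pd _).1)
  rw [inner_laplaceLin_proj, ← integral_finsetSum _ fun j _ => hi j, correctorLin_apply,
    ← real_inner_self_eq_norm_sq, inner_emb_real hV hs hs, ← integral_vavg hV (hs.integrable_mul hs)]
  congr 1
  ext x
  rw [transport_fst hw.1, vavg,
    ← integral_gauss_quadratic fun i j => pd (ebasis i) (vavg ψ) x * pd (ebasis j) (vavg ψ) x]
  congr 1
  ext v
  rw [neg_mul_neg, Finset.sum_mul_sum]
  exact Finset.sum_congr rfl fun i _ => Finset.sum_congr rfl fun j _ => by ring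

/-- The part of `X X w` that is quadratic in the velocity, for a function `w` of the position. -/
def hessianQuad (w : E d → ℝ) (z : E d × E d) : ℝ :=
  ∑ i, ∑ j, z.2 i * z.2 j * pd (ebasis i) (pd (ebasis j) w) z.1

theorem vavg_hessianQuad (w : E d → ℝ) (x : E d) :
    vavg (hessianQuad w) x = ∑ j, pd (ebasis j) (pd (ebasis j) w) x :=
  integral_gauss_quadratic fun i j => pd (ebasis i) (pd (ebasis j) w) x

theorem continuous_hessianQuad {w : E d → ℝ} (hw : IsTest w) : Continuous (hessianQuad w) := by
  have hp : ∀ i j, Continuous fun z : E d × E d => pd (ebasis i) (pd (ebasis j) w) z.1 :=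
    fun i j => ((hw.pd _).pd _).1.continuous.comp continuous_fst
  unfold hessianQuad
  fun_prop

theorem abs_hessianQuad_le (w : E d → ℝ) (z : E d × E d) :
    |hessianQuad w z| ≤ ‖z.2‖ ^ 2 * ∑ i, ∑ j, |pd (ebasis i) (pd (ebasis j) w) z.1| := by
  rw [Finset.mul_sum]
  refine (Finset.abs_sum_le_sum_abs _ _).trans (Finset.sum_le_sum fun i _ => ?_)
  rw [Finset.mul_sum]
  refine (Finset.abs_sum_le_sum_abs _ _).trans (Finset.sum_le_sum fun j _ => ?_)
  rw [abs_mul, abs_mul, sq]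
  gcongr
  · exact abs_coord_le _ _
  · exact abs_coord_le _ _

theorem sqInt_hessianQuad (hV : IsConfining V) {w : E d → ℝ} (hw : IsTest w) :
    SqInt V (hessianQuad w) := by
  choose C hC0 hC using fun i j => ((hw.pd (ebasis j)).pd (ebasis i)).exists_bound
  have hC1 : 0 ≤ ∑ i, ∑ j, C i j :=
    Finset.sum_nonneg fun i _ => Finset.sum_nonneg fun j _ => hC0 i j
  refine SqInt.of_le hV (continuous_hessianQuad hw) (C := ∑ i, ∑ j, C i j) fun z => ?_
  refine (abs_hessianQuad_le w z).trans ?_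
  rw [mul_comm]
  refine mul_le_mul (Finset.sum_le_sum fun i _ => Finset.sum_le_sum fun j _ => hC i j _) ?_
    (by positivity) hC1
  linarith

variable (d) in
/-- The fourth moment of the Gaussian. -/
def fourthMoment : ℝ := ∫ v, ‖v‖ ^ 4 ∂(gaussMeas d)

theorem fourthMoment_nonneg : 0 ≤ fourthMoment d := integral_nonneg fun v => by positivity

theorem norm_hessianQuad_sq_le (hV : IsConfining V) {w : E d → ℝ} (hw : IsTest w) :
    ‖emb V (hessianQuad w)‖ ^ 2 ≤ fourthMoment d * d ^ 2 *
      ∑ i, ∑ j, ∫ x, pd (ebasis i) (pd (ebasis j) w) x ^ 2 ∂(rhoMeas V) := by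
  have := isProbabilityMeasure_rhoMeas hV
  have hs := sqInt_hessianQuad hV hw
  have hi : ∀ i j, Integrable (fun x => pd (ebasis i) (pd (ebasis j) w) x ^ 2) (rhoMeas V) :=
    fun i j => (isGibbs_rhoInf hV).integrable ((hw.pd _).pd _).sq
  have hi' := integrable_finsetSum Finset.univ fun i _ =>
    integrable_finsetSum Finset.univ fun j _ => hi i j
  have h4 : Integrable (fun v : E d => ‖v‖ ^ 4) (gaussMeas d) :=
    integrable_gaussMeas_of_le (C := 1) (by fun_prop) fun v => by
      rw [abs_of_nonneg (by positivity)]; linarith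
  have hprod : Integrable (fun z : E d × E d => (∑ i, ∑ j, pd (ebasis i) (pd (ebasis j) w) z.1 ^ 2)
      * ‖z.2‖ ^ 4) (phaseMeas V) := by
    rw [phaseMeas_eq_prod hV]; exact hi'.mul_prod h4
  calc ‖emb V (hessianQuad w)‖ ^ 2 = ∫ z, hessianQuad w z ^ 2 ∂(phaseMeas V) := norm_emb_sq hV hs
    _ ≤ ∫ z, d ^ 2 * ((∑ i, ∑ j, pd (ebasis i) (pd (ebasis j) w) z.1 ^ 2) * ‖z.2‖ ^ 4)
        ∂(phaseMeas V) := by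
      refine integral_mono ((hs.integrable_mul hs).congr (Eventually.of_forall fun z => ?_))
        (hprod.const_mul _) fun z => ?_
      · simp only [sq]
      · simp only
        have h1 := abs_hessianQuad_le w z
        have h2 : (∑ i, ∑ j, |pd (ebasis i) (pd (ebasis j) w) z.1|) ^ 2 ≤
            d ^ 2 * ∑ i, ∑ j, pd (ebasis i) (pd (ebasis j) w) z.1 ^ 2 := by
          rw [← Finset.sum_product', ← Finset.sum_product']
          have := sq_sum_le_card_mul_sum_sq (s := (Finset.univ : Finset (Fin d)) ×ˢ Finset.univ)
            (f := fun p => |pd (ebasis p.1) (pd (ebasis p.2) w) z.1|)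
          simp only [sq_abs, Finset.card_product, Finset.card_univ, Fintype.card_fin] at this
          refine this.trans_eq ?_
          push_cast; ring
        calc hessianQuad w z ^ 2 = |hessianQuad w z| ^ 2 := (sq_abs _).symm
          _ ≤ (‖z.2‖ ^ 2 * ∑ i, ∑ j, |pd (ebasis i) (pd (ebasis j) w) z.1|) ^ 2 := by gcongr
          _ = (∑ i, ∑ j, |pd (ebasis i) (pd (ebasis j) w) z.1|) ^ 2 * ‖z.2‖ ^ 4 := by ring
          _ ≤ (d ^ 2 * ∑ i, ∑ j, pd (ebasis i) (pd (ebasis j) w) z.1 ^ 2) * ‖z.2‖ ^ 4 := by gcongr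
          _ = _ := by ring
    _ = _ := by
      rw [integral_const_mul, phaseMeas_eq_prod hV, integral_prod_mul
        (fun x : E d => ∑ i, ∑ j, pd (ebasis i) (pd (ebasis j) w) x ^ 2) fun v : E d => ‖v‖ ^ 4,
        integral_finsetSum _ fun i _ => integrable_finsetSum _ fun j _ => hi i j]
      simp_rw [integral_finsetSum Finset.univ fun j _ => hi _ j]
      rw [← fourthMoment]; ring

/-- The Hessian is controlled by the weighted Laplacian and the gradient, if the Hessian of the
potential is bounded. -/
theorem IsGibbs.integral_hessian_le {F ι : Type*} [NormedAddCommGroup F] [NormedSpace ℝ F]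
    [FiniteDimensional ℝ F] [MeasureSpace F] [BorelSpace F] [(volume : Measure F).IsAddHaarMeasure]
    [Fintype ι] {W δ : F → ℝ} (hG : IsGibbs W δ) (e : ι → F) {C : ℝ} (hC0 : 0 ≤ C)
    (hC : ∀ i j x, |pd (e i) (pd (e j) W) x| ≤ C) {w : F → ℝ} (hw : IsTest w) :
    ∑ i, ∑ j, ∫ x, pd (e i) (pd (e j) w) x ^ 2 ∂(gibbs δ) ≤
      ∫ x, gibbsLap e W w x ^ 2 ∂(gibbs δ)
        + C * Fintype.card ι * ∑ j, ∫ x, pd (e j) w x * pd (e j) w x ∂(gibbs δ) := by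
  have hW := hG.smooth_potential
  have i1 : ∀ i j, Integrable (fun x => pd (e i) (pd (e j) w) x ^ 2) (gibbs δ) :=
    fun i j => hG.integrable ((hw.pd _).pd _).sq
  have i2 : ∀ i j, Integrable (fun x => pd (e i) (pd (e j) W) x * pd (e i) w x
      * pd (e j) w x) (gibbs δ) := fun i j =>
    hG.integrable ((hw.pd _).mul_left ((contDiff_pd (contDiff_pd hW _) _).mul (hw.pd _).1))
  have i3 : ∀ j, Integrable (fun x => pd (e j) w x * pd (e j) w x) (gibbs δ) :=
    fun j => hG.integrable ((hw.pd _).mul_left (hw.pd _).1)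
  have h0 := hG.integral_gibbsLap_sq e hw
  have h1 : ∑ i, ∑ j, ∫ x, (pd (e j) (pd (e i) w) x ^ 2
        + pd (e i) (pd (e j) W) x * pd (e i) w x * pd (e j) w x) ∂(gibbs δ)
      = ∑ i, ∑ j, ∫ x, pd (e i) (pd (e j) w) x ^ 2 ∂(gibbs δ)
        + ∫ x, ∑ i, ∑ j, pd (e i) (pd (e j) W) x * pd (e i) w x * pd (e j) w x ∂(gibbs δ) := by
    rw [integral_finsetSum _ fun i _ => integrable_finsetSum _ fun j _ => i2 i j,
      Finset.sum_comm (f := fun i j => ∫ x, pd (e i) (pd (e j) w) x ^ 2 ∂(gibbs δ)),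
      ← Finset.sum_add_distrib]
    refine Finset.sum_congr rfl fun i _ => ?_
    rw [integral_finsetSum _ fun j _ => i2 i j, ← Finset.sum_add_distrib]
    exact Finset.sum_congr rfl fun j _ => integral_add (i1 j i) (i2 i j)
  have h2 : -(C * Fintype.card ι * ∑ j, ∫ x, pd (e j) w x * pd (e j) w x ∂(gibbs δ)) ≤
      ∫ x, ∑ i, ∑ j, pd (e i) (pd (e j) W) x * pd (e i) w x * pd (e j) w x ∂(gibbs δ) := by
    rw [← integral_finsetSum _ fun j _ => i3 j, ← integral_const_mul, ← integral_neg]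
    refine integral_mono ((integrable_finsetSum _ fun j _ => i3 j).const_mul _).neg
      (integrable_finsetSum _ fun i _ => integrable_finsetSum _ fun j _ => i2 i j) fun x => ?_
    simp only
    rw [neg_le]
    calc -∑ i, ∑ j, pd (e i) (pd (e j) W) x * pd (e i) w x * pd (e j) w x
        ≤ |∑ i, ∑ j, pd (e i) (pd (e j) W) x * pd (e i) w x * pd (e j) w x| := neg_le_abs _
      _ ≤ ∑ i, ∑ j, C * (|pd (e i) w x| * |pd (e j) w x|) := by
        refine (Finset.abs_sum_le_sum_abs _ _).trans (Finset.sum_le_sum fun i _ => ?_)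
        refine (Finset.abs_sum_le_sum_abs _ _).trans (Finset.sum_le_sum fun j _ => ?_)
        rw [abs_mul, abs_mul, mul_assoc]
        gcongr
        exact hC i j x
      _ = C * (∑ i, |pd (e i) w x|) ^ 2 := by
        rw [sq, Finset.sum_mul_sum, Finset.mul_sum]; simp_rw [Finset.mul_sum]
      _ ≤ C * (Fintype.card ι * ∑ i, |pd (e i) w x| ^ 2) := by
        gcongr
        have := sq_sum_le_card_mul_sum_sq (s := (Finset.univ : Finset ι))
          (f := fun i => |pd (e i) w x|)
        simpa using this
      _ = _ := by simp only [sq_abs]; simp only [sq]; ring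
  rw [h1] at h0
  linarith

/-- Macroscopic coercivity: the velocity average of `-X X Π ψ` is the weighted Laplacian of the
density, and what remains is tested against the microscopic part of `φ` only. -/
theorem inner_correctorLin_transportLin (hV : IsConfining V) (ψ φ : testSpace ℝ d) :
    ⟪correctorLin hV ψ, transportLin hV φ⟫ = ⟪laplaceLin ℝ hV ψ, proj hV (coreEmb hV φ)⟫
      - ⟪emb V (hessianQuad (vavg ψ)), coreEmb hV φ - proj hV (coreEmb hV φ)⟫ := by
  have hG := isGibbs_rhoInf hV
  have hw := ψ.2.vavg
  have hu := φ.2.vavg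
  have hs := sqInt_transport_fst hV hw
  have hq := sqInt_hessianQuad hV hw
  have hc := contDiff_transport hV.smooth (hw.1.comp (contDiff_fst (E := E d) (F := E d)))
  have h1 : ⟪correctorLin hV ψ, transportLin hV φ⟫ =
      -∫ z, φ.1 z * transport V (transport V fun z => vavg ψ z.1) z ∂(phaseMeas V) := by
    rw [correctorLin_apply, transportLin_apply, real_inner_comm,
      inner_emb_real hV ((φ.2.transport hV.smooth).sqInt hV) hs]
    exact integral_transport_mul hV φ.2 hc
  -- the first order part of `X X Π ψ` depends on the position only
  have hg : IsTest fun x => ∑ j, gradV V j x * pd (ebasis j) (vavg ψ) x :=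
    IsTest.sum _ fun j => (hw.pd _).mul_left (contDiff_gradV hV.smooth j)
  have hgs := hg.sqInt_fst hV
  have h2 : ∫ z, φ.1 z * transport V (transport V fun z => vavg ψ z.1) z ∂(phaseMeas V) =
      ⟪emb V (hessianQuad (vavg ψ)), coreEmb hV φ⟫
        - ∫ x, vavg φ x * ∑ j, gradV V j x * pd (ebasis j) (vavg ψ) x ∂(rhoMeas V) := by
    rw [coreEmb_apply, inner_emb_real hV hq (φ.2.sqInt hV)]
    have i4 := (φ.2.sqInt hV).integrable_mul hgs
    have i5 := hq.integrable_mul (φ.2.sqInt hV)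
    have h3 := integral_vavg hV i4
    simp only [vavg_mul_fst φ.1 fun x => ∑ j, gradV V j x * pd (ebasis j) (vavg ψ) x] at h3
    rw [h3]
    refine (integral_congr_ae (Eventually.of_forall fun z => ?_)).trans (integral_sub i5 i4)
    simp only [transport_transport_fst hw.1, hessianQuad]
    ring
  have h4 : ⟪emb V (hessianQuad (vavg ψ)), proj hV (coreEmb hV φ)⟫ =
      ∫ x, vavg φ x * ∑ j, pd (ebasis j) (pd (ebasis j) (vavg ψ)) x ∂(rhoMeas V) := by
    rw [real_inner_comm, inner_proj_coreEmb hV φ hq]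
    simp_rw [vavg_hessianQuad]
  have h5 : ⟪laplaceLin ℝ hV ψ, proj hV (coreEmb hV φ)⟫ =
      ∫ x, gibbsLap ebasis V (vavg ψ) x * vavg φ x ∂(rhoMeas V) := by
    rw [inner_laplaceLin_proj, hG.integral_gibbsLap_mul ebasis hw.1 hu.1 (Or.inl hw.2)]
  have h6 : ∫ x, gibbsLap ebasis V (vavg ψ) x * vavg φ x ∂(rhoMeas V) =
      ∫ x, vavg φ x * ∑ j, gradV V j x * pd (ebasis j) (vavg ψ) x ∂(rhoMeas V)
      - ∫ x, vavg φ x * ∑ j, pd (ebasis j) (pd (ebasis j) (vavg ψ)) x ∂(rhoMeas V) := by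
    have i6 : Integrable (fun x => vavg φ x * ∑ j, gradV V j x * pd (ebasis j) (vavg ψ) x)
        (rhoMeas V) := hG.integrable (hg.mul_left hu.1)
    have i7 : Integrable (fun x => vavg φ x * ∑ j, pd (ebasis j) (pd (ebasis j) (vavg ψ)) x)
        (rhoMeas V) := hG.integrable
      ((IsTest.sum Finset.univ fun j => (hw.pd (ebasis j)).pd (ebasis j)).mul_left hu.1)
    refine (integral_congr_ae (Eventually.of_forall fun x => ?_)).trans (integral_sub i6 i7)
    simp only [gibbsLap, Finset.sum_sub_distrib, smul_eq_mul, gradV_eq]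
    ring
  rw [inner_sub_right, h1, h2, h4, h5, h6]
  ring

variable (d) in
/-- The constant in the bound for the transport of the corrector; `C` bounds the Hessian of `V`. -/
def transportBound (γ C : ℝ) : ℝ :=
  √(fourthMoment d * d ^ 2 * ((γ ^ 2)⁻¹ + C * d * γ⁻¹))

/-- The second derivatives of the density are controlled by the reference operator, through
Bochner's formula, so that the remainder in the macroscopic coercivity is bounded. -/
theorem correctorLin_transport (hV : IsConfining V) {γ : ℝ} (hγ : 0 < γ) {C : ℝ} (hC0 : 0 ≤ C)
    (hC : ∀ x, ‖iteratedFDeriv ℝ 2 V x‖ ≤ C) (ψ φ : testSpace ℝ d) :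
    ⟪laplaceLin ℝ hV ψ, proj hV (coreEmb hV φ)⟫ - transportBound d γ C *
      √(‖proj hV (coreEmb hV ψ + γ • laplaceLin ℝ hV ψ)‖ ^ 2 - ‖proj hV (coreEmb hV ψ)‖ ^ 2)
        * ‖coreEmb hV φ - proj hV (coreEmb hV φ)‖ ≤
      ⟪correctorLin hV ψ, transportLin hV φ⟫ := by
  have hw := ψ.2.vavg
  have hL := (isGibbs_rhoInf hV).isTest_gibbsLap ebasis hw
  rw [inner_correctorLin_transportLin]
  set S := ‖proj hV (coreEmb hV ψ + γ • laplaceLin ℝ hV ψ)‖ ^ 2 - ‖proj hV (coreEmb hV ψ)‖ ^ 2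
  set Dx := ∑ j, ∫ x, pd (ebasis j) (vavg ψ) x * pd (ebasis j) (vavg ψ) x ∂(rhoMeas V) with hDx
  set Lw := ∫ x, gibbsLap ebasis V (vavg ψ) x ^ 2 ∂(rhoMeas V) with hLw
  have hDx0 : 0 ≤ Dx := Finset.sum_nonneg fun j _ => integral_nonneg fun x => mul_self_nonneg _
  have hLw0 : 0 ≤ Lw := integral_nonneg fun x => sq_nonneg _
  have hS : S = 2 * γ * Dx + γ ^ 2 * Lw := by
    have h1 : ⟪proj hV (coreEmb hV ψ), γ • proj hV (laplaceLin ℝ hV ψ)⟫ = γ * Dx := by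
      rw [real_inner_smul_right, ← proj_symm, proj_idem, real_inner_comm, inner_laplaceLin_proj]
    have h2 : ‖proj hV (laplaceLin ℝ hV ψ)‖ ^ 2 = Lw := by
      have hs := hL.sqInt_fst hV
      rw [proj_laplaceLin, ← real_inner_self_eq_norm_sq, inner_emb_real hV hs hs,
        ← integral_vavg hV (hs.integrable_mul hs), hLw]
      simp_rw [vavg_mul_fst (fun z : E d × E d => gibbsLap ebasis V (vavg ψ) z.1), vavg_fst, sq]
    simp only [S]
    rw [map_add, map_smul, norm_add_sq_real, h1, norm_smul, mul_pow, h2, Real.norm_eq_abs, sq_abs]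
    ring
  have hq : ‖emb V (hessianQuad (vavg ψ))‖ ≤ transportBound d γ C * √S := by
    rw [transportBound, ← Real.sqrt_mul (by have := fourthMoment_nonneg (d := d); positivity)]
    refine Real.le_sqrt_of_sq_le ((norm_hessianQuad_sq_le hV hw).trans ?_)
    rw [mul_assoc (fourthMoment d * (d : ℝ) ^ 2)]
    have hH := (isGibbs_rhoInf hV).integral_hessian_le ebasis hC0
      (abs_pd_gradV_le hV.smooth hC) hw
    rw [Fintype.card_fin] at hH
    refine mul_le_mul_of_nonneg_left (hH.trans ?_)
      (by have := fourthMoment_nonneg (d := d); positivity)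
    rw [← hLw, ← hDx, hS]
    have h3 : ((γ ^ 2)⁻¹ + C * d * γ⁻¹) * (2 * γ * Dx + γ ^ 2 * Lw) =
        Lw + C * d * Dx + (2 * γ⁻¹ * Dx + C * d * Dx + C * d * γ * Lw) := by
      field_simp; ring
    rw [h3]
    have : 0 ≤ 2 * γ⁻¹ * Dx + C * d * Dx + C * d * γ * Lw := by positivity
    linarith
  have h4 := real_inner_le_norm (emb V (hessianQuad (vavg ψ)))
    (coreEmb hV φ - proj hV (coreEmb hV φ))
  have h5 := mul_le_mul_of_nonneg_right hq (norm_nonneg (coreEmb hV φ - proj hV (coreEmb hV φ)))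
  linarith

end Corrector

/-! ### The kernel of the weighted Laplacian -/

section WeakGradient

/-- A locally integrable function with vanishing weak gradient is constant. -/
theorem ae_eq_const_of_weak_gradient {F : Type*} [NormedAddCommGroup F] [NormedSpace ℝ F]
    [FiniteDimensional ℝ F] [MeasureSpace F] [BorelSpace F] [(volume : Measure F).IsAddHaarMeasure]
    {h : F → ℝ} (hh : LocallyIntegrable h)
    (h0 : ∀ χ : F → ℝ, IsTest χ → ∀ e, ∫ z, h z * pd e χ z = 0) :
    ∃ c : ℝ, h =ᵐ[volume] fun _ => c := by
  -- the mollifications are smooth with vanishing gradient, and converge almost everywhere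
  let b : ℕ → ContDiffBump (0 : F) := fun n =>
    ⟨1 / ((n : ℝ) + 1), 2 * (1 / ((n : ℝ) + 1)), by positivity, by
      have : (0 : ℝ) < 1 / ((n : ℝ) + 1) := by positivity
      linarith⟩
  have hb0 : Tendsto (fun n => (b n).rOut) atTop (𝓝 0) := by
    have := (tendsto_one_div_add_atTop_nhds_zero_nat (𝕜 := ℝ)).const_mul 2
    simpa [b] using this
  have hlim := ContDiffBump.ae_convolution_tendsto_right_of_locallyIntegrable
    (μ := (volume : Measure F)) (g := h) (K := 2) hb0 (Eventually.of_forall fun n => le_rfl) hh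
  have hconst : ∀ n x y, convolution ((b n).normed volume) h (ContinuousLinearMap.lsmul ℝ ℝ)
      (volume : Measure F) x = convolution ((b n).normed volume) h (ContinuousLinearMap.lsmul ℝ ℝ)
      (volume : Measure F) y := by
    intro n x y
    have hg : IsTest ((b n).normed (volume : Measure F)) :=
      ⟨(b n).contDiff_normed (n := ⊤), (b n).hasCompactSupport_normed⟩
    rw [← convolution_flip]
    have hd : ∀ x, HasFDerivAt _ _ x := fun x => hg.2.hasFDerivAt_convolution_right
      (ContinuousLinearMap.lsmul ℝ ℝ).flip hh (hg.1.of_le (by simp)) x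
    refine is_const_of_fderiv_eq_zero (𝕜 := ℝ) (fun x => (hd x).differentiableAt) (fun x => ?_) x y
    rw [(hd x).fderiv]
    ext e
    rw [convolution_precompR_apply _ hh (hg.2.fderiv (𝕜 := ℝ))
      (hg.1.continuous_fderiv (by simp))]
    simp only [convolution, ContinuousLinearMap.flip_apply, ContinuousLinearMap.lsmul_apply,
      smul_eq_mul, zero_apply]
    have hχ : IsTest fun t => (b n).normed volume (x - t) := by
      refine ⟨by have := hg.1; fun_prop, ?_⟩
      exact hg.2.comp_homeomorph (Homeomorph.subLeft x)
    have h1 : ∀ t, pd e (fun t => (b n).normed volume (x - t)) t =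
        -fderiv ℝ ((b n).normed volume) (x - t) e := fun t => by
      have h2 : HasFDerivAt (fun t : F => x - t) (-ContinuousLinearMap.id ℝ F) t :=
        (hasFDerivAt_id t).const_sub x
      have h3 := (hg.1.hasFDerivAt' (x - t)).comp t h2
      rw [pd, show (fun t => (b n).normed volume (x - t)) =
        (b n).normed volume ∘ fun t => x - t from rfl, h3.fderiv]
      simp
    have h2 := h0 _ hχ e
    simp only [h1, mul_neg, integral_neg, neg_eq_zero] at h2
    simpa only [mul_comm] using h2
  obtain ⟨x₀, hx₀⟩ := hlim.exists
  refine ⟨h x₀, ?_⟩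
  filter_upwards [hlim] with x hx
  refine tendsto_nhds_unique hx ?_
  simpa only [hconst _ x x₀] using hx₀

end WeakGradient

section Kernel

variable {d : ℕ} {V : E d → ℝ}

theorem eq_sum_phaseDir (e : E d × E d) :
    e = ∑ i : Fin d ⊕ Fin d, (Sum.elim (fun j => e.1 j) (fun j => e.2 j) i) • phaseDir i := by
  have h1 : ∀ v : E d, v = ∑ j, v j • ebasis j := fun v => by
    have := (EuclideanSpace.basisFun (Fin d) ℝ).sum_repr v
    simpa using this.symm
  rw [Fintype.sum_sum_type]
  refine Prod.ext ?_ ?_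
  · simpa [phaseDir, Prod.fst_sum] using h1 e.1
  · simpa [phaseDir, Prod.snd_sum] using h1 e.2

theorem locallyIntegrable_div_maxwellian (hV : IsConfining V) (g : B2 ℝ V) :
    LocallyIntegrable fun z => (maxwellian V z)⁻¹ * g z := by
  have hloc : IsLocallyFiniteMeasure (weight V) :=
    IsLocallyFiniteMeasure.withDensity_ofReal (continuous_inv_maxwellian hV)
  have h1 : LocallyIntegrable g (weight V) := (Lp.memLp g).locallyIntegrable (by norm_num)
  rw [locallyIntegrable_iff]
  intro k hk
  have h2 := h1.integrableOn_isCompact hk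
  rw [← integrable_indicator_iff hk.measurableSet] at h2 ⊢
  refine ((integrable_weight_iff hV).1 h2).congr (Eventually.of_forall fun z => ?_)
  by_cases hz : z ∈ k <;> simp [hz]

theorem inner_emb_right (hV : IsConfining V) (g : B2 ℝ V) {k : E d × E d → ℝ} (hk : SqInt V k) :
    ⟪g, emb V k⟫ = ∫ z, (maxwellian V z)⁻¹ * g z * (maxwellian V z * k z) := by
  rw [L2.inner_def]
  have h1 : ∫ z, ⟪g z, emb V k z⟫ ∂(weight V) = ∫ z, g z * (maxwellian V z * k z) ∂(weight V) := by
    refine integral_congr_ae ?_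
    filter_upwards [hk.coeFn_emb hV] with z h1
    rw [h1]; simp [mul_comm]
  rw [h1, integral_weight hV]
  simp only [smul_eq_mul, mul_assoc]

theorem norm_emb_pd_sq_le (hV : IsConfining V) (φ : testSpace ℝ d) (i : Fin d ⊕ Fin d) :
    ‖emb V (pd (phaseDir i) φ.1)‖ ^ 2 ≤ ⟪laplaceLin ℝ hV φ, coreEmb hV φ⟫ := by
  rw [norm_emb_sq hV ((φ.2.pd _).sqInt hV), coreEmb_apply,
    inner_laplaceLin hV φ φ.2.1 (φ.2.sqInt hV)]
  simp_rw [sq]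
  exact Finset.single_le_sum (f := fun i => ∫ z, pd (phaseDir i) φ.1 z * pd (phaseDir i) φ.1 z
    ∂(phaseMeas V)) (fun i _ => integral_nonneg fun z => mul_self_nonneg _) (Finset.mem_univ i)

/-- Integration by parts in `B²`. -/
theorem inner_emb_pd (hV : IsConfining V) (e : E d × E d) {φ η : E d × E d → ℝ} (hφ : IsTest φ)
    (hη : IsTest η) : ⟪emb V φ, emb V (fun z => pd e η z - pd e (phasePot V) z * η z)⟫ =
      -⟪emb V (pd e φ), emb V η⟫ := by
  have hG := isGibbs_maxwellian hV
  have hW := contDiff_pd hG.smooth_potential e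
  have h1 := hφ.mul_right hη.1
  have h2 := hG.integral_pd (h1.1.of_le (by simp)) h1.2 e
  have h3 : IsTest fun z => pd e η z - pd e (phasePot V) z * η z := (hη.pd e).sub (hη.mul_left hW)
  simp only [pd_mul hφ.1 hη.1, smul_eq_mul] at h2
  have i1 : Integrable (fun z => pd e φ z * η z) (phaseMeas V) :=
    hG.integrable ((hφ.pd e).mul_right hη.1)
  have i2 : Integrable (fun z => φ z * pd e η z) (phaseMeas V) :=
    hG.integrable (hφ.mul_right (hη.pd e).1)
  have i3 : Integrable (fun z => pd e (phasePot V) z * (φ z * η z)) (phaseMeas V) :=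
    hG.integrable (h1.mul_left hW)
  rw [integral_add i1 i2] at h2
  rw [inner_emb_real hV (hφ.sqInt hV) (h3.sqInt hV), inner_emb_real hV ((hφ.pd e).sqInt hV)
    (hη.sqInt hV)]
  have h4 : ∫ z, φ z * (pd e η z - pd e (phasePot V) z * η z) ∂(phaseMeas V) =
      ∫ z, φ z * pd e η z ∂(phaseMeas V) - ∫ z, pd e (phasePot V) z * (φ z * η z) ∂(phaseMeas V) := by
    refine (integral_congr_ae (Eventually.of_forall fun z => ?_)).trans (integral_sub i2 i3)
    ring
  rw [h4]; linarith

/-- The kernel of the closed weighted Laplacian consists of the multiples of the Maxwellian: the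
Dirichlet form of the approximations tends to `0`, so the weak gradient of `g / M` vanishes. -/
theorem eq_smul_equil (hV : IsConfining V) {γ : ℝ} (hγ : 0 < γ) (g : B2 ℝ V)
    (hg : ∀ ε > 0, ∃ φ : testSpace ℝ d, ‖coreEmb hV φ + γ • laplaceLin ℝ hV φ - g‖ < ε ∧
      ‖coreEmb hV φ - g‖ < ε) : ∃ c : ℝ, g = c • equil V := by
  have hG := isGibbs_maxwellian hV
  -- `g` is orthogonal to the range of the adjoint derivatives
  have key : ∀ i (η : E d × E d → ℝ), IsTest η → ⟪g, emb V fun z =>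
      pd (phaseDir i) η z - pd (phaseDir i) (phasePot V) z * η z⟫ = 0 := by
    intro i η hη
    set k := emb V fun z => pd (phaseDir i) η z - pd (phaseDir i) (phasePot V) z * η z with hk
    have hb : ∀ ε > 0, ε ≤ 1 → |⟪g, k⟫| ≤
        ε * ‖k‖ + √(2 * ε / γ * (‖g‖ + 1)) * ‖emb V η‖ := by
      intro ε hε hε1
      obtain ⟨φ, h1, h2⟩ := hg ε hε
      have h3 : γ * ‖laplaceLin ℝ hV φ‖ ≤ 2 * ε := by
        have : γ • laplaceLin ℝ hV φ =
            (coreEmb hV φ + γ • laplaceLin ℝ hV φ - g) - (coreEmb hV φ - g) := by abel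
        rw [← Real.norm_of_nonneg hγ.le, ← norm_smul, this]
        exact (norm_sub_le _ _).trans (by linarith)
      have h4 : ‖coreEmb hV φ‖ ≤ ‖g‖ + 1 := by
        have := norm_add_le (coreEmb hV φ - g) g
        rw [sub_add_cancel] at this; linarith
      have h5 : ‖emb V (pd (phaseDir i) φ.1)‖ ≤ √(2 * ε / γ * (‖g‖ + 1)) := by
        refine Real.le_sqrt_of_sq_le ((norm_emb_pd_sq_le hV φ i).trans
          ((real_inner_le_norm _ _).trans ?_))
        gcongr
        rw [le_div_iff₀ hγ]; linarith
      have h6 : ⟪g, k⟫ = -⟪coreEmb hV φ - g, k⟫ - ⟪emb V (pd (phaseDir i) φ.1), emb V η⟫ := by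
        rw [inner_sub_left, coreEmb_apply, hk, inner_emb_pd hV _ φ.2 hη]; ring
      rw [h6]
      refine (abs_sub _ _).trans (add_le_add ?_ ?_)
      · rw [abs_neg]
        exact (abs_real_inner_le_norm _ _).trans (by gcongr)
      · exact (abs_real_inner_le_norm _ _).trans (by gcongr)
    have hlim : Tendsto (fun ε : ℝ => ε * ‖k‖ + √(2 * ε / γ * (‖g‖ + 1)) * ‖emb V η‖)
        (𝓝[>] 0) (𝓝 0) := by
      have : Continuous fun ε : ℝ => ε * ‖k‖ + √(2 * ε / γ * (‖g‖ + 1)) * ‖emb V η‖ := by fun_prop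
      have h7 := this.tendsto 0
      simp only [zero_mul, mul_zero, zero_div, Real.sqrt_zero, add_zero] at h7
      exact h7.mono_left nhdsWithin_le_nhds
    refine abs_nonpos_iff.1 (ge_of_tendsto hlim ?_)
    filter_upwards [Ioc_mem_nhdsGT one_pos] with ε hε
    exact hb ε hε.1 hε.2
  have hloc := locallyIntegrable_div_maxwellian hV g
  obtain ⟨c, hc⟩ := ae_eq_const_of_weak_gradient hloc fun χ hχ e => by
    have hdir : ∀ i, ∫ z, (maxwellian V z)⁻¹ * g z * pd (phaseDir i) χ z = 0 := by
      intro i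
      have hinv : ContDiff ℝ ∞ fun z => (maxwellian V z)⁻¹ :=
        hG.smooth.inv fun z => (maxwellian_pos hV z).ne'
      have hη : IsTest fun z => (maxwellian V z)⁻¹ * χ z := hχ.mul_left hinv
      have h1 := key i _ hη
      have h3 : IsTest fun z => pd (phaseDir i) (fun z => (maxwellian V z)⁻¹ * χ z) z
          - pd (phaseDir i) (phasePot V) z * ((maxwellian V z)⁻¹ * χ z) :=
        (hη.pd _).sub (hη.mul_left (contDiff_pd hG.smooth_potential _))
      rw [inner_emb_right hV g (h3.sqInt hV)] at h1
      rw [← h1]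
      congr 1; ext z; congr 1
      have h4 : χ = fun z => maxwellian V z * ((maxwellian V z)⁻¹ * χ z) := by
        ext z; rw [mul_inv_cancel_left₀ (maxwellian_pos hV z).ne']
      conv_lhs => rw [h4]
      rw [pd_mul hG.smooth hη.1, hG.pd_eq]; ring
    have h5 : ∀ z, (maxwellian V z)⁻¹ * g z * pd e χ z = ∑ i, Sum.elim (fun j => e.1 j)
        (fun j => e.2 j) i * ((maxwellian V z)⁻¹ * g z * pd (phaseDir i) χ z) := by
      intro z
      have : pd e χ z = ∑ i, Sum.elim (fun j => e.1 j) (fun j => e.2 j) i * pd (phaseDir i) χ z := by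
        conv_lhs => rw [pd, eq_sum_phaseDir e, map_sum]
        simp only [map_smul, smul_eq_mul]; rfl
      rw [this, Finset.mul_sum]
      exact Finset.sum_congr rfl fun i _ => by ring
    have h6 : ∀ i, Integrable fun z => (maxwellian V z)⁻¹ * g z * pd (phaseDir i) χ z := fun i =>
      hloc.integrable_smul_right_of_hasCompactSupport (hχ.pd _).1.continuous (hχ.pd _).2
    simp_rw [h5]
    rw [integral_finsetSum _ fun i _ => (h6 i).const_mul _]
    simp [integral_const_mul, hdir]
  refine ⟨c, ?_⟩
  have h1 := emb_congr_ae hV ((sqInt_one hV).const_smul c) (f := g) ?_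
  · rw [h1, emb_smul hV (sqInt_one hV)]; rfl
  · rw [Filter.EventuallyEq, ae_weight_iff hV]
    filter_upwards [hc] with z hz
    have h2 := (maxwellian_pos hV z).ne'
    rw [← hz]; simp only [smul_eq_mul, mul_one]; field_simp

end Kernel

/-! ### The spectral gap for real functions -/

section Complexification

theorem pd_clm_comp {F 𝕜 𝕜' : Type*} [NormedAddCommGroup F] [NormedSpace ℝ F]
    [NormedAddCommGroup 𝕜] [NormedSpace ℝ 𝕜] [NormedAddCommGroup 𝕜'] [NormedSpace ℝ 𝕜']
    (A : 𝕜 →L[ℝ] 𝕜') {φ : F → 𝕜} (hφ : ContDiff ℝ ∞ φ) (e : F) :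
    pd e (fun z => A (φ z)) = fun z => A (pd e φ z) := by
  ext z
  rw [pd, show (fun z => A (φ z)) = A ∘ φ from rfl,
    (A.hasFDerivAt.comp z (hφ.hasFDerivAt' z)).fderiv]
  rfl

theorem IsTest.clm_comp {F 𝕜 𝕜' : Type*} [NormedAddCommGroup F] [NormedSpace ℝ F]
    [NormedAddCommGroup 𝕜] [NormedSpace ℝ 𝕜] [NormedAddCommGroup 𝕜'] [NormedSpace ℝ 𝕜']
    (A : 𝕜 →L[ℝ] 𝕜') {φ : F → 𝕜} (hφ : IsTest φ) : IsTest fun z => A (φ z) :=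
  ⟨A.contDiff.comp hφ.1, hφ.2.comp_left (map_zero A)⟩

theorem gibbsLap_clm_comp {F 𝕜 𝕜' : Type*} [NormedAddCommGroup F] [NormedSpace ℝ F]
    [RCLike 𝕜] [RCLike 𝕜'] {ι : Type*} [Fintype ι] (b : ι → F) (W : F → ℝ)
    (A : 𝕜 →L[ℝ] 𝕜') {φ : F → 𝕜} (hφ : ContDiff ℝ ∞ φ) :
    gibbsLap b W (fun z => A (φ z)) = fun z => A (gibbsLap b W φ z) := by
  ext z
  simp only [gibbsLap, pd_clm_comp A hφ, pd_clm_comp A (contDiff_pd hφ _), map_sum, map_sub,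
    map_smul]

variable {d : ℕ} {V : E d → ℝ}

theorem compLp_emb {𝕜 𝕜' : Type} [RCLike 𝕜] [RCLike 𝕜'] (hV : IsConfining V) (A : 𝕜 →L[ℝ] 𝕜')
    {h : E d × E d → 𝕜} (hh : SqInt V h) (hA : SqInt V fun z => A (h z)) :
    A.compLp (emb V h) = emb V fun z => A (h z) := by
  refine emb_congr_ae hV hA ?_
  filter_upwards [A.coeFn_compLp (emb V h), hh.coeFn_emb hV] with z h1 h2
  rw [h1, h2, map_smul]

end Complexification

section Gap

variable {d : ℕ} {V : E d → ℝ}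

/-- The Dirichlet form for complex functions; the inner product is conjugate linear in the first
variable. -/
theorem inner_laplaceLin_complex (hV : IsConfining V) (φ ψ : testSpace ℂ d) :
    inner ℂ (laplaceLin ℂ hV φ) (emb V (ψ : E d × E d → ℂ)) =
      ∑ i, ∫ z, pd (phaseDir i) (fun z => Complex.conjCLE (φ.1 z)) z * pd (phaseDir i) ψ.1 z
        ∂(phaseMeas V) := by
  have hG := isGibbs_maxwellian hV
  have hφ : IsTest fun z => (Complex.conjCLE : ℂ →L[ℝ] ℂ) (φ.1 z) := φ.2.clm_comp _
  have h1 := hG.integral_gibbsLap_mul phaseDir hφ.1 ψ.2.1 (Or.inl hφ.2)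
  rw [show laplaceLin ℂ hV φ = emb V (gibbsLap phaseDir (phasePot V) φ.1) from rfl,
    inner_emb hV ((hG.isTest_gibbsLap phaseDir φ.2).sqInt hV) (ψ.2.sqInt hV)]
  refine Eq.trans ?_ h1
  rw [gibbsLap_clm_comp phaseDir (phasePot V) (Complex.conjCLE : ℂ →L[ℝ] ℂ) φ.2.1]
  congr 1; ext z
  rw [RCLike.inner_apply, mul_comm]; rfl

theorem inner_laplaceLin_complex_symm (hV : IsConfining V) (φ ψ : testSpace ℂ d) :
    inner ℂ (laplaceLin ℂ hV φ) (emb V (ψ : E d × E d → ℂ)) =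
      inner ℂ (emb V (φ : E d × E d → ℂ)) (laplaceLin ℂ hV ψ) := by
  rw [← inner_conj_symm (emb V (φ : E d × E d → ℂ)), inner_laplaceLin_complex,
    inner_laplaceLin_complex, map_sum]
  refine Finset.sum_congr rfl fun i _ => ?_
  rw [← integral_conj]
  congr 1; ext z
  have h1 := pd_clm_comp (Complex.conjCLE : ℂ →L[ℝ] ℂ) φ.2.1 (phaseDir i)
  have h2 := pd_clm_comp (Complex.conjCLE : ℂ →L[ℝ] ℂ) ψ.2.1 (phaseDir i)
  simp only [ContinuousLinearEquiv.coe_coe, Complex.conjCLE_apply] at h1 h2 ⊢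
  rw [h1, h2, map_mul, Complex.conj_conj, mul_comm]

theorem inner_laplaceLin_complex_nonneg (hV : IsConfining V) (φ : testSpace ℂ d) :
    0 ≤ (inner ℂ (laplaceLin ℂ hV φ) (emb V (φ : E d × E d → ℂ))).re := by
  rw [inner_laplaceLin_complex, Complex.re_sum]
  refine Finset.sum_nonneg fun i _ => ?_
  have h1 := pd_clm_comp (Complex.conjCLE : ℂ →L[ℝ] ℂ) φ.2.1 (phaseDir i)
  simp only [ContinuousLinearEquiv.coe_coe, Complex.conjCLE_apply] at h1 ⊢
  rw [h1]
  have h2 : ∀ z, (starRingEnd ℂ) (pd (phaseDir i) φ.1 z) * pd (phaseDir i) φ.1 z =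
      ((‖pd (phaseDir i) φ.1 z‖ ^ 2 : ℝ) : ℂ) := fun z => by
    rw [mul_comm, Complex.mul_conj, Complex.normSq_eq_norm_sq]
  simp_rw [h2]
  rw [integral_complex_ofReal, Complex.ofReal_re]
  exact integral_nonneg fun z => by positivity

/-- The graph of the closure of `Λ² - 1`, in terms of `h = f / M`. -/
def diffusionGraph (hV : IsConfining V) (γ : ℝ) : Submodule ℂ (B2 ℂ V × B2 ℂ V) :=
  (LinearMap.range ((opLin hV (fun φ => φ) (fun _ h => h.sqInt hV) (fun _ _ _ _ => rfl)
    (fun _ _ _ => rfl)).prod ((γ : ℂ) • laplaceLin ℂ hV))).topologicalClosure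

theorem diffusionGraph_eq_closure (hV : IsConfining V) (γ : ℝ) :
    (diffusionGraph hV γ : Set (B2 ℂ V × B2 ℂ V)) = closure (Set.range fun φ : testSpace ℂ d =>
      (emb V (φ : E d × E d → ℂ), (γ : ℂ) • laplaceLin ℂ hV φ)) := by
  rw [diffusionGraph, Submodule.topologicalClosure_coe, LinearMap.coe_range]
  rfl

theorem diffusionGraph_eq (hV : IsConfining V) (γ : ℝ) :
    (diffusionGraph hV γ : Set (B2 ℂ V × B2 ℂ V)) = closureGraph V (lambdaSqSubOne V γ) := by
  have hG := isGibbs_maxwellian hV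
  have hL : ∀ φ : E d × E d → ℂ, IsTest φ → SqInt V (gibbsLap phaseDir (phasePot V) φ) :=
    fun φ hφ => (hG.isTest_gibbsLap phaseDir hφ).sqInt hV
  have hr : ∀ φ : E d × E d → ℂ, (fun z => γ • gibbsLap phaseDir (phasePot V) φ z) =
      fun z => (γ : ℂ) • gibbsLap phaseDir (phasePot V) φ z := fun φ => by
    ext z; simp
  rw [closureGraph_eq hV (A := fun φ z => γ • gibbsLap phaseDir (phasePot V) φ z)
    (fun φ hφ => by rw [hr]; exact (hL φ hφ).const_smul _)
    (fun φ hφ => lambdaSqSubOne_maxwellian_smul hV γ hφ), diffusionGraph_eq_closure]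
  congr 2
  ext1 φ
  rw [hr, emb_smul hV (hL φ φ.2)]
  rfl

/-- The spectral gap of `Λ² - 1`, which concerns complex functions, read on the real test
functions: the range of `Λ²` is dense, and the gap inequality holds. -/
theorem HasSpectralGap.core (hV : IsConfining V) {γ α : ℝ} (hγ : 0 < γ)
    (h : HasSpectralGap V γ α) :
    DenseRange (coreEmb hV + γ • laplaceLin ℝ hV) ∧
      ∀ φ, α * ⟪γ • laplaceLin ℝ hV φ, coreEmb hV φ⟫ ≤ ‖γ • laplaceLin ℝ hV φ‖ ^ 2 := by
  have hG := isGibbs_maxwellian hV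
  obtain ⟨hα, hgap⟩ := h
  rw [← diffusionGraph_eq hV γ] at hgap
  have hcl := diffusionGraph_eq_closure hV γ
  have hsub : ∀ {S : Set (B2 ℂ V × B2 ℂ V)}, IsClosed S → (∀ φ : testSpace ℂ d,
      (emb V (φ : E d × E d → ℂ), (γ : ℂ) • laplaceLin ℂ hV φ) ∈ S) →
      ∀ p ∈ diffusionGraph hV γ, p ∈ S := by
    intro S hS h1 p hp
    have hp' : p ∈ (diffusionGraph hV γ : Set (B2 ℂ V × B2 ℂ V)) := hp
    rw [hcl] at hp'
    refine closure_minimal ?_ hS hp'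
    rintro _ ⟨φ, rfl⟩
    exact h1 φ
  have hsymm : ∀ p ∈ diffusionGraph hV γ, ∀ q ∈ diffusionGraph hV γ,
      inner ℂ p.2 q.1 = inner ℂ p.1 q.2 := by
    intro p hp
    refine hsub (S := {q | inner ℂ p.2 q.1 = inner ℂ p.1 q.2})
      (isClosed_eq (by fun_prop) (by fun_prop)) fun ψ => ?_
    refine hsub (S := {p | inner ℂ p.2 (emb V (ψ : E d × E d → ℂ)) =
      inner ℂ p.1 ((γ : ℂ) • laplaceLin ℂ hV ψ)})
      (isClosed_eq (by fun_prop) (by fun_prop)) (fun φ => ?_) p hp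
    simp only [Set.mem_ofPred_eq, inner_smul_left, inner_smul_right, Complex.conj_ofReal,
      inner_laplaceLin_complex_symm]
  have hpos : ∀ p ∈ diffusionGraph hV γ, 0 ≤ (inner ℂ p.2 p.1).re := by
    refine hsub (S := {p | 0 ≤ (inner ℂ p.2 p.1).re})
      (isClosed_le continuous_const (Complex.continuous_re.comp (by fun_prop))) fun φ => ?_
    simp only [Set.mem_ofPred_eq, inner_smul_left, Complex.conj_ofReal, Complex.re_ofReal_mul]
    exact mul_nonneg hγ.le (inner_laplaceLin_complex_nonneg hV φ)
  obtain ⟨hsurj, hg⟩ := gap_of_graphSpectrum hsymm hpos hα hgap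
  refine ⟨?_, fun φ => ?_⟩
  · have h1 : DenseRange fun φ : testSpace ℂ d =>
        (γ : ℂ) • laplaceLin ℂ hV φ + emb V (φ : E d × E d → ℂ) := by
      intro g
      obtain ⟨p, hp, rfl⟩ := hsurj g
      refine hsub (S := {p | p.2 + p.1 ∈ closure (Set.range fun φ : testSpace ℂ d =>
        (γ : ℂ) • laplaceLin ℂ hV φ + emb V (φ : E d × E d → ℂ))})
        (isClosed_closure.preimage (by fun_prop)) (fun φ => subset_closure ⟨φ, rfl⟩) p hp
    have h2 : Function.Surjective (Complex.reCLM.compLpL 2 (weight V)) := fun g =>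
      ⟨Complex.ofRealCLM.compLpL 2 (weight V) g, by
        refine Lp.ext ?_
        filter_upwards [Complex.reCLM.coeFn_compLpL (Complex.ofRealCLM.compLpL 2 (weight V) g),
          Complex.ofRealCLM.coeFn_compLpL g] with z h3 h4
        rw [h3, h4]; simp⟩
    -- `Λ²` has real coefficients, so it commutes with taking the real part
    refine (h2.denseRange.comp h1 (ContinuousLinearMap.continuous _)).mono ?_
    rintro _ ⟨φ, rfl⟩
    have hre : IsTest fun z => Complex.reCLM (φ.1 z) := φ.2.clm_comp _
    refine ⟨⟨_, hre⟩, ?_⟩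
    have hL := hG.isTest_gibbsLap phaseDir φ.2
    have hs : IsTest fun z => (γ : ℂ) • gibbsLap phaseDir (phasePot V) φ.1 z + φ.1 z :=
      (hL.mul_left contDiff_const).add φ.2
    have h3 : (γ : ℂ) • laplaceLin ℂ hV φ + emb V (φ : E d × E d → ℂ) =
        emb V fun z => (γ : ℂ) • gibbsLap phaseDir (phasePot V) φ.1 z + φ.1 z := by
      rw [emb_add hV ((hL.sqInt hV).const_smul _) (φ.2.sqInt hV), emb_smul hV (hL.sqInt hV)]; rfl
    have hL' := hG.isTest_gibbsLap phaseDir hre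
    simp only [Function.comp_apply]
    rw [h3, show (Complex.reCLM.compLpL 2 (weight V)) _ = Complex.reCLM.compLp _ from rfl,
      compLp_emb hV _ (hs.sqInt hV) ((hs.clm_comp _).sqInt hV), LinearMap.add_apply,
      LinearMap.smul_apply, laplaceLin_apply, coreEmb_apply, ← emb_smul hV (hL'.sqInt hV),
      ← emb_add hV (hre.sqInt hV) ((hL'.sqInt hV).const_smul _),
      gibbsLap_clm_comp phaseDir (phasePot V) _ φ.2.1]
    congr 1
    ext z
    simp [add_comm]
  · have hof : IsTest fun z => Complex.ofRealCLM (φ.1 z) := φ.2.clm_comp _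
    set ψ : testSpace ℂ d := ⟨_, hof⟩
    have h1 := hg (emb V ψ.1, (γ : ℂ) • laplaceLin ℂ hV ψ) (by
      change _ ∈ (diffusionGraph hV γ : Set (B2 ℂ V × B2 ℂ V))
      rw [hcl]; exact subset_closure ⟨ψ, rfl⟩)
    have hinner : ∀ {a b : E d × E d → ℝ}, IsTest a → IsTest b →
        inner ℂ (emb V fun z => Complex.ofRealCLM (a z)) (emb V fun z => Complex.ofRealCLM (b z)) =
        ((⟪emb V a, emb V b⟫ : ℝ) : ℂ) := by
      intro a b ha hb
      rw [inner_emb hV ((ha.clm_comp _).sqInt hV) ((hb.clm_comp _).sqInt hV),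
        inner_emb_real hV (ha.sqInt hV) (hb.sqInt hV), ← integral_complex_ofReal]
      congr 1; ext z; simp [mul_comm]
    have h2 : laplaceLin ℂ hV ψ = emb V fun z =>
        Complex.ofRealCLM (gibbsLap phaseDir (phasePot V) φ.1 z) := by
      rw [← gibbsLap_clm_comp phaseDir (phasePot V) _ φ.2.1]; rfl
    have hL := hG.isTest_gibbsLap phaseDir φ.2
    have h3 : ‖laplaceLin ℂ hV ψ‖ ^ 2 = ‖laplaceLin ℝ hV φ‖ ^ 2 := by
      rw [← real_inner_self_eq_norm_sq (laplaceLin ℝ hV φ), laplaceLin_apply, h2]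
      have := inner_self_eq_norm_sq (𝕜 := ℂ)
        (emb V fun z => Complex.ofRealCLM (gibbsLap phaseDir (phasePot V) φ.1 z))
      rw [hinner hL hL] at this
      exact this.symm
    have h4 : inner ℂ (laplaceLin ℂ hV ψ) (emb V ψ.1) =
        ((⟪laplaceLin ℝ hV φ, coreEmb hV φ⟫ : ℝ) : ℂ) := by
      rw [h2]; exact hinner hL φ.2
    simp only [inner_smul_left, Complex.conj_ofReal, h4, ← Complex.ofReal_mul,
      Complex.ofReal_re] at h1
    rw [norm_smul, mul_pow, h3, Complex.norm_real] at h1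
    rwa [inner_smul_left, norm_smul, mul_pow]

end Gap

/-! ### Bounds for the transport operator -/

section CoreEstimates

variable {d : ℕ} {V : E d → ℝ}

theorem inner_laplaceLin_symm (hV : IsConfining V) (φ ψ : testSpace ℝ d) :
    ⟪laplaceLin ℝ hV φ, coreEmb hV ψ⟫ = ⟪coreEmb hV φ, laplaceLin ℝ hV ψ⟫ := by
  rw [← real_inner_comm, coreEmb_apply, coreEmb_apply, real_inner_comm,
    inner_laplaceLin hV φ ψ.2.1 (ψ.2.sqInt hV), real_inner_comm,
    inner_laplaceLin hV ψ φ.2.1 (φ.2.sqInt hV)]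
  simp_rw [mul_comm]

theorem inner_laplaceLin_nonneg (hV : IsConfining V) (φ : testSpace ℝ d) :
    0 ≤ ⟪laplaceLin ℝ hV φ, coreEmb hV φ⟫ := by
  rw [coreEmb_apply, inner_laplaceLin hV φ φ.2.1 (φ.2.sqInt hV)]
  exact Finset.sum_nonneg fun i _ => integral_nonneg fun z => mul_self_nonneg _

theorem inner_transportLin (hV : IsConfining V) (φ : testSpace ℝ d) :
    ⟪transportLin hV φ, coreEmb hV φ⟫ = 0 := by
  have h1 := integral_transport_mul hV φ.2 φ.2.1
  rw [transportLin_apply, coreEmb_apply, inner_emb_real hV ((φ.2.transport hV.smooth).sqInt hV)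
    (φ.2.sqInt hV)]
  simp_rw [mul_comm (φ.1 _)] at h1
  linarith

theorem inner_transportLin_equil (hV : IsConfining V) (φ : testSpace ℝ d) :
    ⟪transportLin hV φ, equil V⟫ = 0 := by
  rw [transportLin_apply, equil, inner_emb_real hV ((φ.2.transport hV.smooth).sqInt hV)
    (sqInt_one hV)]
  simpa using integral_transport hV (φ.2.1.of_le (by simp)) φ.2.2

/-- The hypotheses of the abstract method, with constants that depend only on `d`, `γ` and a bound
for the Hessian of `V`. -/
theorem coreEstimates (hV : IsConfining V) {γ : ℝ} (hγ : 0 < γ) {C : ℝ} (hC0 : 0 ≤ C)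
    (hC : ∀ x, ‖iteratedFDeriv ℝ 2 V x‖ ≤ C) :
    CoreEstimates (coreEmb hV) (coreEmb hV + γ • laplaceLin ℝ hV) (transportLin hV)
      (correctorLin hV) (proj hV) (equil V) γ γ⁻¹ (transportBound d γ C) where
  symm φ ψ := by
    simp only [LinearMap.add_apply, LinearMap.smul_apply, inner_add_left, inner_add_right,
      inner_smul_left, inner_smul_right, inner_laplaceLin_symm]; rfl
  norm_sq_le φ := by
    have := mul_nonneg hγ.le (inner_laplaceLin_nonneg hV φ)
    rw [LinearMap.add_apply, LinearMap.smul_apply, inner_add_left, real_inner_self_eq_norm_sq,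
      real_inner_smul_left]
    linarith
  proj_symm := proj_symm hV
  proj_idem := proj_idem hV
  proj_commute φ ψ := by
    simp only [LinearMap.add_apply, LinearMap.smul_apply, inner_add_left, real_inner_smul_left,
      inner_laplaceLin_proj]
    rw [← proj_symm, real_inner_comm]
    simp_rw [mul_comm (pd _ (vavg φ.1) _)]
  norm_eq := norm_equil hV
  proj_eq := proj_equil hV
  inner_eq φ := by
    rw [LinearMap.add_apply, LinearMap.smul_apply, inner_add_left, real_inner_smul_left,
      inner_laplaceLin_equil]; ring
  antisymm := inner_transportLin hV
  mass := inner_transportLin_equil hV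
  corrector_inner := correctorLin_inner hV
  corrector_norm ψ := by
    rw [norm_correctorLin_sq, LinearMap.add_apply, LinearMap.smul_apply, add_sub_cancel_left,
      real_inner_smul_left, inv_mul_cancel_left₀ hγ.ne']
  proj_corrector := proj_correctorLin hV
  corrector_transport ψ φ := by
    rw [LinearMap.add_apply, LinearMap.smul_apply, add_sub_cancel_left, real_inner_smul_left,
      inv_mul_cancel_left₀ hγ.ne']
    exact correctorLin_transport hV hγ hC0 hC ψ φ
  kernel := eq_smul_equil hV hγ

end CoreEstimates

section TransportBounds

variable {d : ℕ} {V : E d → ℝ}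

/-- The commutator of a derivative with the transport operator has coefficients that involve only
the Hessian of `V`. -/
theorem pd_transport (hV : ContDiff ℝ ∞ V) {h : E d × E d → ℝ} (hh : ContDiff ℝ ∞ h)
    (e z : E d × E d) : pd e (transport V h) z = transport V (pd e h) z
      + (-(∑ j, e.2 j * pd (phaseDir (Sum.inl j)) h z)
        + ∑ j, pd e.1 (gradV V j) z.1 * pd (phaseDir (Sum.inr j)) h z) := by
  have h1 := contDiff_phase_coord (d := d)
  have h2 := contDiff_phase_gradV hV
  have h3 := fun e => contDiff_pd hh e
  have h4 : ContDiff ℝ ∞ fun z : E d × E d => ∑ j, z.2 j * pd (phaseDir (Sum.inl j)) h z := by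
    fun_prop
  have h5 : ContDiff ℝ ∞ fun z : E d × E d => ∑ j, gradV V j z.1 * pd (phaseDir (Sum.inr j)) h z := by
    fun_prop
  have h6 : transport V h = fun z => (fun z => -∑ j, z.2 j * pd (phaseDir (Sum.inl j)) h z) z +
    (fun z => ∑ j, gradV V j z.1 * pd (phaseDir (Sum.inr j)) h z) z := rfl
  rw [h6, pd_add h4.neg h5, pd_neg, pd_sum _ fun j => (h1 j).mul (h3 _),
    pd_sum _ fun j => (h2 j).mul (h3 _)]
  simp only [pd_mul (h1 _) (h3 _), pd_mul (h2 _) (h3 _), pd_comp_snd (contDiff_coord _),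
    pd_comp_fst (contDiff_gradV hV _), pd_coord, Finset.sum_add_distrib, transport]
  simp only [fun j => pd_comm hh e (phaseDir (Sum.inl j)),
    fun j => pd_comm hh e (phaseDir (Sum.inr j))]
  ring

/-- The commutator of the transport operator and the weighted Laplacian is bounded, in the sense of
forms, by the weighted Laplacian. -/
theorem inner_transportLin_laplaceLin_le (hV : IsConfining V) {C : ℝ} (hC0 : 0 ≤ C)
    (hC : ∀ x, ‖iteratedFDeriv ℝ 2 V x‖ ≤ C) (φ : testSpace ℝ d) :
    ⟪transportLin hV φ, laplaceLin ℝ hV φ⟫ ≤ (1 + d * C) * ⟪laplaceLin ℝ hV φ, coreEmb hV φ⟫ := by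
  have hG := isGibbs_maxwellian hV
  have hX := φ.2.transport hV.smooth
  have hsq : ∀ i, Integrable (fun z => pd (phaseDir i) φ.1 z * pd (phaseDir i) φ.1 z)
      (phaseMeas V) := fun i => hG.integrable ((φ.2.pd _).mul_left (φ.2.pd _).1)
  rw [real_inner_comm, transportLin_apply, coreEmb_apply,
    inner_laplaceLin hV φ hX.1 (hX.sqInt hV), inner_laplaceLin hV φ φ.2.1 (φ.2.sqInt hV)]
  -- the commutator of the gradient with the transport
  set R : Fin d ⊕ Fin d → E d × E d → ℝ := fun i z =>
    -(∑ j, (phaseDir i : E d × E d).2 j * pd (phaseDir (Sum.inl j)) φ.1 z)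
      + ∑ j, pd (phaseDir i : E d × E d).1 (gradV V j) z.1 * pd (phaseDir (Sum.inr j)) φ.1 z with hR
  have hRt : ∀ i, IsTest (R i) := fun i =>
    (IsTest.sum _ fun j => (φ.2.pd _).mul_left contDiff_const).neg.add
      (IsTest.sum _ fun j => (φ.2.pd _).mul_left
        ((contDiff_pd (contDiff_gradV hV.smooth j) _).comp contDiff_fst))
  have hRi : ∀ i, Integrable (fun z => pd (phaseDir i) φ.1 z * R i z) (phaseMeas V) := fun i =>
    hG.integrable ((hRt i).mul_left (φ.2.pd _).1)
  have h1 : ∀ i, ∫ z, pd (phaseDir i) φ.1 z * pd (phaseDir i) (transport V φ.1) z ∂(phaseMeas V) =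
      ∫ z, pd (phaseDir i) φ.1 z * R i z ∂(phaseMeas V) := by
    intro i
    have hi := φ.2.pd (phaseDir i)
    have h2 := integral_transport_mul hV hi hi.1
    simp_rw [mul_comm (transport V _ _)] at h2
    have h3 : ∫ z, pd (phaseDir i) φ.1 z * transport V (pd (phaseDir i) φ.1) z
        ∂(phaseMeas V) = 0 := by linarith
    have i1 : Integrable (fun z => pd (phaseDir i) φ.1 z * transport V (pd (phaseDir i) φ.1) z)
        (phaseMeas V) := hG.integrable ((hi.transport hV.smooth).mul_left hi.1)
    simp_rw [pd_transport hV.smooth φ.2.1, mul_add (pd (phaseDir i) φ.1 _) (transport V _ _)]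
    rw [integral_add i1 (hRi i), h3, zero_add]
  simp_rw [h1]
  rw [← integral_finsetSum _ fun i _ => hRi i, ← integral_finsetSum _ fun i _ => hsq i,
    ← integral_const_mul]
  refine integral_mono (integrable_finsetSum _ fun i _ => hRi i)
    ((integrable_finsetSum _ fun i _ => hsq i).const_mul _) fun z => ?_
  simp only [Fintype.sum_sum_type, hR]
  set p : Fin d → ℝ := fun j => pd (phaseDir (Sum.inl j)) φ.1 z
  set q : Fin d → ℝ := fun j => pd (phaseDir (Sum.inr j)) φ.1 z
  have h4 : ∀ i, p i * (-(∑ j, (phaseDir (Sum.inl i) : E d × E d).2 j * p j)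
      + ∑ j, pd (phaseDir (Sum.inl i) : E d × E d).1 (gradV V j) z.1 * q j) =
      ∑ j, p i * (pd (ebasis i) (gradV V j) z.1 * q j) := fun i => by
    simp [phaseDir, Finset.mul_sum]
  have h5 : ∀ i, q i * (-(∑ j, (phaseDir (Sum.inr i) : E d × E d).2 j * p j)
      + ∑ j, pd (phaseDir (Sum.inr i) : E d × E d).1 (gradV V j) z.1 * q j) = -(q i * p i) := fun i => by
    simp [phaseDir, pd_zero, ebasis]
  rw [Finset.sum_congr rfl fun i _ => h4 i, Finset.sum_congr rfl fun i _ => h5 i]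
  have h6 : ∑ i, ∑ j, p i * (pd (ebasis i) (gradV V j) z.1 * q j) ≤
      ∑ i, ∑ j, C * ((p i * p i + q j * q j) / 2) := by
    refine Finset.sum_le_sum fun i _ => Finset.sum_le_sum fun j _ => ?_
    calc p i * (pd (ebasis i) (gradV V j) z.1 * q j)
        ≤ |p i * (pd (ebasis i) (gradV V j) z.1 * q j)| := le_abs_self _
      _ = |pd (ebasis i) (gradV V j) z.1| * (|p i| * |q j|) := by rw [abs_mul, abs_mul]; ring
      _ ≤ C * ((p i * p i + q j * q j) / 2) := by
        gcongr
        · exact abs_pd_gradV_le hV.smooth hC i j _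
        · nlinarith [sq_nonneg (|p i| - |q j|), abs_mul_abs_self (p i), abs_mul_abs_self (q j)]
  have h7 : ∑ i, ∑ j, C * ((p i * p i + q j * q j) / 2) =
      d * C / 2 * (∑ i, p i * p i + ∑ i, q i * q i) := by
    simp only [add_div, mul_add, Finset.sum_add_distrib, Finset.sum_const, Finset.card_univ,
      Fintype.card_fin, nsmul_eq_mul, ← Finset.mul_sum, ← Finset.sum_div]
    ring
  have h8 : ∑ i, -(q i * p i) ≤ ∑ i, (p i * p i + q i * q i) / 2 :=
    Finset.sum_le_sum fun i _ => by nlinarith [sq_nonneg (p i + q i)]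
  rw [← Finset.sum_div, Finset.sum_add_distrib] at h8
  rw [h7] at h6
  have h9 : 0 ≤ ∑ i, p i * p i := Finset.sum_nonneg fun i _ => mul_self_nonneg _
  have h10 : 0 ≤ ∑ i, q i * q i := Finset.sum_nonneg fun i _ => mul_self_nonneg _
  have h11 : 0 ≤ d * C * (∑ i, p i * p i + ∑ i, q i * q i) := by positivity
  nlinarith

theorem abs_pd_pd_phasePot_le (hV : ContDiff ℝ ∞ V) {C : ℝ} (hC0 : 0 ≤ C)
    (hC : ∀ x, ‖iteratedFDeriv ℝ 2 V x‖ ≤ C) (i j : Fin d ⊕ Fin d) (z : E d × E d) :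
    |pd (phaseDir i) (pd (phaseDir j) (phasePot V)) z| ≤ C + 1 := by
  rcases j with j | j
  · rw [pd_inl_phasePot hV, pd_comp_fst (contDiff_gradV hV j)]
    rcases i with i | i
    · exact (abs_pd_gradV_le hV hC i j z.1).trans (by linarith)
    · simp only [phaseDir, Sum.elim_inr, pd_zero, abs_zero]; linarith
  · rw [pd_inr_phasePot hV, pd_comp_snd (contDiff_coord j), pd_coord]
    rcases i with i | i
    · simp only [phaseDir, Sum.elim_inl, PiLp.zero_apply, abs_zero]; linarith
    · have := abs_coord_le (ebasis i) j
      rw [norm_ebasis] at this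
      simp only [phaseDir, Sum.elim_inr]; linarith

/-- The transport operator is relatively bounded by the weighted Laplacian. Its coefficients are
unbounded, but it is the sum of the `∂_x* ∂_v - ∂_v* ∂_x`, and the norm of `∂* u` is controlled by
the derivatives of `u`. -/
theorem exists_norm_transportLin_le (hV : IsConfining V) {γ : ℝ} (hγ : 0 < γ) {C : ℝ} (hC0 : 0 ≤ C)
    (hC : ∀ x, ‖iteratedFDeriv ℝ 2 V x‖ ≤ C) : ∃ c, ∀ φ : testSpace ℝ d,
      ‖transportLin hV φ‖ ≤ c * ‖(coreEmb hV + γ • laplaceLin ℝ hV) φ‖ := by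
  have hG := isGibbs_maxwellian hV
  have hW := hG.smooth_potential
  set B : ℝ := (γ ^ 2)⁻¹ + (C + 1) * (2 * d + 1) * γ⁻¹ with hB
  refine ⟨∑ j : Fin d, (√B + √B), fun φ => ?_⟩
  set n := ‖(coreEmb hV + γ • laplaceLin ℝ hV) φ‖ with hn
  set D := ⟪laplaceLin ℝ hV φ, coreEmb hV φ⟫ with hD
  have hD0 : 0 ≤ D := inner_laplaceLin_nonneg hV φ
  set L := ‖laplaceLin ℝ hV φ‖ ^ 2 with hL
  have hL0 : 0 ≤ L := sq_nonneg _
  have hn2 : 2 * γ * D + γ ^ 2 * L ≤ n ^ 2 := by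
    have h1 : n ^ 2 = ‖coreEmb hV φ‖ ^ 2 + 2 * (γ * D) + γ ^ 2 * L := by
      rw [hn, LinearMap.add_apply, LinearMap.smul_apply, norm_add_sq_real, real_inner_smul_right,
        real_inner_comm, norm_smul, mul_pow, Real.norm_eq_abs, sq_abs]
    nlinarith [sq_nonneg ‖coreEmb hV φ‖]
  have hDeq : D = ∑ i, ∫ z, pd (phaseDir i) φ.1 z * pd (phaseDir i) φ.1 z ∂(phaseMeas V) := by
    rw [hD, coreEmb_apply, inner_laplaceLin hV φ φ.2.1 (φ.2.sqInt hV)]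
  have hH := hG.integral_hessian_le phaseDir (by linarith) (abs_pd_pd_phasePot_le hV.smooth hC0 hC)
    φ.2
  rw [← hDeq, ← norm_emb_sq hV ((hG.isTest_gibbsLap phaseDir φ.2).sqInt hV), ← laplaceLin_apply hV,
    ← hL] at hH
  simp only [Fintype.card_sum, Fintype.card_fin] at hH
  push_cast at hH
  -- the norm of `∂ᵢ* ∂ₖ φ`
  have hadj : ∀ i k, IsTest fun z => pd (phaseDir i) (phasePot V) z * pd (phaseDir k) φ.1 z
      - pd (phaseDir i) (pd (phaseDir k) φ.1) z := fun i k =>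
    ((φ.2.pd _).mul_left (contDiff_pd hW _)).sub ((φ.2.pd _).pd _)
  have hbound : ∀ i k, ‖emb V fun z => pd (phaseDir i) (phasePot V) z * pd (phaseDir k) φ.1 z
      - pd (phaseDir i) (pd (phaseDir k) φ.1) z‖ ≤ √B * n := by
    intro i k
    have hk := φ.2.pd (phaseDir k)
    have i1 : Integrable (fun z => pd (phaseDir i) (pd (phaseDir k) φ.1) z ^ 2) (phaseMeas V) :=
      hG.integrable (hk.pd _).sq
    have i2 : Integrable (fun z => pd (phaseDir k) φ.1 z * pd (phaseDir k) φ.1 z) (phaseMeas V) :=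
      hG.integrable (hk.mul_left hk.1)
    have i3 : Integrable (fun z => pd (phaseDir i) (pd (phaseDir k) φ.1) z ^ 2
        + pd (phaseDir i) (pd (phaseDir i) (phasePot V)) z * pd (phaseDir k) φ.1 z ^ 2)
        (phaseMeas V) := hG.integrable ((hk.pd _).sq.add
          (hk.sq.mul_left (contDiff_pd (contDiff_pd hW _) _)))
    have h1 : ∫ z, pd (phaseDir i) (pd (phaseDir k) φ.1) z ^ 2 ∂(phaseMeas V) ≤
        ∑ i, ∑ k, ∫ z, pd (phaseDir i) (pd (phaseDir k) φ.1) z ^ 2 ∂(phaseMeas V) := by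
      refine le_trans ?_ (Finset.single_le_sum (f := fun i => ∑ k, ∫ z,
        pd (phaseDir i) (pd (phaseDir k) φ.1) z ^ 2 ∂(phaseMeas V)) (fun i _ =>
        Finset.sum_nonneg fun k _ => integral_nonneg fun z => sq_nonneg _) (Finset.mem_univ i))
      exact Finset.single_le_sum (f := fun k => ∫ z,
        pd (phaseDir i) (pd (phaseDir k) φ.1) z ^ 2 ∂(phaseMeas V)) (fun k _ =>
        integral_nonneg fun z => sq_nonneg _) (Finset.mem_univ k)
    have h2 : ∫ z, pd (phaseDir k) φ.1 z * pd (phaseDir k) φ.1 z ∂(phaseMeas V) ≤ D := by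
      rw [hDeq]
      exact Finset.single_le_sum (f := fun i => ∫ z, pd (phaseDir i) φ.1 z * pd (phaseDir i) φ.1 z
        ∂(phaseMeas V)) (fun i _ => integral_nonneg fun z => mul_self_nonneg _) (Finset.mem_univ k)
    have h3 : ‖emb V fun z => pd (phaseDir i) (phasePot V) z * pd (phaseDir k) φ.1 z
        - pd (phaseDir i) (pd (phaseDir k) φ.1) z‖ ^ 2 ≤ B * n ^ 2 := by
      rw [norm_emb_sq hV ((hadj i k).sqInt hV), hG.integral_adjoint_sq _ hk]
      calc _ ≤ ∫ z, (pd (phaseDir i) (pd (phaseDir k) φ.1) z ^ 2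
            + (C + 1) * (pd (phaseDir k) φ.1 z * pd (phaseDir k) φ.1 z)) ∂(phaseMeas V) := by
            refine integral_mono i3 (i1.add (i2.const_mul _)) fun z => ?_
            have h4 := (le_abs_self _).trans (abs_pd_pd_phasePot_le hV.smooth hC0 hC i i z)
            have h5 := mul_le_mul_of_nonneg_right h4 (mul_self_nonneg (pd (phaseDir k) φ.1 z))
            simp only [sq] at h5 ⊢
            linarith
        _ ≤ (L + (C + 1) * (d + d) * D) + (C + 1) * D := by
            rw [integral_add i1 (i2.const_mul _), integral_const_mul]
            gcongr
            exact h1.trans hH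
        _ ≤ B * (2 * γ * D + γ ^ 2 * L) := by
            have h6 : B * (2 * γ * D + γ ^ 2 * L) = L + (C + 1) * (2 * d + 1) * D +
                (2 * γ⁻¹ * D + (C + 1) * (2 * d + 1) * D + (C + 1) * (2 * d + 1) * γ * L) := by
              rw [hB]; field_simp; ring
            rw [h6]
            have : 0 ≤ 2 * γ⁻¹ * D + (C + 1) * (2 * d + 1) * D + (C + 1) * (2 * d + 1) * γ * L := by
              positivity
            linarith
        _ ≤ B * n ^ 2 := by gcongr
    have h7 := Real.le_sqrt_of_sq_le h3
    rwa [Real.sqrt_mul (by positivity), Real.sqrt_sq (norm_nonneg _)] at h7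
  have hT : transportLin hV φ = ∑ j : Fin d,
      ((emb V fun z => pd (phaseDir (Sum.inl j)) (phasePot V) z * pd (phaseDir (Sum.inr j)) φ.1 z
        - pd (phaseDir (Sum.inl j)) (pd (phaseDir (Sum.inr j)) φ.1) z) -
      emb V fun z => pd (phaseDir (Sum.inr j)) (phasePot V) z * pd (phaseDir (Sum.inl j)) φ.1 z
        - pd (phaseDir (Sum.inr j)) (pd (phaseDir (Sum.inl j)) φ.1) z) := by
    have h1 : ∀ (s : Finset (Fin d)) (u : Fin d → E d × E d → ℝ), (∀ j, IsTest (u j)) →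
        emb V (fun z => ∑ j ∈ s, u j z) = ∑ j ∈ s, emb V (u j) := by
      intro s u hu
      classical
      induction s using Finset.induction_on with
      | empty => simpa using emb_smul hV (sqInt_one hV) (0 : ℝ)
      | insert j s hj ih =>
        simp_rw [Finset.sum_insert hj]
        rw [emb_add hV ((hu j).sqInt hV) ((IsTest.sum s hu).sqInt hV), ih]
    simp_rw [← emb_sub hV ((hadj _ _).sqInt hV) ((hadj _ _).sqInt hV)]
    rw [← h1 _ _ fun j => (hadj _ _).sub (hadj _ _), transportLin_apply]
    congr 1
    ext z
    rw [transport, neg_add_eq_sub, ← Finset.sum_sub_distrib]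
    refine Finset.sum_congr rfl fun j _ => ?_
    rw [pd_inl_phasePot hV.smooth, pd_inr_phasePot hV.smooth,
      pd_comm φ.2.1 (phaseDir (Sum.inl j)) (phaseDir (Sum.inr j))]
    ring
  rw [hT, Finset.sum_mul]
  refine (norm_sum_le _ _).trans (Finset.sum_le_sum fun j _ => (norm_sub_le _ _).trans ?_)
  rw [add_mul]
  exact add_le_add (hbound _ _) (hbound _ _)

end TransportBounds

/-! ### Existence of solutions -/

section ClosedRange

variable {H : Type*} [NormedAddCommGroup H] [InnerProductSpace ℝ H] [CompleteSpace H]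

/-- For a closed dissipative operator the range of `l - T` is closed, so it is everything once it is
dense. -/
theorem exists_sub_eq_of_dense {G : Submodule ℝ (H × H)} (hGc : IsClosed (G : Set (H × H)))
    (hG : ∀ p ∈ G, ⟪p.2, p.1⟫ ≤ 0) {l : ℝ} (hl : 0 < l)
    (hd : Dense {g | ∃ p ∈ G, l • p.1 - p.2 = g}) (g : H) : ∃ p ∈ G, l • p.1 - p.2 = g := by
  let Λ : G →ₗ[ℝ] H := (l • LinearMap.fst ℝ H H - LinearMap.snd ℝ H H).comp G.subtype
  have hΛ : ∀ p : G, Λ p = l • p.1.1 - p.1.2 := fun p => by simp [Λ]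
  have hΛc : Continuous Λ := by
    have : (Λ : G → H) = fun p => l • p.1.1 - p.1.2 := funext hΛ
    rw [this]; fun_prop
  have h1 : ∀ p : G, l * ‖p.1.1‖ ≤ ‖Λ p‖ := fun p => by
    have h2 : l * ‖p.1.1‖ ^ 2 ≤ ⟪Λ p, p.1.1⟫ := by
      rw [hΛ, inner_sub_left, real_inner_smul_left, real_inner_self_eq_norm_sq]
      linarith [hG p.1 p.2]
    have h3 := real_inner_le_norm (Λ p) p.1.1
    rcases (norm_nonneg p.1.1).eq_or_lt with h | h
    · rw [← h, mul_zero]; exact norm_nonneg _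
    · refine le_of_mul_le_mul_right ?_ h
      linarith [sq ‖p.1.1‖]
  have h2 : ∀ p : G, ‖p.1.2‖ ≤ 2 * ‖Λ p‖ := fun p => by
    have h3 : p.1.2 = l • p.1.1 - Λ p := by rw [hΛ]; abel
    have h4 := norm_sub_le (l • p.1.1) (Λ p)
    rw [← h3, norm_smul, Real.norm_of_nonneg hl.le] at h4
    linarith [h1 p]
  have h3 : ∀ p : G, ‖p‖ ≤ (max l⁻¹ 2).toNNReal * ‖Λ p‖ := fun p => by
    rw [Real.coe_toNNReal _ (by positivity)]
    have h4 : ‖p.1.1‖ ≤ l⁻¹ * ‖Λ p‖ := by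
      rw [inv_mul_eq_div, le_div_iff₀ hl, mul_comm]; exact h1 p
    refine max_le (h4.trans ?_) ((h2 p).trans ?_)
    · gcongr; exact le_max_left _ _
    · gcongr; exact le_max_right _ _
  have : CompleteSpace G := hGc.completeSpace_coe
  have h4 : IsClosed (Set.range Λ) :=
    (AddMonoidHomClass.antilipschitz_of_bound Λ h3).isClosed_range
      (uniformContinuous_addMonoidHom_of_continuous hΛc)
  have h5 : Set.range Λ = {g | ∃ p ∈ G, l • p.1 - p.2 = g} := by
    ext g
    constructor
    · rintro ⟨p, rfl⟩; exact ⟨p.1, p.2, (hΛ p).symm⟩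
    · rintro ⟨p, hp, rfl⟩; exact ⟨⟨p, hp⟩, hΛ _⟩
  rw [h5] at h4
  have := h4.closure_eq ▸ hd.closure_eq ▸ Set.mem_univ g
  exact this

end ClosedRange

section KineticGraph

variable {d : ℕ} {V : E d → ℝ}

/-- The kinetic operator `X + γ (Π - 1)` on test functions, in terms of `h = f / M`. -/
def kineticLin (hV : IsConfining V) (γ : ℝ) : testSpace ℝ d →ₗ[ℝ] B2 ℝ V :=
  transportLin hV + γ • ((proj hV).toLinearMap.comp (coreEmb hV) - coreEmb hV)

theorem kineticLin_apply (hV : IsConfining V) (γ : ℝ) (φ : testSpace ℝ d) :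
    kineticLin hV γ φ =
      transportLin hV φ + γ • (proj hV (coreEmb hV φ) - coreEmb hV φ) := rfl

/-- The graph of the closure of the kinetic operator. -/
def kineticGraph (hV : IsConfining V) (γ : ℝ) : Submodule ℝ (B2 ℝ V × B2 ℝ V) :=
  (LinearMap.range ((coreEmb hV).prod (kineticLin hV γ))).topologicalClosure

theorem kineticGraph_eq_closure (hV : IsConfining V) (γ : ℝ) :
    (kineticGraph hV γ : Set (B2 ℝ V × B2 ℝ V)) =
      closure (Set.range fun φ => (coreEmb hV φ, kineticLin hV γ φ)) := by
  rw [kineticGraph, Submodule.topologicalClosure_coe, LinearMap.coe_range]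
  rfl

theorem kineticGraph_induction (hV : IsConfining V) (γ : ℝ) {S : Set (B2 ℝ V × B2 ℝ V)}
    (hS : IsClosed S) (h : ∀ φ, (coreEmb hV φ, kineticLin hV γ φ) ∈ S) :
    ∀ p ∈ kineticGraph hV γ, p ∈ S := by
  intro p hp
  have hp' : p ∈ (kineticGraph hV γ : Set (B2 ℝ V × B2 ℝ V)) := hp
  rw [kineticGraph_eq_closure] at hp'
  refine closure_minimal ?_ hS hp'
  rintro _ ⟨φ, rfl⟩
  exact h φ

theorem mem_kineticGraph (hV : IsConfining V) (γ : ℝ) (φ : testSpace ℝ d) :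
    (coreEmb hV φ, kineticLin hV γ φ) ∈ kineticGraph hV γ :=
  Submodule.le_topologicalClosure _ ⟨φ, rfl⟩

theorem kineticLin_eq_emb (hV : IsConfining V) (γ : ℝ) (φ : testSpace ℝ d) :
    kineticLin hV γ φ = emb V fun z => transport V φ z + γ • (vavg φ z.1 - φ.1 z) := by
  have h1 := φ.2.vavg.sqInt_fst hV
  have h2 := φ.2.sqInt hV
  rw [kineticLin_apply, proj_coreEmb, coreEmb_apply, transportLin_apply, ← emb_sub hV h1 h2,
    ← emb_smul hV (h1.sub h2), ← emb_add hV ((φ.2.transport hV.smooth).sqInt hV)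
      ((h1.sub h2).const_smul γ)]

theorem kineticGraph_eq (hV : IsConfining V) (γ : ℝ) :
    (kineticGraph hV γ : Set (B2 ℝ V × B2 ℝ V)) = closureGraph V (kinetic V γ) := by
  rw [closureGraph_eq hV (A := fun φ z => transport V φ z + γ • (vavg φ z.1 - φ z))
    (fun φ hφ => ((hφ.transport hV.smooth).sqInt hV).add
      (((hφ.vavg.sqInt_fst hV).sub (hφ.sqInt hV)).const_smul γ))
    (fun φ hφ => kinetic_maxwellian_smul hV γ hφ), kineticGraph_eq_closure]
  simp_rw [kineticLin_eq_emb, coreEmb_apply]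

theorem isSolution_iff (hV : IsConfining V) (γ : ℝ) (f₀ : B2 ℝ V) (f : C(ℝ≥0, B2 ℝ V)) :
    IsSolution V γ f₀ f ↔ IsMild (kineticGraph hV γ) f₀ f := by
  rw [IsSolution, IsMild, ← kineticGraph_eq hV γ]
  rfl

theorem norm_proj_le (hV : IsConfining V) (g : B2 ℝ V) : ‖proj hV g‖ ≤ ‖g‖ := by
  have := (averageLin hV).norm_extendOfNorm_apply_le (coreEmb_denseRange hV) 1
    (norm_averageLin_le hV) g
  rwa [one_mul] at this

theorem kineticGraph_dissipative (hV : IsConfining V) {γ : ℝ} (hγ : 0 ≤ γ) :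
    ∀ p ∈ kineticGraph hV γ, ⟪p.2, p.1⟫ ≤ 0 := by
  refine kineticGraph_induction hV γ (S := {p | ⟪p.2, p.1⟫ ≤ 0})
    (isClosed_le (by fun_prop) continuous_const) fun φ => ?_
  simp only [Set.mem_ofPred_eq]
  have h1 := real_inner_le_norm (proj hV (coreEmb hV φ)) (coreEmb hV φ)
  have h2 := mul_le_mul_of_nonneg_right (norm_proj_le hV (coreEmb hV φ)) (norm_nonneg (coreEmb hV φ))
  rw [kineticLin_apply, inner_add_left, inner_transportLin, zero_add, real_inner_smul_left,
    inner_sub_left, real_inner_self_eq_norm_sq]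
  refine mul_nonpos_of_nonneg_of_nonpos hγ ?_
  linarith [sq ‖coreEmb hV φ‖]

/-- The kinetic equation is solvable in `B²`. The reference operator is essentially self-adjoint
on the test functions, and serves to show that the range of `l - T` is dense. -/
theorem exists_isMild_kineticGraph (hV : IsConfining V) {γ α : ℝ} (hγ : 0 < γ) {C : ℝ}
    (hC0 : 0 ≤ C) (hC : ∀ x, ‖iteratedFDeriv ℝ 2 V x‖ ≤ C) (hgap : HasSpectralGap V γ α)
    (f₀ : B2 ℝ V) : ∃ f : C(ℝ≥0, B2 ℝ V), IsMild (kineticGraph hV γ) f₀ f := by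
  obtain ⟨hN, -⟩ := hgap.core hV hγ
  have hE := coreEstimates hV hγ hC0 hC
  obtain ⟨R, hR, hRN⟩ := exists_isResolvent hN hE.symm hE.norm_sq_le
  obtain ⟨c, hc⟩ := exists_norm_transportLin_le hV hγ hC0 hC
  have hcl : IsClosed (kineticGraph hV γ : Set (B2 ℝ V × B2 ℝ V)) :=
    Submodule.isClosed_topologicalClosure _
  have hdis := kineticGraph_dissipative hV hγ.le
  have hl₀ : 0 ≤ 1 + d * C := by positivity
  refine exists_isMild hcl hdis ?_ hl₀ (fun l hl g => ?_) f₀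
  · refine (coreEmb_denseRange hV).mono ?_
    rintro _ ⟨φ, rfl⟩
    exact ⟨_, mem_kineticGraph hV γ φ⟩
  · refine exists_sub_eq_of_dense hcl hdis (hl₀.trans_lt hl) ?_ g
    have := denseRange_sub_generator hR hRN hN (coreEmb_denseRange hV) (proj_symm hV)
      (proj_idem hV) (resolvent_commute hR hRN hN (proj_symm hV) hE.proj_commute)
      (X := transportLin hV) hγ.le hc (inner_transportLin hV) (c := 1 + d * C) (fun φ => ?_) hl₀ hl
    · refine this.mono ?_
      rintro _ ⟨φ, rfl⟩
      exact ⟨_, mem_kineticGraph hV γ φ, rfl⟩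
    · rw [LinearMap.add_apply, LinearMap.smul_apply, add_sub_cancel_left, real_inner_smul_right,
        real_inner_smul_left, mul_left_comm]
      exact mul_le_mul_of_nonneg_left (inner_transportLin_laplaceLin_le hV hC0 hC φ) hγ.le

theorem subset_closure_kinetic (hV : IsConfining V) (γ : ℝ) :
    (kineticGraph hV γ : Set (B2 ℝ V × B2 ℝ V)) ⊆ closure (Set.range fun φ =>
      (coreEmb hV φ, transportLin hV φ + γ • (proj hV (coreEmb hV φ) - coreEmb hV φ))) :=
  (kineticGraph_eq_closure hV γ).subset

end KineticGraph

/-! ### Exponential decay and positivity -/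

section Decay

variable {d : ℕ} {V : E d → ℝ}

theorem sqInt_coord (hV : IsConfining V) (j : Fin d) : SqInt V fun z : E d × E d => z.2 j :=
  SqInt.of_le hV (contDiff_phase_coord j).continuous (C := 1) fun z => by
    nlinarith [abs_coord_le z.2 j, sq_nonneg (‖z.2‖ - 1)]

theorem integral_phase_snd (hV : IsConfining V) {p : E d → ℝ}
    (hp : SqInt V fun z : E d × E d => p z.2) :
    ∫ z, p z.2 ∂(phaseMeas V) = ∫ v, p v ∂(gaussMeas d) := by
  have := isProbabilityMeasure_rhoMeas hV
  have h1 := hp.integrable_mul (sqInt_one hV)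
  simp only [mul_one] at h1
  rw [← integral_vavg hV h1]
  simp [vavg]

/-- A velocity coordinate is an eigenvector of the weighted Laplacian, for the eigenvalue `1`. -/
theorem inner_laplaceLin_coord (hV : IsConfining V) (j : Fin d) (φ : testSpace ℝ d) :
    ⟪laplaceLin ℝ hV φ, emb V fun z => z.2 j⟫ = ⟪coreEmb hV φ, emb V fun z => z.2 j⟫ := by
  have hG := isGibbs_maxwellian hV
  have h1 : ∀ i : Fin d ⊕ Fin d, ∀ z, pd (phaseDir i) (fun z : E d × E d => z.2 j) z =
      if i = Sum.inr j then 1 else 0 := by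
    intro i z
    rw [pd_comp_snd (contDiff_coord j), pd_coord]
    rcases i with i | i
    · simp [phaseDir]
    · simp [phaseDir, ebasis, eq_comm]
  have h2 := hG.integral_pd (φ.2.1.of_le (by simp)) φ.2.2 (phaseDir (Sum.inr j))
  rw [inner_laplaceLin hV φ (contDiff_phase_coord j) (sqInt_coord hV j), coreEmb_apply,
    inner_emb_real hV (φ.2.sqInt hV) (sqInt_coord hV j)]
  simp only [h1]
  rw [Finset.sum_eq_single (Sum.inr j) (fun i _ hi => by simp [hi]) (by simp)]
  simp only [if_true, mul_one]
  rw [h2, pd_inr_phasePot hV.smooth]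
  simp only [smul_eq_mul, mul_comm]

/-- Exponential convergence to equilibrium in `B²`. -/
theorem distSq_le (hV : IsConfining V) {γ α : ℝ} (hγ : 0 < γ) {C : ℝ} (hC0 : 0 ≤ C)
    (hC : ∀ x, ‖iteratedFDeriv ℝ 2 V x‖ ≤ C) (hgap : HasSpectralGap V γ α) {f₀ : B2 ℝ V}
    {f : C(ℝ≥0, B2 ℝ V)} (hf : IsMild (kineticGraph hV γ) f₀ f) (t : ℝ≥0) :
    distSq (equil V) (f t) ≤
      3 * Real.exp (-(α ^ 2 / decayConstant γ γ⁻¹ (transportBound d γ C)) * t)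
        * distSq (equil V) f₀ := by
  have hα := hgap.1
  obtain ⟨hN, hg⟩ := hgap.core hV hγ
  have hE := coreEstimates hV hγ hC0 hC
  have ha : 0 ≤ γ⁻¹ := by positivity
  have hb : 0 ≤ transportBound d γ C := Real.sqrt_nonneg _
  obtain ⟨R, K, hRN, hH⟩ := hE.exists_isHypocoercive ha hb hN hα fun φ => by
    simpa only [LinearMap.add_apply, LinearMap.smul_apply, add_sub_cancel_left] using hg φ
  rcases Nat.eq_zero_or_pos d with h0 | h0
  · -- without velocities the space is the line of the equilibria
    subst h0
    have hR : ∀ g, R g = g := fun g => by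
      refine (coreEmb_denseRange hV).induction_on (p := fun g => R g = g) g
        (isClosed_eq (by fun_prop) (by fun_prop)) fun φ => ?_
      have h1 : laplaceLin ℝ hV φ = 0 := by
        rw [laplaceLin_apply]
        have h2 := emb_smul hV (sqInt_one hV) (0 : ℝ)
        simp only [zero_smul] at h2
        rw [← h2]
        congr 1
      have h2 := hRN φ
      rwa [LinearMap.add_apply, LinearMap.smul_apply, h1, smul_zero, add_zero] at h2
    have h1 : ∀ g : B2 ℝ V, distSq (equil V) g = 0 := fun g => by
      have h2 := hH.gap g
      rw [hR, sub_self, inner_zero_left, mul_zero] at h2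
      have h3 := hH.distSq_eq g
      have h4 := hH.distSq_proj_nonneg g
      have h5 := sq_nonneg ‖g - proj hV g‖
      refine le_antisymm ?_ (by rw [h3]; linarith)
      unfold distSq
      exact nonpos_of_mul_nonpos_right h2 hα
    rw [h1, h1]; simp
  · -- a velocity coordinate is an eigenvector of the reference operator for the eigenvalue `γ`
    have hαγ : α ≤ γ := by
      set g : B2 ℝ V := emb V fun z => z.2 ⟨0, h0⟩ with hgdef
      have hs := sqInt_coord hV ⟨0, h0⟩
      have h1 : R g = (1 + γ)⁻¹ • g := by
        refine hH.resolvent.apply_eq_of_inner hRN hN fun φ => ?_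
        rw [LinearMap.add_apply, LinearMap.smul_apply, inner_add_left, real_inner_smul_left,
          real_inner_smul_right, real_inner_smul_right, hgdef, inner_laplaceLin_coord]
        field_simp
      have h2 : ‖g‖ ^ 2 = 1 := by
        rw [norm_emb_sq hV hs]
        have h3 : SqInt V fun z : E d × E d => z.2 ⟨0, h0⟩ ^ 2 :=
          SqInt.of_le hV (by have := hs.1; fun_prop) (C := 1) fun z => by
            rw [abs_pow]
            nlinarith [abs_coord_le z.2 ⟨0, h0⟩, abs_nonneg (z.2 ⟨0, h0⟩)]
        rw [integral_phase_snd hV (p := fun v => v ⟨0, h0⟩ ^ 2) h3]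
        have := integral_coord_mul_coord (d := d) ⟨0, h0⟩ ⟨0, h0⟩
        simpa [sq] using this
      have h3 : ⟪g, equil V⟫ = 0 := by
        rw [equil, inner_emb_real hV hs (sqInt_one hV)]
        simp only [mul_one]
        rw [integral_phase_snd hV (p := fun v => v ⟨0, h0⟩) hs, integral_coord]
      have h4 := hH.gap g
      rw [h1, inner_sub_left, real_inner_smul_left, real_inner_self_eq_norm_sq, h2, h3] at h4
      have h5 : (1 + α) * (1 - (1 + γ)⁻¹ * 1) = (1 + α) * γ / (1 + γ) := by field_simp; ring
      rw [h5, le_div_iff₀ (by linarith)] at h4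
      linarith
    exact hH.decay hγ ha hb hα hαγ (subset_closure_kinetic hV γ) hf t

end Decay

section PositivePart

variable {H : Type*} [NormedAddCommGroup H] [InnerProductSpace ℝ H]

/-- The squared norm of the positive part is differentiable. The hypotheses say that the map `p`
is a contraction and that `p (y + k)` is dominated by `p y + k`. -/
theorem hasFDerivAt_norm_sq_posPart {p : H → H} (h1 : ∀ y z, ‖p y - p z‖ ≤ ‖y - z‖)
    (h2 : ∀ y k, ‖p (y + k)‖ ≤ ‖p y + k‖) (y : H) :
    HasFDerivAt (fun y => ‖p y‖ ^ 2) ((2 : ℝ) • innerSL ℝ (p y)) y := by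
  rw [hasFDerivAt_iff_isLittleO_nhds_zero]
  have hO : (fun k => ‖p (y + k)‖ ^ 2 - ‖p y‖ ^ 2 - ((2 : ℝ) • innerSL ℝ (p y)) k) =O[𝓝 0]
      fun k => ‖k‖ ^ 2 := by
    refine Asymptotics.IsBigO.of_bound 3 (Eventually.of_forall fun k => ?_)
    have h3 : ‖p (y + k)‖ ^ 2 ≤ ‖p y‖ ^ 2 + 2 * ⟪p y, k⟫ + ‖k‖ ^ 2 := by
      rw [← norm_add_sq_real]; gcongr; exact h2 y k
    have h4 : ‖p y‖ ^ 2 ≤ ‖p (y + k)‖ ^ 2 - 2 * ⟪p (y + k), k⟫ + ‖k‖ ^ 2 := by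
      rw [← norm_sub_sq_real]; gcongr
      have := h2 (y + k) (-k)
      rwa [add_neg_cancel_right, ← sub_eq_add_neg] at this
    have h5 : |⟪p (y + k) - p y, k⟫| ≤ ‖k‖ ^ 2 := by
      refine (abs_real_inner_le_norm _ _).trans ?_
      have := h1 (y + k) y
      rw [add_sub_cancel_left] at this
      rw [sq]; gcongr
    rw [inner_sub_left] at h5
    have h6 := abs_le.1 h5
    simp only [smul_apply, innerSL_apply_apply, smul_eq_mul]
    rw [Real.norm_eq_abs, Real.norm_of_nonneg (by positivity), abs_le]
    constructor <;> linarith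
  refine hO.trans_isLittleO ?_
  have : (fun k : H => ‖k‖ ^ 2) =o[𝓝 0] fun k => ‖k‖ ^ 1 :=
    (Asymptotics.isLittleO_pow_pow one_lt_two).comp_tendsto
      (by simpa using (continuous_norm (E := H)).tendsto 0)
  exact (this.congr_right fun k => pow_one _).of_norm_right

end PositivePart

section Positivity

variable {d : ℕ} {V : E d → ℝ}

theorem hasDerivAt_max_sq (t : ℝ) : HasDerivAt (fun t : ℝ => max t 0 ^ 2) (2 * max t 0) t := by
  have := (hasFDerivAt_norm_sq_posPart (H := ℝ) (p := fun t => max t 0)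
    (fun y z => by simpa [Real.norm_eq_abs] using abs_max_sub_max_le_abs y z 0) (fun y k => by
      rw [Real.norm_of_nonneg (le_max_right _ _), Real.norm_eq_abs]
      refine max_le (le_trans ?_ (le_abs_self _)) (abs_nonneg _)
      linarith [le_max_left y 0]) t).hasDerivAt
  simp only [Real.norm_eq_abs, sq_abs] at this
  refine this.congr_deriv ?_
  simp

theorem contDiff_max_sq : ContDiff ℝ 1 fun t : ℝ => max t 0 ^ 2 := by
  rw [contDiff_one_iff_deriv]
  refine ⟨fun t => (hasDerivAt_max_sq t).differentiableAt, ?_⟩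
  rw [show deriv (fun t : ℝ => max t 0 ^ 2) = fun t => 2 * max t 0 from
    funext fun t => (hasDerivAt_max_sq t).deriv]
  fun_prop

theorem sqInt_max (hV : IsConfining V) {φ : E d × E d → ℝ} (hφ : IsTest φ) :
    SqInt V fun z => max (φ z) 0 := by
  obtain ⟨C, hC0, hC⟩ := hφ.exists_bound
  refine SqInt.of_le hV (hφ.1.continuous.max continuous_const) (C := C) fun z => ?_
  have h1 : |max (φ z) 0| ≤ |φ z| := by
    rw [abs_of_nonneg (le_max_right _ _)]; exact max_le (le_abs_self _) (abs_nonneg _)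
  nlinarith [hC z, mul_nonneg hC0 (sq_nonneg ‖z.2‖)]

theorem posPart_emb (hV : IsConfining V) {φ : E d × E d → ℝ} (hφ : IsTest φ) :
    Lp.posPart (emb V φ) = emb V fun z => max (φ z) 0 := by
  refine emb_congr_ae hV (sqInt_max hV hφ) ?_
  filter_upwards [Lp.coeFn_posPart (emb V φ), (hφ.sqInt hV).coeFn_emb hV] with z h1 h2
  have := (maxwellian_pos hV z).le
  rw [h1, h2, smul_eq_mul, smul_eq_mul, mul_max_of_nonneg _ _ this, mul_zero]

/-- The transport is a derivation, so this is half the integral of the transport of `(φ⁺)²`. -/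
theorem inner_posPart_transport (hV : IsConfining V) (φ : testSpace ℝ d) :
    ⟪Lp.posPart (coreEmb hV φ), transportLin hV φ⟫ = 0 := by
  have hχ : ContDiff ℝ 1 fun z => max (φ.1 z) 0 ^ 2 :=
    contDiff_max_sq.comp (φ.2.1.of_le (by simp))
  have hc : HasCompactSupport fun z => max (φ.1 z) 0 ^ 2 :=
    φ.2.2.comp_left (g := fun t : ℝ => max t 0 ^ 2) (by simp)
  have h1 := integral_transport hV hχ hc
  have h2 : ∀ e z, pd e (fun z => max (φ.1 z) 0 ^ 2) z = 2 * max (φ.1 z) 0 * pd e φ.1 z := by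
    intro e z
    rw [pd, show (fun z => max (φ.1 z) 0 ^ 2) = (fun t : ℝ => max t 0 ^ 2) ∘ φ.1 from rfl,
      ((hasDerivAt_max_sq (φ.1 z)).comp_hasFDerivAt z (φ.2.1.hasFDerivAt' z)).fderiv]
    rfl
  have h3 : ∀ z, transport V (fun z => max (φ.1 z) 0 ^ 2) z =
      2 * (max (φ.1 z) 0 * transport V φ.1 z) := by
    intro z
    simp only [transport, h2, mul_add, mul_neg, Finset.mul_sum]
    congr 1
    · congr 1; exact Finset.sum_congr rfl fun j _ => by ring
    · exact Finset.sum_congr rfl fun j _ => by ring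
  simp only [h3, integral_const_mul] at h1
  rw [coreEmb_apply, posPart_emb hV φ.2, transportLin_apply,
    inner_emb_real hV (sqInt_max hV φ.2) ((φ.2.transport hV.smooth).sqInt hV)]
  linarith

/-- The velocity average is at most the average of the positive part, and Jensen's inequality
concludes. -/
theorem inner_posPart_collision (hV : IsConfining V) (φ : testSpace ℝ d) :
    ⟪Lp.posPart (coreEmb hV φ), proj hV (coreEmb hV φ) - coreEmb hV φ⟫ ≤ 0 := by
  have hs := (φ.2.vavg.sqInt_fst hV).sub (φ.2.sqInt hV)
  have hm := sqInt_max hV φ.2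
  rw [proj_coreEmb, coreEmb_apply, ← emb_sub hV (φ.2.vavg.sqInt_fst hV) (φ.2.sqInt hV),
    posPart_emb hV φ.2, inner_emb_real hV hm hs, ← integral_vavg hV (hm.integrable_mul hs)]
  refine integral_nonpos fun x => ?_
  -- at each position, the inequality is one for the Gaussian average of `u`
  set u : E d → ℝ := fun v => φ.1 (x, v) with hu
  have hut : IsTest u := φ.2.slice x
  have hi := isGibbs_muInf.integrable hut
  have huc : Continuous fun v => max (u v) 0 := hut.1.continuous.max continuous_const
  have hus : HasCompactSupport fun v => max (u v) 0 :=
    hut.2.comp_left (g := fun t : ℝ => max t 0) (by simp)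
  have hloc := (isGibbs_muInf (d := d)).isLocallyFiniteMeasure
  have i1 : Integrable (fun v => max (u v) 0) (gaussMeas d) :=
    huc.integrable_of_hasCompactSupport hus
  have i2 : Integrable (fun v => max (u v) 0 * max (u v) 0) (gaussMeas d) :=
    (huc.mul huc).integrable_of_hasCompactSupport hus.mul_left
  set P := ∫ v, max (u v) 0 ∂(gaussMeas d) with hP
  have hP0 : 0 ≤ P := integral_nonneg fun v => le_max_right _ _
  have hle : vavg φ.1 x ≤ P := integral_mono hi i1 fun v => le_max_left _ _
  have h1 : vavg (fun z => max (φ.1 z) 0 * (vavg φ.1 z.1 - φ.1 z)) x =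
      P * vavg φ.1 x - ∫ v, max (u v) 0 * max (u v) 0 ∂(gaussMeas d) := by
    rw [hP, ← integral_mul_const, ← integral_sub (i1.mul_const _) i2]
    refine integral_congr_ae (Eventually.of_forall fun v => ?_)
    simp only [hu]
    rcases le_total (φ.1 (x, v)) 0 with h | h
    · simp [max_eq_right h]
    · simp only [max_eq_left h]; ring
  have h2 : 0 ≤ ∫ v, (max (u v) 0 - P) ^ 2 ∂(gaussMeas d) := integral_nonneg fun v => sq_nonneg _
  have h3 : ∫ v, (max (u v) 0 - P) ^ 2 ∂(gaussMeas d) =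
      ∫ v, max (u v) 0 * max (u v) 0 ∂(gaussMeas d) - P * P := by
    have i3 : Integrable (fun v => max (u v) 0 * (2 * P)) (gaussMeas d) := i1.mul_const _
    have h4 : ∀ v, (max (u v) 0 - P) ^ 2 =
      (max (u v) 0 * max (u v) 0 - max (u v) 0 * (2 * P)) + P * P := fun v => by ring
    simp_rw [h4]
    have i4 : Integrable (fun v => max (u v) 0 * max (u v) 0 - max (u v) 0 * (2 * P))
        (gaussMeas d) := i2.sub i3
    rw [integral_add i4 (integrable_const _), integral_sub i2 i3, integral_mul_const, ← hP]
    simp; ring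
  rw [Pi.zero_apply, h1]
  nlinarith [mul_le_mul_of_nonneg_left hle hP0]

/-- Solutions with nonnegative data are nonnegative: the squared norm of the negative part does
not increase. -/
theorem IsMild.nonneg (hV : IsConfining V) {γ : ℝ} (hγ : 0 ≤ γ) {f₀ : B2 ℝ V}
    {f : C(ℝ≥0, B2 ℝ V)} (hf : IsMild (kineticGraph hV γ) f₀ f) (h0 : ∀ᵐ z ∂(weight V), 0 ≤ f₀ z)
    (t : ℝ≥0) : ∀ᵐ z ∂(weight V), 0 ≤ f t z := by
  have hd : ∀ y : B2 ℝ V, HasFDerivAt (fun y : B2 ℝ V => ‖Lp.posPart y‖ ^ 2)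
      ((2 : ℝ) • innerSL ℝ (Lp.posPart y)) y := by
    refine hasFDerivAt_norm_sq_posPart (fun y z => ?_) fun y k => ?_
    · refine Lp.norm_le_norm_of_ae_le ?_
      filter_upwards [Lp.coeFn_posPart y, Lp.coeFn_posPart z, Lp.coeFn_sub y z,
        Lp.coeFn_sub (Lp.posPart y) (Lp.posPart z)] with x h1 h2 h3 h4
      rw [h4, h3, Pi.sub_apply, Pi.sub_apply, h1, h2, Real.norm_eq_abs, Real.norm_eq_abs]
      exact abs_max_sub_max_le_abs _ _ _
    · refine Lp.norm_le_norm_of_ae_le ?_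
      filter_upwards [Lp.coeFn_posPart y, Lp.coeFn_posPart (y + k), Lp.coeFn_add y k,
        Lp.coeFn_add (Lp.posPart y) k] with x h1 h2 h3 h4
      rw [h4, h2, h3, Pi.add_apply, Pi.add_apply, h1, Real.norm_of_nonneg (le_max_right _ _),
        Real.norm_eq_abs]
      refine max_le (le_trans ?_ (le_abs_self _)) (abs_nonneg _)
      linarith [le_max_left (y x) 0]
  have hdis : ∀ p ∈ kineticGraph hV γ, ⟪Lp.posPart p.1, p.2⟫ ≤ 0 := by
    have hcont : Continuous fun y : B2 ℝ V => Lp.posPart y := Lp.continuous_posPart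
    refine kineticGraph_induction hV γ (S := {p | ⟪Lp.posPart p.1, p.2⟫ ≤ 0})
      (isClosed_le ((hcont.comp continuous_fst).inner continuous_snd) continuous_const) fun φ => ?_
    simp only [Set.mem_ofPred_eq]
    rw [kineticLin_apply, inner_add_right, inner_posPart_transport, zero_add,
      real_inner_smul_right]
    exact mul_nonpos_of_nonneg_of_nonpos hγ (inner_posPart_collision hV φ)
  have hneg : ∀ y : B2 ℝ V, HasFDerivAt (fun y : B2 ℝ V => ‖Lp.posPart (-y)‖ ^ 2)
      (((2 : ℝ) • innerSL ℝ (Lp.posPart (-y))).comp (-ContinuousLinearMap.id ℝ (B2 ℝ V))) y :=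
    fun y => (hd (-y)).comp y (hasFDerivAt_id y).neg
  have h1 := hf.lyapunov hneg (κ := 0) (fun p hp => by
    have := hdis (-p) (Submodule.neg_mem _ hp)
    simp only [Prod.fst_neg, Prod.snd_neg] at this
    simp only [ContinuousLinearMap.comp_apply, neg_apply, ContinuousLinearMap.id_apply,
      smul_apply, innerSL_apply_apply, smul_eq_mul, neg_zero, zero_mul]
    linarith) t
  have h2 : Lp.posPart (-f₀) = 0 := by
    refine Lp.ext ?_
    filter_upwards [Lp.coeFn_posPart (-f₀), Lp.coeFn_neg f₀, Lp.coeFn_zero ℝ 2 (weight V), h0]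
      with z h2 h3 h4 h5
    rw [h2, h3, h4, Pi.neg_apply, Pi.zero_apply, max_eq_right (by linarith)]
  rw [h2, norm_zero, zero_pow two_ne_zero, mul_zero] at h1
  have h3 : Lp.posPart (-f t) = 0 := by
    have := sq_eq_zero_iff.1 (le_antisymm h1 (sq_nonneg _))
    exact norm_eq_zero.1 this
  filter_upwards [Lp.coeFn_posPart (-f t), Lp.coeFn_neg (f t), Lp.coeFn_zero ℝ 2 (weight V)]
    with z h4 h5 h6
  rw [h3, h6, h5, Pi.neg_apply, Pi.zero_apply] at h4
  linarith [le_max_left (-f t z) 0]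

end Positivity

/-! ### Entropy -/

section Entropy

variable {d : ℕ} {V : E d → ℝ}

/-- Elements of `B²` are integrable, and the pairing with the Maxwellian is the mass. -/
theorem inner_equil (hV : IsConfining V) (g : B2 ℝ V) :
    Integrable g ∧ ⟪g, equil V⟫ = ∫ z, g z := by
  constructor
  · have h1 := L2.integrable_inner (𝕜 := ℝ) g (equil V)
    rw [integrable_weight_iff hV] at h1
    refine h1.congr ?_
    filter_upwards [(ae_weight_iff hV).1 ((sqInt_one hV).coeFn_emb hV)] with z h2
    rw [equil, h2]
    have := (maxwellian_pos hV z).ne'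
    simp [this]
  · rw [equil, inner_emb_right hV g (sqInt_one hV)]
    congr 1; ext z
    have := (maxwellian_pos hV z).ne'
    field_simp

theorem norm_sq_eq (hV : IsConfining V) (g : B2 ℝ V) :
    Integrable (fun z => |g z| ^ 2 * (maxwellian V z)⁻¹) ∧
      ‖g‖ ^ 2 = ∫ z, |g z| ^ 2 * (maxwellian V z)⁻¹ := by
  constructor
  · have h1 := (integrable_weight_iff hV).1 (L2.integrable_inner (𝕜 := ℝ) g g)
    refine h1.congr (Eventually.of_forall fun z => ?_)
    simp [sq, mul_comm]
  · rw [← real_inner_self_eq_norm_sq, L2.inner_def, integral_weight hV]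
    congr 1; ext z
    simp [sq, mul_comm]

theorem norm_eq_b2Norm (hV : IsConfining V) (g : B2 ℝ V) : ‖g‖ = b2Norm V g := by
  rw [b2Norm, ← (norm_sq_eq hV g).2, Real.sqrt_sq (norm_nonneg _)]

theorem norm_sub_equil (hV : IsConfining V) (g : B2 ℝ V) :
    ‖g - equil V‖ = b2Norm V fun z => g z - maxwellian V z := by
  rw [norm_eq_b2Norm hV, b2Norm, b2Norm]
  congr 1
  refine integral_congr_ae ?_
  filter_upwards [(ae_weight_iff hV).1 (Lp.coeFn_sub g (equil V)),
    (ae_weight_iff hV).1 ((sqInt_one hV).coeFn_emb hV)] with z h1 h2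
  rw [h1, Pi.sub_apply, equil, h2, smul_eq_mul, mul_one]

/-- The entropy of a probability density is controlled by its distance to equilibrium. -/
theorem relEntropy_bounds (hV : IsConfining V) {g : B2 ℝ V} (h0 : ∀ᵐ z, 0 ≤ g z)
    (h1 : ⟪g, equil V⟫ = 1) : Integrable (entropyDensity V g) ∧ 0 ≤ relEntropy V g ∧
      relEntropy V g ≤ distSq (equil V) g := by
  have := isProbabilityMeasure_phaseMeas hV
  obtain ⟨hi, hm⟩ := inner_equil hV g
  obtain ⟨hi2, hn⟩ := norm_sq_eq hV g
  have hMi : Integrable (maxwellian V) := by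
    have := (integrable_phaseMeas_iff hV).1 (integrable_const (μ := phaseMeas V) (1 : ℝ))
    simpa using this
  have hM1 : ∫ z, maxwellian V z = 1 := by
    have := integral_phaseMeas hV fun _ => (1 : ℝ)
    simpa using this.symm
  -- `1 - 1 / s ≤ log s ≤ s - 1` at `s = g / M`; both bounds integrate to known quantities
  have hlow : ∀ᵐ z, g z - maxwellian V z ≤ entropyDensity V g z := by
    filter_upwards [h0] with z hz
    have hM := maxwellian_pos hV z
    rw [entropyDensity]
    rcases hz.eq_or_lt with h | h
    · rw [← h]; simp; exact hM.le
    · have h2 := Real.one_sub_inv_le_log_of_pos (div_pos h hM)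
      have h3 := mul_le_mul_of_nonneg_left h2 h.le
      rw [inv_div, mul_sub, mul_div_cancel₀ _ h.ne'] at h3
      linarith
  have hup : ∀ᵐ z, entropyDensity V g z ≤ |g z| ^ 2 * (maxwellian V z)⁻¹ - g z := by
    filter_upwards [h0] with z hz
    have hM := maxwellian_pos hV z
    rw [entropyDensity]
    rcases hz.eq_or_lt with h | h
    · rw [← h]; simp
    · have h3 := mul_le_mul_of_nonneg_left (Real.log_le_sub_one_of_pos (div_pos h hM)) h.le
      refine h3.trans_eq ?_
      rw [sq_abs]; field_simp
  have hmeas : AEStronglyMeasurable (entropyDensity V g) := by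
    have h2 : Measurable g := (Lp.stronglyMeasurable g).measurable
    have h3 : Measurable (maxwellian V) := (continuous_maxwellian hV).measurable
    exact (h2.mul (Real.measurable_log.comp (h2.div h3))).aestronglyMeasurable
  have hint : Integrable (entropyDensity V g) := by
    refine ((hi.sub hMi).norm.add (hi2.sub hi).norm).mono' hmeas ?_
    filter_upwards [hlow, hup] with z h2 h3
    simp only [Pi.add_apply, Pi.sub_apply, Real.norm_eq_abs]
    have h4 := neg_abs_le (g z - maxwellian V z)
    have h5 := le_abs_self (|g z| ^ 2 * (maxwellian V z)⁻¹ - g z)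
    rw [abs_le]
    constructor
    · linarith [abs_nonneg (|g z| ^ 2 * (maxwellian V z)⁻¹ - g z)]
    · linarith [abs_nonneg (g z - maxwellian V z)]
  refine ⟨hint, ?_, ?_⟩
  · have h2 := integral_mono_ae (hi.sub hMi) hint hlow
    have h3 : ∫ z, (⇑g - maxwellian V) z = 0 := by
      rw [integral_sub' hi hMi, hM1, ← hm, h1, sub_self]
    rw [h3] at h2
    exact h2
  · have h2 := integral_mono_ae hint (hi2.sub hi) hup
    have h3 : ∫ z, ((fun z => |g z| ^ 2 * (maxwellian V z)⁻¹) - ⇑g) z = ‖g‖ ^ 2 - 1 := by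
      rw [integral_sub' hi2 hi, ← hn, ← hm, h1]
    rw [h3] at h2
    rw [distSq, h1]
    exact h2.trans_eq (by ring)

/-- Conservation of mass. -/
theorem IsMild.inner_equil_eq (hV : IsConfining V) {γ : ℝ} {f₀ : B2 ℝ V}
    {f : C(ℝ≥0, B2 ℝ V)} (hf : IsMild (kineticGraph hV γ) f₀ f) (t : ℝ≥0) :
    ⟪f t, equil V⟫ = ⟪f₀, equil V⟫ := by
  have hG : ∀ p ∈ kineticGraph hV γ, ⟪p.2, equil V⟫ = 0 := by
    refine kineticGraph_induction hV γ (S := {p | ⟪p.2, equil V⟫ = 0})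
      (isClosed_eq (by fun_prop) continuous_const) fun φ => ?_
    simp only [Set.mem_ofPred_eq]
    rw [kineticLin_apply, inner_add_left, inner_transportLin_equil, real_inner_smul_left,
      inner_sub_left, proj_symm, proj_equil]
    ring
  -- the linear functional and its opposite both do not increase
  have h1 : ∀ c : ℝ, ⟪f t, c • equil V⟫ ≤ ⟪f₀, c • equil V⟫ := fun c => by
    have := hf.lyapunov (Φ := fun y => ⟪y, c • equil V⟫)
      (Φ' := fun _ => (innerSL ℝ (c • equil V))) (fun y => by
        have := (innerSL ℝ (c • equil V)).hasFDerivAt (x := y)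
        exact this.congr_of_eventuallyEq (Eventually.of_forall fun z => by
          rw [innerSL_apply_apply, real_inner_comm])) (κ := 0) (fun p hp => by
        rw [innerSL_apply_apply, real_inner_comm, real_inner_smul_right, hG p hp]; simp) t
    simpa using this
  have h2 := h1 1
  have h3 := h1 (-1)
  simp only [one_smul, neg_smul, inner_neg_right] at h2 h3
  linarith

variable (d) in
/-- The constant `A` of the decay rate `α ^ 2 / A`. -/
def entropyDecayConstant (γ C : ℝ) : ℝ := decayConstant γ γ⁻¹ (transportBound d γ C)

theorem entropyDecayConstant_pos {γ : ℝ} (hγ : 0 < γ) (C : ℝ) : 0 < entropyDecayConstant d γ C :=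
  decayConstant_pos hγ (inv_nonneg.2 hγ.le) _

theorem existsUnique_isSolution (hV : IsConfining V) {γ α : ℝ} (hγ : 0 < γ) {C : ℝ}
    (hC0 : 0 ≤ C) (hC : ∀ x, ‖iteratedFDeriv ℝ 2 V x‖ ≤ C) (hgap : HasSpectralGap V γ α)
    (f₀ : B2 ℝ V) : ∃! f : C(ℝ≥0, B2 ℝ V), IsSolution V γ f₀ f := by
  simp only [isSolution_iff hV]
  obtain ⟨f, hf⟩ := exists_isMild_kineticGraph hV hγ hC0 hC hgap f₀
  exact ⟨f, hf, fun g hg => hg.eq_of_dissipative (kineticGraph_dissipative hV hγ.le) hf⟩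

theorem IsSolution.nonneg_and_relEntropy_le (hV : IsConfining V) {γ α : ℝ} (hγ : 0 < γ) {C : ℝ}
    (hC0 : 0 ≤ C) (hC : ∀ x, ‖iteratedFDeriv ℝ 2 V x‖ ≤ C) (hgap : HasSpectralGap V γ α)
    {f₀ : B2 ℝ V} (hf₀ : ∫ z, |f₀ z| = 1) (hpos : ∀ᵐ z, 0 ≤ f₀ z) {f : C(ℝ≥0, B2 ℝ V)}
    (hf : IsSolution V γ f₀ f) (t : ℝ≥0) :
    (∀ᵐ z, 0 ≤ f t z) ∧ Integrable (entropyDensity V (f t)) ∧ 0 ≤ relEntropy V (f t) ∧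
      relEntropy V (f t) ≤ 3 * b2Norm V f₀ * b2Norm V (fun z => f₀ z - maxwellian V z) *
        Real.exp (-(α ^ 2 * t / entropyDecayConstant d γ C)) := by
  rw [isSolution_iff hV] at hf
  have hpos_t := (ae_weight_iff hV).1 (hf.nonneg hV hγ.le ((ae_weight_iff hV).2 hpos) t)
  have hmass₀ : ⟪f₀, equil V⟫ = 1 := by
    rw [(inner_equil hV f₀).2, ← hf₀]
    refine integral_congr_ae ?_
    filter_upwards [hpos] with z hz
    rw [abs_of_nonneg hz]
  have hmass : ⟪f t, equil V⟫ = 1 := (hf.inner_equil_eq hV t).trans hmass₀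
  obtain ⟨h1, h2, h3⟩ := relEntropy_bounds hV hpos_t hmass
  refine ⟨hpos_t, h1, h2, h3.trans ((distSq_le hV hγ hC0 hC hgap hf t).trans ?_)⟩
  have h4 : distSq (equil V) f₀ ≤ ‖f₀‖ * ‖f₀ - equil V‖ := by
    have h5 : distSq (equil V) f₀ = ⟪f₀, f₀ - equil V⟫ := by
      rw [distSq, inner_sub_right, hmass₀, real_inner_self_eq_norm_sq]; ring
    rw [h5]; exact real_inner_le_norm _ _
  rw [norm_eq_b2Norm hV, norm_sub_equil hV] at h4
  rw [← entropyDecayConstant]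
  set A := entropyDecayConstant d γ C
  have h5 : -(α ^ 2 / A) * (t : ℝ) = -(α ^ 2 * t / A) := by ring
  rw [h5]
  calc 3 * Real.exp (-(α ^ 2 * t / A)) * distSq (equil V) f₀
      ≤ 3 * Real.exp (-(α ^ 2 * t / A)) *
        (b2Norm V f₀ * b2Norm V fun z => f₀ z - maxwellian V z) := by gcongr
    _ = _ := by ring

end Entropy

end RelaxationBoltzmann

end

theorem corollary1p2 (d : ℕ) (γ : ℝ) (hγ : 0 < γ) (C₂ C₃ : ℝ) :
    ∃ A : ℝ, 0 < A ∧
      ∀ V : RelaxationBoltzmann.E d → ℝ, RelaxationBoltzmann.IsConfining V →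
        (∀ x, ‖iteratedFDeriv ℝ 2 V x‖ ≤ C₂) → (∀ x, ‖iteratedFDeriv ℝ 3 V x‖ ≤ C₃) →
      ∀ α : ℝ, RelaxationBoltzmann.HasSpectralGap V γ α →
      ∀ f₀ : RelaxationBoltzmann.B2 ℝ V,
        (∫ z, |f₀ z|) = 1 → (∀ᵐ z, 0 ≤ f₀ z) →
        (∃! f : C(ℝ≥0, RelaxationBoltzmann.B2 ℝ V), RelaxationBoltzmann.IsSolution V γ f₀ f) ∧
        ∀ f : C(ℝ≥0, RelaxationBoltzmann.B2 ℝ V), RelaxationBoltzmann.IsSolution V γ f₀ f →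
          ∀ t : ℝ≥0,
            (∀ᵐ z, 0 ≤ f t z) ∧
            Integrable (RelaxationBoltzmann.entropyDensity V (f t)) ∧
            0 ≤ RelaxationBoltzmann.relEntropy V (f t) ∧
            RelaxationBoltzmann.relEntropy V (f t) ≤
              3 * RelaxationBoltzmann.b2Norm V f₀ *
                RelaxationBoltzmann.b2Norm V (fun z => f₀ z - RelaxationBoltzmann.maxwellian V z) *
                Real.exp (-(α ^ 2 * t / A)) := by
  refine ⟨RelaxationBoltzmann.entropyDecayConstant d γ |C₂|,
    RelaxationBoltzmann.entropyDecayConstant_pos hγ _, ?_⟩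
  intro V hV hV2 _ α hgap f₀ hf₀ hpos
  have hC : ∀ x, ‖iteratedFDeriv ℝ 2 V x‖ ≤ |C₂| := fun x => (hV2 x).trans (le_abs_self _)
  exact ⟨RelaxationBoltzmann.existsUnique_isSolution hV hγ (abs_nonneg _) hC hgap f₀, fun f hf t =>
    hf.nonneg_and_relEntropy_le hV hγ (abs_nonneg _) hC hgap hf₀ hpos t⟩
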